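/- Let $\mathcal X$ be a compact smooth $n$-dimensional (Riemannian) manifold without boundary with a smooth positive volume density $dx$, and let $E^0,\dots,E^N$ be smooth vector bundles over $\mathcal X$ of finite rank with smooth fibre metrics (real bundles; a complex Hermitian bundle is included, regarded as a real bundle with the real part of its metric); put $E^j=0$ for $j<0$ and $j>N$. Write $(u,v)_j=\int_{\mathcal X}(u,v)_{x,j}\,dx$ for sections of $E^j$. Let $$0\to C^\infty_{E^0}(\mathcal X)\xrightarrow{A^0}C^\infty_{E^1}(\mathcal X)\xrightarrow{A^1}\cdots\xrightarrow{A^{N-1}}C^\infty_{E^N}(\mathcal X)\to 0$$ be an elliptic complex of first order differential operators with smooth coefficients: $A^{j+1}A^j=0$, and with the formal adjoints $(A^j)^*$ the Laplacians $\Delta^j=(A^j)^*A^j+A^{j-1}(A^{j-1})^*$ are strongly elliptic of second order. Let $\mathcal H^j=\{h\in C^\infty_{E^j}(\mathcal X): A^jh=0,\ (A^{j-1})^*h=0\}$. Fix $0\le i\le N$, $\mu>0$, $0<T<\infty$, and for each $x\in\mathcal X$ bilinear maps $\mathcal M_{1,x}:E^{i+1}_x\times E^i_x\to E^i_x$ and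 $\mathcal M_{2,x}:E^i_x\times E^i_x\to E^{i-1}_x$ such that, with constants $c_1,c_2$, $$|\mathcal M_{1,x}(v,u)|\le c_1|u||v|,\qquad |\mathcal M_{2,x}(w,u)|\le c_2|u||w|\qquad\text{for all }x\in\mathcal X,\ v\in E^{i+1}_x,\ u,w\in E^i_x .$$ Put $\mathcal N(u)=\mathcal M_1(A^iu,u)+A^{i-1}\mathcal M_2(u,u)$, where $A^{i-1}$ is applied to $\mathcal M_2(u,u)$ in the sense of distributions. Let $f$ be a continuous section of $E^i$ over $\mathcal X\times[0,T]$ (that is, $f(\cdot,t)$ is a section of $E^i$ for each $t$, jointly continuous in $(x,t)$), and let $u_0$ be a continuous section of $E^i$ over $\mathcal X$ with $(A^{i-1})^*u_0=0$ in the sense of distributions. Then there is at most one pair $(u,p)$ such that 1. $u$ is a section of $E^i$ over $\mathcal X\times[0,T]$ for which $\partial_tu$ and all derivatives of $u$ in $x$ of order at most $2$ exist and are continuous on $\mathcal X\times[0,T]$ (the class $C^{2,0,1,0}$); 2. $p$ is a continuous section of $E^{i-1}$ over $\mathcal X\times[0,T]$ such that $A^{i-1}p$, in the sense of distributions on $\mathcal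 X$ for each $t$, is a continuous section of $E^i$ over $\mathcal X\times[0,T]$; 3. $\partial_tu+\mu\Delta^iu+\mathcal N(u)+A^{i-1}p=f$ in $\mathcal X\times(0,T)$; 4. $(A^{i-1})^*u(\cdot,t)=0$ and $(A^{i-2})^*p(\cdot,t)=0$ in the sense of distributions on $\mathcal X$ for every $t\in[0,T]$; 5. $u(\cdot,0)=u_0$ on $\mathcal X$; 6. $(p(\cdot,t),h)_{i-1}=0$ for every $h\in\mathcal H^{i-1}$ and every $t\in[0,T]$. That is, if $(u',p')$ and $(u'',p'')$ both satisfy 1–6, then $u'=u''$ and $p'=p''$ on $\mathcal X\times[0,T]$. -/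

import Mathlib

open Set MeasureTheory Bundle Manifold
open scoped ContDiff Manifold Topology

noncomputable section

namespace NavierStokesComplex

/-- The model space `ℝⁿ` with its Euclidean norm. -/
abbrev Model (n : ℕ) : Type := EuclideanSpace ℝ (Fin n)

/-- `vol` is given by a volume form on the manifold `X`: in every chart of the atlas around a point
it is Lebesgue measure times a smooth, strictly positive density. (The Riemannian volume measure of
any Riemannian metric on `X` is of this kind.) -/
def IsSmoothDensity (n : ℕ) {X : Type*} [TopologicalSpace X] [ChartedSpace (Model n) X]
    [MeasurableSpace X] (vol : Measure X) : Prop :=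
  ∀ x₀ : X, ∃ ρ : Model n → ℝ,
    ContDiffOn ℝ ∞ ρ (chartAt (Model n) x₀).target ∧
    (∀ y ∈ (chartAt (Model n) x₀).target, 0 < ρ y) ∧
    ∀ s : Set (Model n), MeasurableSet s → s ⊆ (chartAt (Model n) x₀).target →
      vol ((chartAt (Model n) x₀).symm '' s) = ∫⁻ y in s, ENNReal.ofReal (ρ y)

/-! Sections of vector bundles. All bundles are real; a complex vector bundle with a Hermitian
fibre metric is covered as a real bundle (of twice the rank) with the real part of that metric:
complex linear operators, their formal adjoints, ellipticity, orthogonality to a complex subspace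
and complex bilinear maps are then real ones. -/

section Bundles

variable (n : ℕ) {X : Type*} [TopologicalSpace X] [ChartedSpace (Model n) X]

section OneBundle

variable (F : Type*) [NormedAddCommGroup F] [NormedSpace ℝ F]
  {E : X → Type*} [TopologicalSpace (TotalSpace F E)]
  [∀ x, NormedAddCommGroup (E x)] [∀ x, InnerProductSpace ℝ (E x)] [FiberBundle F E]

/-- `u` is a `C^∞` section. -/
def IsSmoothSection (u : ∀ x, E x) : Prop :=
  ContMDiff (𝓡 n) ((𝓡 n).prod 𝓘(ℝ, F)) ∞ (fun x => TotalSpace.mk' F x (u x))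

variable (E) in
/-- The part of the coordinate patch around `x₀` over which the preferred trivialization of the
bundle around `x₀` is defined (an open subset of `ℝⁿ`). -/
def coordDomain (x₀ : X) : Set (Model n) :=
  (chartAt (Model n) x₀).target ∩
    (chartAt (Model n) x₀).symm ⁻¹' (trivializationAt F E x₀).baseSet

/-- The section `u` written in the coordinates and in the trivialization around `x₀`, as a
function with values in the model fibre (meaningful on `coordDomain`). -/
def localRep (x₀ : X) (u : ∀ x, E x) (y : Model n) : F :=
  (trivializationAt F E x₀
    (TotalSpace.mk' F ((chartAt (Model n) x₀).symm y) (u ((chartAt (Model n) x₀).symm y)))).2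

/-- `u` is a continuous section over the cylinder `X × [0,T]`: the class `C^{0,0,0,0}`.
(As `X × [0,T]` is compact, its norm is automatically finite.) -/
def IsC0 (T : ℝ) (u : ℝ → ∀ x, E x) : Prop :=
  ContinuousOn (fun q : ℝ × X => TotalSpace.mk' F q.2 (u q.1 q.2)) (Icc 0 T ×ˢ univ)

/-- The time derivative `∂_t u` on `[0,T]` (one-sided at the end points). -/
def timeDeriv (T : ℝ) (u : ℝ → ∀ x, E x) (t : ℝ) (x : X) : E x :=
  derivWithin (fun s => u s x) (Icc 0 T) t

/-- The class `C^{2,0,1,0}` on `X × [0,T]`: `∂_t u` exists and is continuous on `X × [0,T]`, and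
so are the derivatives of order at most two with respect to the space variables (in the local
coordinates and trivializations). -/
structure IsC2010 (T : ℝ) (u : ℝ → ∀ x, E x) : Prop where
  differentiable_time : ∀ x, DifferentiableOn ℝ (fun s => u s x) (Icc 0 T)
  continuous_timeDeriv : IsC0 F T (timeDeriv T u)
  contMDiff_space : ∀ t ∈ Icc 0 T,
    ContMDiff (𝓡 n) ((𝓡 n).prod 𝓘(ℝ, F)) 2 (fun x => TotalSpace.mk' F x (u t x))
  continuous_space : ∀ x₀ : X, ∀ m : ℕ, m ≤ 2 →
    ContinuousOn (fun q : ℝ × Model n => iteratedFDeriv ℝ m (localRep n F x₀ (u q.1)) q.2)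
      (Icc 0 T ×ˢ coordDomain n F E x₀)

/-- Strong ellipticity of a second order differential operator `P` acting on the sections of a
bundle with fibre metric. For a function `φ` with `φ x = 0` the vector `P (φ² u) x` is twice the
second order part of `P` at `x` with `∂` replaced by `dφ x`, applied to `u x`; strong ellipticity
says that this quadratic form is negative definite for every covector `dφ x ≠ 0`
(for the Laplacian `-∑ ∂_k²` it is `-2 |dφ x|² |u x|²`). -/
def IsStronglyElliptic (P : (∀ x, E x) → ∀ x, E x) : Prop :=
  ∀ (x : X) (φ : X → ℝ) (u : ∀ x, E x), ContMDiff (𝓡 n) 𝓘(ℝ, ℝ) ∞ φ → IsSmoothSection n F u →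
    φ x = 0 → mfderiv (𝓡 n) 𝓘(ℝ, ℝ) φ x ≠ 0 → u x ≠ 0 →
    inner ℝ (P (fun x' => (φ x') ^ 2 • u x') x) (u x) < 0

end OneBundle

section TwoBundles

variable (F₁ : Type*) [NormedAddCommGroup F₁] [NormedSpace ℝ F₁]
  (E₁ : X → Type*) [TopologicalSpace (TotalSpace F₁ E₁)]
  [∀ x, NormedAddCommGroup (E₁ x)] [∀ x, InnerProductSpace ℝ (E₁ x)] [FiberBundle F₁ E₁]
  (F₂ : Type*) [NormedAddCommGroup F₂] [NormedSpace ℝ F₂]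
  (E₂ : X → Type*) [TopologicalSpace (TotalSpace F₂ E₂)]
  [∀ x, NormedAddCommGroup (E₂ x)] [∀ x, InnerProductSpace ℝ (E₂ x)] [FiberBundle F₂ E₂]

/-- A linear differential operator of first order with smooth coefficients between the bundles
`E₁` and `E₂`. In local coordinates and trivializations it is `u ↦ ∑ a_k ∂_k u + b u` with smooth
matrices `a_k`, `b`; here `∑ a_k ∂_k u` is written as a linear map applied to the derivative.
(The value at `x` of the operator on a section that is not differentiable at `x` is not specified;
such values are never used.) -/
structure FirstOrderOp where
  toFun : (∀ x, E₁ x) → ∀ x, E₂ x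
  local_formula : ∀ x₀ : X,
    ∃ (a : Model n → (Model n →L[ℝ] F₁) →L[ℝ] F₂) (b : Model n → F₁ →L[ℝ] F₂),
      ContDiffOn ℝ ∞ a (coordDomain n F₁ E₁ x₀ ∩ coordDomain n F₂ E₂ x₀) ∧
      ContDiffOn ℝ ∞ b (coordDomain n F₁ E₁ x₀ ∩ coordDomain n F₂ E₂ x₀) ∧
      ∀ (u : ∀ x, E₁ x), ∀ y ∈ coordDomain n F₁ E₁ x₀ ∩ coordDomain n F₂ E₂ x₀,
        DifferentiableAt ℝ (localRep n F₁ x₀ u) y →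
        localRep n F₂ x₀ (toFun u) y =
          a y (fderiv ℝ (localRep n F₁ x₀ u) y) + b y (localRep n F₁ x₀ u y)

instance : CoeFun (FirstOrderOp n F₁ E₁ F₂ E₂) (fun _ => (∀ x, E₁ x) → ∀ x, E₂ x) :=
  ⟨FirstOrderOp.toFun⟩

variable {n F₁ E₁ F₂ E₂} [MeasurableSpace X]

/-- `As` is the formal adjoint of `A`: `(A u, v) = (u, As v)` in `L²` for all smooth `u`, `v`. -/
def IsFormalAdjoint (vol : Measure X) (A : FirstOrderOp n F₁ E₁ F₂ E₂)
    (As : FirstOrderOp n F₂ E₂ F₁ E₁) : Prop :=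
  ∀ (u : ∀ x, E₁ x) (v : ∀ x, E₂ x), IsSmoothSection n F₁ u → IsSmoothSection n F₂ v →
    ∫ x, inner ℝ (A u x) (v x) ∂vol = ∫ x, inner ℝ (u x) (As v x) ∂vol

/-- `A v = w` in the sense of distributions on `X`, where `As` is the formal adjoint of `A`:
`(w, φ) = (v, As φ)` for all smooth sections `φ`. Both integrals are required to exist, which is
automatic for continuous `v` and `w`. -/
def DistribEq (vol : Measure X) (As : FirstOrderOp n F₂ E₂ F₁ E₁)
    (v : ∀ x, E₁ x) (w : ∀ x, E₂ x) : Prop :=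
  ∀ φ : ∀ x, E₂ x, IsSmoothSection n F₂ φ →
    Integrable (fun x => inner ℝ (w x) (φ x)) vol ∧
    Integrable (fun x => inner ℝ (v x) (As φ x)) vol ∧
    ∫ x, inner ℝ (w x) (φ x) ∂vol = ∫ x, inner ℝ (v x) (As φ x) ∂vol

end TwoBundles

end Bundles

section Complex

variable {n : ℕ} {X : Type*} [TopologicalSpace X] [ChartedSpace (Model n) X] [MeasurableSpace X]
  {F : ℤ → Type*} [∀ j, NormedAddCommGroup (F j)] [∀ j, NormedSpace ℝ (F j)]
  {E : ℤ → X → Type*} [∀ j, TopologicalSpace (TotalSpace (F j) (E j))]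
  [∀ j x, NormedAddCommGroup (E j x)] [∀ j x, InnerProductSpace ℝ (E j x)]
  [∀ j, FiberBundle (F j) (E j)]

variable (n F E) in
/-- An elliptic complex `0 → C^∞(E⁰) → C^∞(E¹) → ⋯ → C^∞(E^N) → 0` of first order differential
operators. The bundles are indexed by `ℤ` and vanish outside `0, …, N`. For `k = j + 1`, `d j k _`
is the operator `A^j` from `E^j` to `E^{j+1}` and `dstar j k _` is its formal adjoint `(A^j)^*`
with respect to `vol` and the fibre metrics. Consecutive operators compose to zero, and the
Laplacians `(A^j)^* A^j + A^{j-1} (A^{j-1})^*` are strongly elliptic. -/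
structure EllipticComplex (vol : Measure X) (N : ℕ) where
  d : ∀ j k : ℤ, j + 1 = k → FirstOrderOp n (F j) (E j) (F k) (E k)
  dstar : ∀ j k : ℤ, j + 1 = k → FirstOrderOp n (F k) (E k) (F j) (E j)
  isFormalAdjoint : ∀ (j k : ℤ) (h : j + 1 = k), IsFormalAdjoint vol (d j k h) (dstar j k h)
  subsingleton_outside : ∀ j : ℤ, j < 0 ∨ (N : ℤ) < j → ∀ x, Subsingleton (E j x)
  d_comp_d : ∀ (j k l : ℤ) (h : j + 1 = k) (h' : k + 1 = l) (u : ∀ x, E j x),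
    IsSmoothSection n (F j) u → ∀ x, d k l h' (d j k h u) x = 0
  stronglyElliptic : ∀ j : ℤ, IsStronglyElliptic n (F j) (E := E j)
    (fun u x => dstar j (j + 1) rfl (d j (j + 1) rfl u) x +
      d (j - 1) j (sub_add_cancel j 1) (dstar (j - 1) j (sub_add_cancel j 1) u) x)

namespace EllipticComplex

variable {vol : Measure X} {N : ℕ} (C : EllipticComplex n F E vol N)

/-- The operator `A^j : E^j → E^{j+1}`. -/
def A (j : ℤ) : FirstOrderOp n (F j) (E j) (F (j + 1)) (E (j + 1)) := C.d j (j + 1) rfl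

/-- The operator `(A^j)^* : E^{j+1} → E^j`. -/
def Astar (j : ℤ) : FirstOrderOp n (F (j + 1)) (E (j + 1)) (F j) (E j) := C.dstar j (j + 1) rfl

/-- The operator `A^{j-1} : E^{j-1} → E^j`. -/
def Aprev (j : ℤ) : FirstOrderOp n (F (j - 1)) (E (j - 1)) (F j) (E j) :=
  C.d (j - 1) j (sub_add_cancel j 1)

/-- The operator `(A^{j-1})^* : E^j → E^{j-1}`. -/
def AprevStar (j : ℤ) : FirstOrderOp n (F j) (E j) (F (j - 1)) (E (j - 1)) :=
  C.dstar (j - 1) j (sub_add_cancel j 1)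

/-- The Laplacian `Δ^j = (A^j)^* A^j + A^{j-1} (A^{j-1})^*`. -/
def laplacian (j : ℤ) (u : ∀ x, E j x) (x : X) : E j x :=
  C.Astar j (C.A j u) x + C.Aprev j (C.AprevStar j u) x

/-- `h` belongs to the harmonic space `ℋ^j` of smooth sections with `A^j h = 0` and
`(A^{j-1})^* h = 0`. -/
def IsHarmonic (j : ℤ) (h : ∀ x, E j x) : Prop :=
  IsSmoothSection n (F j) h ∧ (∀ x, C.A j h x = 0) ∧ ∀ x, C.AprevStar j h x = 0

/-- `u` belongs to `𝒮_{(A^{j-1})^*}`, i.e. `(A^{j-1})^* u = 0` in the sense of distributions. -/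
def InKerAprevStar (j : ℤ) (u : ∀ x, E j x) : Prop :=
  DistribEq vol (C.Aprev j) u (fun _ => 0)

/-- `z` is the section `𝒩^j(v) = M₁(A^j v, v) + A^{j-1} M₂(v, v)`, where `A^{j-1}` is applied to
`M₂(v, v)` in the sense of distributions. (If `M₂(v, v)` is continuously differentiable, this is
the classical expression.) -/
def IsNonlinearity (j : ℤ) (M₁ : ∀ x, E (j + 1) x →ₗ[ℝ] E j x →ₗ[ℝ] E j x)
    (M₂ : ∀ x, E j x →ₗ[ℝ] E j x →ₗ[ℝ] E (j - 1) x) (v z : ∀ x, E j x) : Prop :=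
  ∃ w : ∀ x, E j x, DistribEq vol (C.AprevStar j) (fun x => M₂ x (v x) (v x)) w ∧
    ∀ x, z x = M₁ x (C.A j v x) (v x) + w x

/-- `(u, p)` is a solution of the Navier-Stokes type equations with data `(f, u₀)`
* `∂_t u + μ Δ^i u + 𝒩^i(u) + A^{i-1} p = f` in `X × (0,T)`,
* `(A^{i-1})^* u = 0` and `(A^{i-2})^* p = 0` in `X × [0,T]`,
* `u(·,0) = u₀` in `X`,

such that `u` is of class `C^{2,0,1,0}`, `p` and its distributional image `A^{i-1} p = q` are
continuous on `X × [0,T]`, and `p(·,t)` is `L²`-orthogonal to `ℋ^{i-1}` for all `t`. -/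
structure IsSolution (i : ℤ) (M₁ : ∀ x, E (i + 1) x →ₗ[ℝ] E i x →ₗ[ℝ] E i x)
    (M₂ : ∀ x, E i x →ₗ[ℝ] E i x →ₗ[ℝ] E (i - 1) x) (μ T : ℝ)
    (f : ℝ → ∀ x, E i x) (u₀ : ∀ x, E i x)
    (u : ℝ → ∀ x, E i x) (p : ℝ → ∀ x, E (i - 1) x) : Prop where
  regular_u : IsC2010 n (F i) T u
  div_u : ∀ t ∈ Icc 0 T, C.InKerAprevStar i (u t)
  continuous_p : IsC0 (F (i - 1)) T p
  div_p : ∀ t ∈ Icc 0 T, C.InKerAprevStar (i - 1) (p t)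
  orthogonal_p : ∀ t ∈ Icc 0 T, ∀ h : ∀ x, E (i - 1) x, C.IsHarmonic (i - 1) h →
    ∫ x, inner ℝ (p t x) (h x) ∂vol = 0
  initial : ∀ x, u 0 x = u₀ x
  equation : ∃ q : ℝ → ∀ x, E i x, IsC0 (F i) T q ∧
    (∀ t ∈ Icc 0 T, DistribEq vol (C.AprevStar i) (p t) (q t)) ∧
    ∀ t ∈ Ioo 0 T, ∃ z : ∀ x, E i x, C.IsNonlinearity i M₁ M₂ (u t) z ∧
      ∀ x, timeDeriv T u t x + μ • C.laplacian i (u t) x + z x + q t x = f t x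

end EllipticComplex

end Complex

end NavierStokesComplex

end

/-!
Uniqueness for Navier-Stokes type equations attached to an elliptic complex.

*Velocity.* Let `u = u' - u''`. Both velocities are of class `C²` in space, so they are annihilated by
`(A^{i-1})^*` pointwise (`IsFormalAdjoint.apply_eq_zero`). When the difference of the two equations
is paired with `u` in `L²`, the pressure terms and the distributional terms `A^{i-1} M₂(u, u)` drop
out, because they are weak `A^{i-1}`-images; the Laplacian contributes `μ ‖A^i u‖²`; and the
difference of the terms `M₁(A^i u, u)` is pointwise at most `μ |A^i u|² + c |u|²`, as `u'` and
`A^i u''` are bounded. Hence `d/dt ‖u‖² ≤ c ‖u‖²` (`EllipticComplex.energy_inequality`) and `u = 0`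
by Gronwall's lemma (`EllipticComplex.IsSolution.velocity_unique`).

The sections used as test sections are only of class `C¹` or `C²`, whereas formal adjoints and
distributions are tested with smooth sections. The gap is closed by approximating a `C¹` section
uniformly, together with its image under a first order operator, by smooth sections
(`FirstOrderOp.exists_smooth_approx`).

*Pressure.* Once the velocities agree, `p = p' - p''` is continuous and satisfies `A^{i-1} p = 0` and
`(A^{i-2})^* p = 0` in the sense of distributions. By elliptic regularity it is smooth, therefore
harmonic, and it vanishes since it is orthogonal to all harmonic sections
(`EllipticComplex.eq_zero_of_orthogonal_harmonic`, `EllipticComplex.IsSolution.pressure_unique`).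

*Elliptic regularity.* In a chart, `p` is a weak solution of an overdetermined first order system in
divergence form whose symbol is injective at the centre of the chart: strong ellipticity of the
Laplacian says that no vector is orthogonal to the ranges of the symbols of both operators
(`IsStronglyElliptic.eq_zero_of_inner_symbol`). For such a system, continuous weak solutions are
smooth (`IsWeakSol.contDiffAt`). This is proved from Plancherel's theorem: a constant coefficient
estimate, perturbed on a small ball, bounds the mollified solutions in `H¹` uniformly (Friedrichs'
commutator lemma), so that weak derivatives exist; these solve a system of the same type, and
iteration gives weak derivatives of all orders in `L²`, hence smoothness.
-/

open Set MeasureTheory Bundle Manifold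
open scoped ContDiff Manifold Topology

noncomputable section

namespace NavierStokesComplex

/-! ### Partial derivatives and test functions -/

section Scalar

variable {n : ℕ}

/-- The `k`-th partial derivative of a function on `ℝⁿ`. -/
def pd (k : Fin n) (f : Model n → ℝ) (y : Model n) : ℝ :=
  fderiv ℝ f y (EuclideanSpace.single k 1)

/-- `φ` is a test function on `U`: smooth, with compact support contained in `U`. -/
structure IsTest (U : Set (Model n)) (φ : Model n → ℝ) : Prop where
  contDiff : ContDiff ℝ ∞ φ
  hasCompactSupport : HasCompactSupport φ
  tsupport_subset : tsupport φ ⊆ U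

lemma pd_eq_zero_of_notMem_tsupport {k : Fin n} {f : Model n → ℝ} {y : Model n}
    (hy : y ∉ tsupport f) : pd k f y = 0 := by
  have : fderiv ℝ f y = 0 := by
    by_contra h
    exact hy (support_fderiv_subset ℝ h)
  simp [pd, this]

lemma tsupport_pd_subset (k : Fin n) (f : Model n → ℝ) : tsupport (pd k f) ⊆ tsupport f := by
  refine closure_minimal (fun y hy => ?_) (isClosed_tsupport f)
  by_contra h
  exact hy (pd_eq_zero_of_notMem_tsupport h)

lemma contDiff_pd {f : Model n → ℝ} (hf : ContDiff ℝ ∞ f) (k : Fin n) : ContDiff ℝ ∞ (pd k f) :=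
  (hf.fderiv_right (m := ∞) le_rfl).clm_apply contDiff_const

lemma hasCompactSupport_pd {f : Model n → ℝ} (hf : HasCompactSupport f) (k : Fin n) :
    HasCompactSupport (pd k f) :=
  hf.of_isClosed_subset (isClosed_tsupport _) (tsupport_pd_subset k f)

lemma contDiffOn_pd {U : Set (Model n)} (hU : IsOpen U) {f : Model n → ℝ}
    (hf : ContDiffOn ℝ ∞ f U) (k : Fin n) : ContDiffOn ℝ ∞ (pd k f) U :=
  (hf.fderiv_of_isOpen hU (m := ∞) le_rfl).clm_apply contDiffOn_const

lemma pd_mul {f g : Model n → ℝ} {y : Model n} (hf : DifferentiableAt ℝ f y)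
    (hg : DifferentiableAt ℝ g y) (k : Fin n) :
    pd k (fun y => f y * g y) y = f y * pd k g y + g y * pd k f y := by
  simp [pd, fderiv_fun_mul hf hg]

lemma pd_comm {f : Model n → ℝ} (hf : ContDiff ℝ ∞ f) (k l : Fin n) :
    pd k (pd l f) = pd l (pd k f) := by
  have hd : ∀ y, DifferentiableAt ℝ (fderiv ℝ f) y := fun y =>
    ((hf.fderiv_right (m := ∞) le_rfl).differentiable (by simp)) y
  have h : ∀ (k l : Fin n) (y : Model n), pd k (pd l f) y =
      fderiv ℝ (fderiv ℝ f) y (EuclideanSpace.single k 1) (EuclideanSpace.single l 1) := by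
    intro k l y
    have : pd l f = fun z => fderiv ℝ f z (EuclideanSpace.single l 1) := rfl
    rw [this, pd, fderiv_clm_apply (hd y) (differentiableAt_const _)]
    simp
  funext y
  rw [h, h]
  exact (hf.contDiffAt.isSymmSndFDerivAt (by simpa using WithTop.coe_le_coe.2 (le_top : (2 : ℕ∞) ≤ ⊤))) _ _

/-- Expansion of the derivative in the partial derivatives. -/
lemma fderiv_eq_sum_pd (f : Model n → ℝ) (y ξ : Model n) :
    fderiv ℝ f y ξ = ∑ k, ξ k * pd k f y := by
  conv_lhs => rw [← (EuclideanSpace.basisFun (Fin n) ℝ).sum_repr ξ]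
  simp [pd]

lemma integral_pd_mul {f g : Model n → ℝ} (hf : ContDiff ℝ ∞ f) (hg : ContDiff ℝ ∞ g)
    (hc : HasCompactSupport g) (k : Fin n) :
    ∫ y, f y * pd k g y = -∫ y, pd k f y * g y := by
  have hf' := contDiff_pd hf k
  have hg' := contDiff_pd hg k
  apply integral_mul_fderiv_eq_neg_fderiv_mul_of_integrable (μ := (volume : Measure (Model n)))
  · exact (hf'.continuous.mul hg.continuous).integrable_of_hasCompactSupport hc.mul_left
  · exact (hf.continuous.mul hg'.continuous).integrable_of_hasCompactSupport
      (hasCompactSupport_pd hc k).mul_left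
  · exact (hf.continuous.mul hg.continuous).integrable_of_hasCompactSupport hc.mul_left
  · exact fun y _ => hf.differentiable (by simp) y
  · exact fun y _ => hg.differentiable (by simp) y

lemma IsTest.mono {U V : Set (Model n)} (h : U ⊆ V) {φ : Model n → ℝ} (hφ : IsTest U φ) :
    IsTest V φ := ⟨hφ.1, hφ.2, hφ.3.trans h⟩

lemma IsTest.pd {U : Set (Model n)} {φ : Model n → ℝ} (hφ : IsTest U φ) (k : Fin n) :
    IsTest U (pd k φ) :=
  ⟨contDiff_pd hφ.1 k, hasCompactSupport_pd hφ.2 k, (tsupport_pd_subset k φ).trans hφ.3⟩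

/-- The product of a test function on `U` with a function that is smooth on `U` is a test
function. -/
lemma IsTest.mul_contDiffOn {U : Set (Model n)} (hU : IsOpen U) {φ f : Model n → ℝ}
    (hφ : IsTest U φ) (hf : ContDiffOn ℝ ∞ f U) : IsTest U (fun y => f y * φ y) := by
  refine ⟨?_, hφ.2.mul_left, (tsupport_mul_subset_right).trans hφ.3⟩
  rw [contDiff_iff_contDiffAt]
  intro y
  by_cases hy : y ∈ U
  · exact (hf.contDiffAt (hU.mem_nhds hy)).mul hφ.1.contDiffAt
  · have h0 : (fun y => f y * φ y) =ᶠ[𝓝 y] fun _ => 0 := by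
      have : (tsupport φ)ᶜ ∈ 𝓝 y :=
        (isClosed_tsupport φ).isOpen_compl.mem_nhds fun h => hy (hφ.3 h)
      filter_upwards [this] with z hz
      simp [image_eq_zero_of_notMem_tsupport hz]
    exact contDiffAt_const.congr_of_eventuallyEq h0

/-! ### The a priori estimate with constant coefficients -/

/-- An injective symbol is bounded below: by compactness of the product of the unit spheres and
homogeneity. -/
lemma exists_symbol_bound {κ ι : Type*} [Fintype κ] [Fintype ι] (a : Fin n → κ → ι → ℝ)
    (ha : ∀ ξ : Fin n → ℝ, ξ ≠ 0 → ∀ η : ι → ℝ,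
      (∀ r, ∑ k, ∑ l, a k r l * ξ k * η l = 0) → η = 0) :
    ∃ c > 0, ∀ (ξ : Fin n → ℝ) (η : ι → ℝ),
      c * ((∑ k, ξ k ^ 2) * ∑ l, η l ^ 2) ≤ ∑ r, (∑ k, ∑ l, a k r l * ξ k * η l) ^ 2 := by
  let f : EuclideanSpace ℝ (Fin n) × EuclideanSpace ℝ ι → ℝ :=
    fun q => ∑ r, (∑ k, ∑ l, a k r l * q.1 k * q.2 l) ^ 2
  have hf : Continuous f := by fun_prop
  let K := Metric.sphere (0 : EuclideanSpace ℝ (Fin n)) 1 ×ˢ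
    Metric.sphere (0 : EuclideanSpace ℝ ι) 1
  have hK : IsCompact K := (isCompact_sphere _ _).prod (isCompact_sphere _ _)
  obtain ⟨c, hc, hcK⟩ : ∃ c > 0, ∀ q ∈ K, c ≤ f q := by
    rcases K.eq_empty_or_nonempty with h | h
    · exact ⟨1, one_pos, by simp [h]⟩
    · obtain ⟨q, hq, hmin⟩ := hK.exists_isMinOn h hf.continuousOn
      refine ⟨f q, ?_, fun q' hq' => hmin hq'⟩
      have h0 : 0 ≤ f q := Finset.sum_nonneg fun r _ => sq_nonneg _
      refine lt_of_le_of_ne h0 fun h => ?_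
      have h1 : ∀ r, ∑ k, ∑ l, a k r l * q.1 k * q.2 l = 0 := by
        intro r
        have := (Finset.sum_eq_zero_iff_of_nonneg (fun r _ => sq_nonneg _)).1 h.symm r
          (Finset.mem_univ r)
        exact pow_eq_zero_iff (two_ne_zero) |>.1 this
      have hq1 : ‖q.1‖ = 1 := by simpa using hq.1
      have hq2 : ‖q.2‖ = 1 := by simpa using hq.2
      have h2 := ha q.1 (fun h => by
        have : q.1 = 0 := by ext k; exact congrFun h k
        simp [this] at hq1) q.2 h1
      have : q.2 = 0 := by ext k; exact congrFun h2 k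
      simp [this] at hq2
  refine ⟨c, hc, fun ξ η => ?_⟩
  let ξ' : EuclideanSpace ℝ (Fin n) := WithLp.toLp 2 ξ
  let η' : EuclideanSpace ℝ ι := WithLp.toLp 2 η
  have e1 : ∑ k, ξ k ^ 2 = ‖ξ'‖ ^ 2 := by rw [EuclideanSpace.real_norm_sq_eq]
  have e2 : ∑ k, η k ^ 2 = ‖η'‖ ^ 2 := by rw [EuclideanSpace.real_norm_sq_eq]
  rw [e1, e2]
  by_cases h1 : ξ' = 0
  · simp only [h1, norm_zero]
    have : 0 ≤ ∑ r, (∑ k, ∑ l, a k r l * ξ k * η l) ^ 2 :=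
      Finset.sum_nonneg fun r _ => sq_nonneg _
    simpa using this
  by_cases h2 : η' = 0
  · simp only [h2, norm_zero]
    have : 0 ≤ ∑ r, (∑ k, ∑ l, a k r l * ξ k * η l) ^ 2 :=
      Finset.sum_nonneg fun r _ => sq_nonneg _
    simpa using this
  have h1' : ‖ξ'‖ ≠ 0 := norm_ne_zero_iff.2 h1
  have h2' : ‖η'‖ ≠ 0 := norm_ne_zero_iff.2 h2
  have hmem : (‖ξ'‖⁻¹ • ξ', ‖η'‖⁻¹ • η') ∈ K := by
    simp [K, norm_smul, h1', h2']
  have := hcK _ hmem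
  have e3 : f (‖ξ'‖⁻¹ • ξ', ‖η'‖⁻¹ • η') =
      (‖ξ'‖⁻¹ * ‖η'‖⁻¹) ^ 2 * ∑ r, (∑ k, ∑ l, a k r l * ξ k * η l) ^ 2 := by
    simp only [f, Finset.mul_sum, ← mul_pow]
    refine Finset.sum_congr rfl fun r _ => ?_
    congr 1
    refine Finset.sum_congr rfl fun k _ => Finset.sum_congr rfl fun l _ => ?_
    simp only [PiLp.smul_apply, smul_eq_mul, ξ', η']
    ring
  rw [e3] at this
  calc c * (‖ξ'‖ ^ 2 * ‖η'‖ ^ 2)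
      ≤ ((‖ξ'‖⁻¹ * ‖η'‖⁻¹) ^ 2 * ∑ r, (∑ k, ∑ l, a k r l * ξ k * η l) ^ 2) *
        (‖ξ'‖ ^ 2 * ‖η'‖ ^ 2) := by gcongr
    _ = _ := by field_simp

open scoped FourierTransform LineDeriv SchwartzMap in
/-- The a priori estimate for a system with constant coefficients and injective symbol: Plancherel
turns the derivatives into multiplications, and the symbol estimate holds pointwise. -/
lemma exists_const_coeff_estimate {κ ι : Type*} [Fintype κ] [Fintype ι] (a : Fin n → κ → ι → ℝ)
    (ha : ∀ ξ : Fin n → ℝ, ξ ≠ 0 → ∀ η : ι → ℝ,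
      (∀ r, ∑ k, ∑ l, a k r l * ξ k * η l = 0) → η = 0) :
    ∃ c > 0, ∀ u : ι → Model n → ℝ, (∀ l, ContDiff ℝ ∞ (u l)) → (∀ l, HasCompactSupport (u l)) →
      c * ∑ k, ∑ l, ∫ y, (pd k (u l) y) ^ 2 ≤
        ∑ r, ∫ y, (∑ k, ∑ l, a k r l * pd k (u l) y) ^ 2 := by
  obtain ⟨c, hc, hsym⟩ := exists_symbol_bound a ha
  refine ⟨c, hc, fun u hu hcs => ?_⟩
  let S : ι → 𝓢(Model n, ℂ) := fun l =>
    HasCompactSupport.toSchwartzMap (f := fun y => (u l y : ℂ))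
      ((hcs l).comp_left (g := ((↑) : ℝ → ℂ)) Complex.ofReal_zero)
      (Complex.ofRealCLM.contDiff.comp (hu l))
  let e : Fin n → Model n := fun k => EuclideanSpace.single k 1
  have hS : ∀ l k y, (∂_{e k} (S l)) y = (pd k (u l) y : ℂ) := by
    intro l k y
    rw [SchwartzMap.lineDerivOp_apply_eq_fderiv]
    have h1 : HasFDerivAt (fun y => (u l y : ℂ)) (Complex.ofRealCLM.comp (fderiv ℝ (u l) y)) y :=
      Complex.ofRealCLM.hasFDerivAt.comp y ((hu l).differentiable (by simp) y).hasFDerivAt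
    have : fderiv ℝ (S l) y = Complex.ofRealCLM.comp (fderiv ℝ (u l) y) := h1.fderiv
    rw [this]
    simp [pd, e]
  have hF : ∀ l k (ξ : Model n), 𝓕 (∂_{e k} (S l)) ξ = (2 * Real.pi * Complex.I) *
      ((ξ k : ℂ) * 𝓕 (S l) ξ) := by
    intro l k ξ
    rw [SchwartzMap.fourier_lineDerivOp_eq]
    have : (fun x : Model n => inner ℝ x (e k)).HasTemperateGrowth :=
      ((innerSL ℝ).flip (e k)).hasTemperateGrowth
    have h2 : inner ℝ ξ (EuclideanSpace.single k (1 : ℝ)) = ξ k := by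
      simp [EuclideanSpace.inner_single_right]
    simp [this, e, h2]
  let P : κ → 𝓢(Model n, ℂ) := fun r => ∑ k, ∑ l, (a k r l : ℂ) • ∂_{e k} (S l)
  have hP : ∀ r y, P r y = ((∑ k, ∑ l, a k r l * pd k (u l) y : ℝ) : ℂ) := by
    intro r y
    simp [P, hS]
  have hPF : ∀ r ξ, 𝓕 (P r) ξ = (2 * Real.pi * Complex.I) *
      ∑ k, ∑ l, (a k r l : ℂ) * (ξ k : ℂ) * 𝓕 (S l) ξ := by
    intro r ξ
    have : 𝓕 (P r) = ∑ k, ∑ l, (a k r l : ℂ) • 𝓕 (∂_{e k} (S l)) := by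
      change FourierTransform.fourierCLM ℂ 𝓢(Model n, ℂ) (P r) = _
      simp only [P, map_sum, map_smul]
      rfl
    rw [this]
    simp only [sum_apply, smul_apply, hF, smul_eq_mul, Finset.mul_sum]
    refine Finset.sum_congr rfl fun k _ => Finset.sum_congr rfl fun l _ => ?_
    ring
  have hint : ∀ g : 𝓢(Model n, ℂ), Integrable (fun y => ‖g y‖ ^ 2) := fun g =>
    (g.memLp 2).integrable_norm_pow (by norm_num)
  have e1 : ∀ k l, ∫ y, (pd k (u l) y) ^ 2 = ∫ ξ, ‖𝓕 (∂_{e k} (S l)) ξ‖ ^ 2 := by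
    intro k l
    rw [SchwartzMap.integral_norm_sq_fourier]
    simp [hS]
  have e2 : ∀ r, ∫ y, (∑ k, ∑ l, a k r l * pd k (u l) y) ^ 2 = ∫ ξ, ‖𝓕 (P r) ξ‖ ^ 2 := by
    intro r
    rw [SchwartzMap.integral_norm_sq_fourier]
    simp only [hP, Complex.norm_real, Real.norm_eq_abs, sq_abs]
  simp only [e1, e2]
  rw [← integral_finsetSum _ (fun r _ => hint _)]
  simp_rw [← integral_finsetSum _ (fun l _ => hint (𝓕 (∂_{e _} (S l))))]
  rw [← integral_finsetSum _ (fun k _ => integrable_finsetSum _ fun l _ => hint _),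
    ← integral_const_mul]
  refine integral_mono ((integrable_finsetSum _ fun k _ => integrable_finsetSum _
    fun l _ => hint _).const_mul c) (integrable_finsetSum _ fun r _ => hint _) fun ξ => ?_
  simp only [hF, hPF, norm_mul, mul_pow, ← Finset.mul_sum]
  have hpi : ‖(2 : ℂ)‖ ^ 2 * ‖(Real.pi : ℂ)‖ ^ 2 * ‖Complex.I‖ ^ 2 = (2 * Real.pi) ^ 2 := by
    simp [abs_of_pos Real.pi_pos]; ring
  have hsq : ∀ z : ℂ, ‖z‖ ^ 2 = z.re ^ 2 + z.im ^ 2 := fun z => by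
    rw [← Complex.normSq_eq_norm_sq, Complex.normSq_apply]; ring
  rw [hpi]
  have h1 := hsym ξ (fun l => (𝓕 (S l) ξ).re)
  have h2 := hsym ξ (fun l => (𝓕 (S l) ξ).im)
  have h3 : ∀ r, ‖∑ k, ∑ l, (a k r l : ℂ) * (ξ k : ℂ) * 𝓕 (S l) ξ‖ ^ 2 =
      (∑ k, ∑ l, a k r l * ξ k * (𝓕 (S l) ξ).re) ^ 2 +
      (∑ k, ∑ l, a k r l * ξ k * (𝓕 (S l) ξ).im) ^ 2 := by
    intro r
    rw [hsq]
    simp [Complex.re_sum, Complex.im_sum]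
  simp only [h3]
  have h4 : ∑ k, ∑ l, ‖(ξ k : ℂ)‖ ^ 2 * ‖𝓕 (S l) ξ‖ ^ 2 =
      (∑ k, ξ k ^ 2) * (∑ l, (𝓕 (S l) ξ).re ^ 2) + (∑ k, ξ k ^ 2) * (∑ l, (𝓕 (S l) ξ).im ^ 2) := by
    rw [← mul_add, ← Finset.sum_add_distrib, Finset.sum_mul_sum]
    refine Finset.sum_congr rfl fun k _ => Finset.sum_congr rfl fun l _ => ?_
    rw [hsq (𝓕 (S l) ξ)]
    simp
  simp only [← Finset.mul_sum] at h4 ⊢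
  rw [h4, Finset.sum_add_distrib]
  nlinarith [sq_nonneg (2 * Real.pi)]

end Scalar

/-! ### Mollification -/

section Mollify

variable {n : ℕ} {G : Type*} [NormedAddCommGroup G] [NormedSpace ℝ G]

open scoped Convolution

/-- A fixed smooth probability density on `ℝⁿ` supported in the unit ball. -/
def mollBase (n : ℕ) : Model n → ℝ :=
  (⟨1 / 2, 1, by norm_num, by norm_num⟩ : ContDiffBump (0 : Model n)).normed volume

/-- The mollifier `ε⁻ⁿ η(z / ε)`. -/
def moll (n : ℕ) (ε : ℝ) (z : Model n) : ℝ := (ε⁻¹) ^ n * mollBase n (ε⁻¹ • z)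

/-- The mollification `moll n ε ⋆ g`. -/
def mollify (ε : ℝ) (g : Model n → G) : Model n → G :=
  moll n ε ⋆[ContinuousLinearMap.lsmul ℝ ℝ, volume] g

lemma contDiff_mollBase : ContDiff ℝ ∞ (mollBase n) := ContDiffBump.contDiff_normed _

lemma contDiff_moll (ε : ℝ) : ContDiff ℝ ∞ (moll n ε) :=
  contDiff_const.mul (contDiff_mollBase.comp (contDiff_const_smul _))

lemma moll_nonneg {ε : ℝ} (hε : 0 < ε) (z : Model n) : 0 ≤ moll n ε z :=
  mul_nonneg (by positivity) (ContDiffBump.nonneg_normed _ _)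

lemma support_moll_subset {ε : ℝ} (hε : 0 < ε) : Function.support (moll n ε) ⊆ Metric.ball 0 ε := by
  intro z hz
  have h : mollBase n (ε⁻¹ • z) ≠ 0 := right_ne_zero_of_mul hz
  have h2 : ε⁻¹ • z ∈ Metric.ball (0 : Model n) 1 := by
    have := ContDiffBump.support_normed_eq
      (f := (⟨1 / 2, 1, by norm_num, by norm_num⟩ : ContDiffBump (0 : Model n)))
      (μ := (volume : Measure (Model n)))
    rw [← this]
    exact h
  rw [mem_ball_zero_iff, norm_smul, norm_inv, Real.norm_of_nonneg hε.le, inv_mul_lt_one₀ hε] at h2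
  simpa using h2

lemma tsupport_moll_subset {ε : ℝ} (hε : 0 < ε) : tsupport (moll n ε) ⊆ Metric.closedBall 0 ε :=
  closure_minimal ((support_moll_subset hε).trans Metric.ball_subset_closedBall)
    Metric.isClosed_closedBall

lemma hasCompactSupport_moll {ε : ℝ} (hε : 0 < ε) : HasCompactSupport (moll n ε) :=
  (isCompact_closedBall _ _).of_isClosed_subset (isClosed_tsupport _) (tsupport_moll_subset hε)

lemma integral_moll {ε : ℝ} (hε : 0 < ε) : ∫ z, moll n ε z = 1 := by
  simp only [moll]
  rw [integral_const_mul, Measure.integral_comp_inv_smul_of_nonneg _ _ hε.le, mollBase,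
    ContDiffBump.integral_normed, finrank_euclideanSpace_fin]
  simp only [smul_eq_mul, mul_one, inv_pow]
  field_simp

lemma moll_neg (ε : ℝ) (z : Model n) : moll n ε (-z) = moll n ε z := by
  simp only [moll, mollBase, smul_neg, ContDiffBump.normed_neg]

lemma pd_moll (ε : ℝ) (k : Fin n) (z : Model n) :
    pd k (moll n ε) z = (ε⁻¹) ^ (n + 1) * pd k (mollBase n) (ε⁻¹ • z) := by
  have h1 : HasFDerivAt (mollBase n) (fderiv ℝ (mollBase n) (ε⁻¹ • z)) (ε⁻¹ • z) :=
    (contDiff_mollBase.differentiable (by simp) _).hasFDerivAt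
  have h2 := (h1.comp z ((hasFDerivAt_id z).const_smul ε⁻¹)).const_mul ((ε⁻¹) ^ n)
  have h3 : fderiv ℝ (moll n ε) z = _ := h2.fderiv
  rw [pd, h3, pd]
  simp
  ring

/-- The first moment of the gradient of the mollifier does not depend on `ε`. -/
lemma integral_norm_mul_pd_moll {ε : ℝ} (hε : 0 < ε) (k : Fin n) :
    ∫ z, ‖z‖ * |pd k (moll n ε) z| = ∫ z, ‖z‖ * |pd k (mollBase n) z| := by
  have : ∀ z : Model n, ‖z‖ * |pd k (moll n ε) z| =
      (ε⁻¹) ^ n * (‖ε⁻¹ • z‖ * |pd k (mollBase n) (ε⁻¹ • z)|) := by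
    intro z
    rw [pd_moll, norm_smul, norm_inv, Real.norm_of_nonneg hε.le, abs_mul,
      abs_of_pos (by positivity)]
    ring
  simp only [this]
  rw [integral_const_mul, Measure.integral_comp_inv_smul_of_nonneg
    (f := fun z : Model n => ‖z‖ * |pd k (mollBase n) z|) _ hε.le, finrank_euclideanSpace_fin]
  simp only [smul_eq_mul, inv_pow]
  field_simp

lemma mollify_apply (ε : ℝ) (g : Model n → G) (x : Model n) :
    mollify ε g x = ∫ y, moll n ε (x - y) • g y := convolution_lsmul_swap

lemma contDiff_mollify {ε : ℝ} (hε : 0 < ε) {g : Model n → G} (hg : LocallyIntegrable g) :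
    ContDiff ℝ ∞ (mollify ε g) :=
  (hasCompactSupport_moll hε).contDiff_convolution_left _ (contDiff_moll ε) hg

lemma pd_mollify {ε : ℝ} (hε : 0 < ε) {g : Model n → ℝ} (hg : LocallyIntegrable g) (k : Fin n)
    (x : Model n) : pd k (mollify ε g) x = ∫ y, pd k (moll n ε) (x - y) * g y := by
  have h := (hasCompactSupport_moll hε).hasFDerivAt_convolution_left
    (ContinuousLinearMap.lsmul ℝ ℝ) ((contDiff_moll ε).of_le (by simp)) hg x
  have h1 : fderiv ℝ (mollify ε g) x = _ := h.fderiv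
  rw [pd, h1, convolution_eq_swap, ContinuousLinearMap.integral_apply]
  · rfl
  · have h2 : ConvolutionExistsAt (fderiv ℝ (moll n ε)) g x
        ((ContinuousLinearMap.lsmul ℝ ℝ).precompL (Model n)) volume :=
      ((hasCompactSupport_moll hε).fderiv ℝ).convolutionExists_left _
        ((contDiff_moll ε).continuous_fderiv (by simp)) hg x
    exact (convolutionExistsAt_iff_integrable_swap).1 h2

lemma fderiv_mollify {ε : ℝ} {g : Model n → G} (hg : ContDiff ℝ 1 g)
    (hc : HasCompactSupport g) (x : Model n) :
    fderiv ℝ (mollify ε g) x = mollify ε (fderiv ℝ g) x := by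
  have h := hc.hasFDerivAt_convolution_right (ContinuousLinearMap.lsmul ℝ ℝ)
    (contDiff_moll (n := n) ε).continuous.locallyIntegrable (μ := volume) hg x
  have h1 : fderiv ℝ (mollify ε g) x = _ := h.fderiv
  rw [h1]
  simp only [mollify, convolution]
  rfl

lemma mollify_eq_zero {ε r : ℝ} (hε : 0 < ε) {g : Model n → G} {y₀ x : Model n}
    (hg : ∀ y, y ∉ Metric.ball y₀ r → g y = 0) (hx : x ∉ Metric.ball y₀ (r + ε)) :
    mollify ε g x = 0 := by
  rw [mollify_apply]
  refine integral_eq_zero_of_ae (Filter.Eventually.of_forall fun y => ?_)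
  by_cases hy : y ∈ Metric.ball y₀ r
  · have : moll n ε (x - y) = 0 := by
      by_contra h
      have h1 := support_moll_subset hε h
      rw [mem_ball_zero_iff] at h1
      rw [Metric.mem_ball] at hx hy
      apply hx
      calc dist x y₀ ≤ dist x y + dist y y₀ := dist_triangle _ _ _
        _ < ε + r := by rw [dist_eq_norm]; gcongr
        _ = _ := by ring
    simp [this]
  · simp [hg y hy]

/-- The mollification of `g` at a point outside the `ε`-neighbourhood of the support of `g`
vanishes. -/
lemma tsupport_mollify_subset {ε : ℝ} (hε : 0 < ε) (g : Model n → G) :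
    tsupport (mollify ε g) ⊆ Metric.cthickening ε (tsupport g) := by
  refine closure_minimal (fun x hx => ?_) Metric.isClosed_cthickening
  by_contra h
  apply hx
  rw [mollify_apply]
  refine integral_eq_zero_of_ae (Filter.Eventually.of_forall fun y => ?_)
  by_cases hy : y ∈ tsupport g
  · have : moll n ε (x - y) = 0 := by
      by_contra h'
      have h1 := support_moll_subset hε h'
      rw [mem_ball_zero_iff, ← dist_eq_norm] at h1
      exact h (Metric.mem_cthickening_of_dist_le x y ε _ hy h1.le)
    simp [this]
  · simp [image_eq_zero_of_notMem_tsupport hy]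

lemma dist_mollify_le [CompleteSpace G] {ε δ : ℝ} (hε : 0 < ε) (hδ : 0 ≤ δ) {g : Model n → G}
    (hg : Continuous g) {x : Model n} (h : ∀ y ∈ Metric.ball x ε, dist (g y) (g x) ≤ δ) :
    dist (mollify ε g x) (g x) ≤ δ :=
  dist_convolution_le hδ (support_moll_subset hε) (moll_nonneg hε) (integral_moll hε)
    hg.aestronglyMeasurable h

lemma eventually_dist_mollify_le [CompleteSpace G] {g : Model n → G} (hg : Continuous g)
    (hc : HasCompactSupport g) {δ : ℝ} (hδ : 0 < δ) :
    ∀ᶠ ε in 𝓝[>] (0 : ℝ), ∀ x, dist (mollify ε g x) (g x) ≤ δ := by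
  obtain ⟨r, hr, h⟩ := Metric.uniformContinuous_iff.1 (hc.uniformContinuous_of_continuous hg)
    δ hδ
  filter_upwards [Ioo_mem_nhdsGT hr] with ε hε x
  exact dist_mollify_le hε.1 hδ.le hg fun y hy => (h (lt_trans hy hε.2)).le

/-- Mollification is symmetric and converges to the identity, here in the weak sense. -/
lemma tendsto_integral_mollify_mul {g ψ : Model n → ℝ} (hg : Integrable g)
    (hψ : Continuous ψ) (hc : HasCompactSupport ψ) :
    Filter.Tendsto (fun ε => ∫ x, mollify ε g x * ψ x) (𝓝[>] 0) (𝓝 (∫ x, g x * ψ x)) := by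
  have hψi : Integrable ψ := hψ.integrable_of_hasCompactSupport hc
  have hsymm : ∀ ε : ℝ, 0 < ε → ∫ x, mollify ε g x * ψ x = ∫ y, g y * mollify ε ψ y := by
    intro ε hε
    have e1 : ∀ x, mollify ε g x * ψ x = ∫ y, moll n ε (x - y) * g y * ψ x := fun x => by
      rw [mollify_apply, ← integral_mul_const]; rfl
    have e2 : ∀ y, g y * mollify ε ψ y = ∫ x, moll n ε (x - y) * g y * ψ x := fun y => by
      rw [mollify_apply, ← integral_const_mul]
      refine integral_congr_ae (Filter.Eventually.of_forall fun x => ?_)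
      have : moll n ε (y - x) = moll n ε (x - y) := by rw [← moll_neg, neg_sub]
      simp only [smul_eq_mul, this]
      ring
    simp only [e1, e2]
    refine integral_integral_swap ?_
    obtain ⟨C, hC⟩ := (hasCompactSupport_moll (n := n) hε).exists_bound_of_continuous
      (contDiff_moll ε).continuous
    have h1 : Integrable (fun q : Model n × Model n => ψ q.1 * g q.2) (volume.prod volume) :=
      hψi.mul_prod hg
    have h2 := h1.bdd_mul (f := fun q : Model n × Model n => moll n ε (q.1 - q.2)) (c := C)
      (by exact ((contDiff_moll ε).continuous.comp
        (continuous_fst.sub continuous_snd)).aestronglyMeasurable)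
      (Filter.Eventually.of_forall fun q => hC _)
    refine h2.congr (Filter.Eventually.of_forall fun q => ?_)
    simp only [Function.uncurry]
    ring
  rw [Metric.tendsto_nhds]
  intro δ hδ
  set I := ∫ y, |g y|
  have hI : 0 ≤ I := integral_nonneg fun y => abs_nonneg _
  have hδ' : 0 < δ / (2 * (I + 1)) := by positivity
  filter_upwards [eventually_dist_mollify_le hψ hc hδ', self_mem_nhdsWithin] with ε h hε
  rw [hsymm ε hε, dist_eq_norm, ← integral_sub]
  · calc ‖∫ y, (g y * mollify ε ψ y - g y * ψ y)‖
        ≤ ∫ y, |g y| * (δ / (2 * (I + 1))) := by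
          refine norm_integral_le_of_norm_le (hg.abs.mul_const _)
            (Filter.Eventually.of_forall fun y => ?_)
          rw [← mul_sub, norm_mul, Real.norm_eq_abs]
          exact mul_le_mul_of_nonneg_left (by rw [← dist_eq_norm]; exact h y) (abs_nonneg _)
      _ = I * (δ / (2 * (I + 1))) := integral_mul_const _ _
      _ < δ := by
          rw [mul_div_assoc', div_lt_iff₀ (by positivity)]
          nlinarith
  · have hcm : HasCompactSupport (mollify ε ψ) :=
      (hc.cthickening (r := ε)).of_isClosed_subset (isClosed_tsupport _)
        (tsupport_mollify_subset hε ψ)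
    obtain ⟨C, hC⟩ := hcm.exists_bound_of_continuous
      (contDiff_mollify hε hψ.locallyIntegrable).continuous
    exact hg.mul_bdd (c := C)
      (contDiff_mollify hε hψ.locallyIntegrable).continuous.aestronglyMeasurable
      (Filter.Eventually.of_forall hC)
  · obtain ⟨C, hC⟩ := hc.exists_bound_of_continuous hψ
    exact hg.mul_bdd (c := C) hψ.aestronglyMeasurable (Filter.Eventually.of_forall hC)

open scoped ENNReal in
/-- **Young's inequality** `‖K ⋆ h‖₂ ≤ ‖K‖₁ ‖h‖₂` for nonnegative functions. -/
lemma lintegral_conv_sq_le {K h : Model n → ℝ≥0∞} (hK : Measurable K) (hh : Measurable h) :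
    ∫⁻ x, (∫⁻ y, K (x - y) * h y) ^ 2 ≤ (∫⁻ z, K z) ^ 2 * ∫⁻ y, h y ^ 2 := by
  have hKx : ∀ x, ∫⁻ y, K (x - y) = ∫⁻ z, K z := fun x => lintegral_sub_left_eq_self K x
  have hcs : ∀ x, (∫⁻ y, K (x - y) * h y) ^ 2 ≤ (∫⁻ z, K z) * ∫⁻ y, K (x - y) * h y ^ 2 := by
    intro x
    have hm : Measurable fun y => K (x - y) := hK.comp (measurable_const.sub measurable_id)
    have := ENNReal.lintegral_mul_le_Lp_mul_Lq volume Real.HolderConjugate.two_two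
      (f := fun y => K (x - y) ^ (1 / 2 : ℝ)) (g := fun y => K (x - y) ^ (1 / 2 : ℝ) * h y)
      (hm.pow_const _).aemeasurable ((hm.pow_const _).mul hh).aemeasurable
    have e0 : ∀ t : ℝ≥0∞, t ^ (1 / 2 : ℝ) * t ^ (1 / 2 : ℝ) = t := fun t => by
      rw [← ENNReal.rpow_add_of_nonneg _ _ (by norm_num) (by norm_num)]; norm_num
    have e1 : ∀ t : ℝ≥0∞, (t ^ (1 / 2 : ℝ)) ^ 2 = t := fun t => by rw [sq, e0]
    simp only [Pi.mul_apply, ← mul_assoc, e0, ENNReal.rpow_two, mul_pow, e1] at this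
    calc (∫⁻ y, K (x - y) * h y) ^ 2 ≤ _ := pow_le_pow_left' this 2
      _ = _ := by rw [mul_pow, e1, e1, hKx]
  calc ∫⁻ x, (∫⁻ y, K (x - y) * h y) ^ 2
      ≤ ∫⁻ x, (∫⁻ z, K z) * ∫⁻ y, K (x - y) * h y ^ 2 := lintegral_mono hcs
    _ = (∫⁻ z, K z) * ∫⁻ x, ∫⁻ y, K (x - y) * h y ^ 2 := by
        refine lintegral_const_mul _ ?_
        exact Measurable.lintegral_prod_right' (f := fun q : Model n × Model n =>
          K (q.1 - q.2) * h q.2 ^ 2) (by fun_prop)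
    _ = (∫⁻ z, K z) * ∫⁻ y, ∫⁻ x, K (x - y) * h y ^ 2 := by
        rw [lintegral_lintegral_swap]
        exact Measurable.aemeasurable (by fun_prop)
    _ = (∫⁻ z, K z) * ∫⁻ y, (∫⁻ z, K z) * h y ^ 2 := by
        congr 1
        refine lintegral_congr fun y => ?_
        rw [lintegral_mul_const _ (by fun_prop), lintegral_sub_right_eq_self K y]
    _ = _ := by rw [lintegral_const_mul _ (by fun_prop)]; ring

end Mollify

/-! ### Weak derivatives and weak solutions -/

section Weak

variable {n : ℕ}

/-- `w` is the weak `k`-th partial derivative of `v` on `U`. -/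
def IsWeakDeriv (U : Set (Model n)) (k : Fin n) (v w : Model n → ℝ) : Prop :=
  ∀ φ, IsTest U φ → ∫ y, v y * pd k φ y = -∫ y, w y * φ y

/-- `v` is a weak solution on `U` of the first order system
`-∑ₖ ∂ₖ (∑ₗ a k r l * v l) + ∑ₗ b r l * v l = 0`, one equation for each `r`. The system is in
divergence form, so that no derivative of a coefficient occurs when it is tested. -/
def IsWeakSol {κ ι : Type*} [Fintype ι] (U : Set (Model n)) (a : Fin n → κ → ι → Model n → ℝ)
    (b : κ → ι → Model n → ℝ) (v : ι → Model n → ℝ) : Prop :=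
  ∀ r φ, IsTest U φ →
    ∫ y, ((∑ k, ∑ l, a k r l y * v l y * pd k φ y) + ∑ l, b r l y * v l y * φ y) = 0

lemma IsWeakDeriv.mono {U V : Set (Model n)} (h : U ⊆ V) {k : Fin n} {v w : Model n → ℝ}
    (hv : IsWeakDeriv V k v w) : IsWeakDeriv U k v w := fun φ hφ => hv φ (hφ.mono h)

lemma IsWeakSol.mono {κ ι : Type*} [Fintype ι] {U V : Set (Model n)} (h : U ⊆ V)
    {a : Fin n → κ → ι → Model n → ℝ} {b : κ → ι → Model n → ℝ} {v : ι → Model n → ℝ}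
    (hv : IsWeakSol V a b v) : IsWeakSol U a b v := fun r φ hφ => hv r φ (hφ.mono h)

lemma IsTest.exists_bound {U : Set (Model n)} {φ : Model n → ℝ} (hφ : IsTest U φ) :
    ∃ C, ∀ y, ‖φ y‖ ≤ C := hφ.2.exists_bound_of_continuous hφ.1.continuous

lemma IsTest.memLp_mul {U : Set (Model n)} (hU : IsOpen U) {φ : Model n → ℝ} (hφ : IsTest U φ)
    {v : Model n → ℝ} {p : ENNReal} (hv : MemLp v p (volume.restrict U)) :
    MemLp (fun y => φ y * v y) p volume := by
  obtain ⟨C, hC⟩ := hφ.exists_bound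
  have h1 : MemLp (fun y => φ y * v y) p (volume.restrict U) := by
    refine MemLp.of_le_mul (c := C) hv
      (hφ.1.continuous.aestronglyMeasurable.mul hv.1) (Filter.Eventually.of_forall fun y => ?_)
    rw [norm_mul]
    exact mul_le_mul_of_nonneg_right (hC y) (norm_nonneg _)
  rw [← memLp_indicator_iff_restrict hU.measurableSet] at h1
  have h2 : (U.indicator fun y => φ y * v y) = fun y => φ y * v y := by
    funext y
    by_cases hy : y ∈ U
    · simp [hy]
    · simp [hy, image_eq_zero_of_notMem_tsupport fun h => hy (hφ.3 h)]
  rwa [h2] at h1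

lemma IsTest.integrable_mul_of_integrableOn {U : Set (Model n)} (hU : IsOpen U) {φ : Model n → ℝ}
    (hφ : IsTest U φ) {v : Model n → ℝ} (hv : IntegrableOn v U) :
    Integrable (fun y => φ y * v y) :=
  memLp_one_iff_integrable.1 (hφ.memLp_mul hU (memLp_one_iff_integrable.2 hv))

lemma IsTest.integrable_mul {U : Set (Model n)} (hU : IsOpen U) {φ : Model n → ℝ}
    (hφ : IsTest U φ) {v : Model n → ℝ} (hv : MemLp v 2 (volume.restrict U)) :
    Integrable (fun y => φ y * v y) := by
  have h1 := (hφ.memLp_mul hU hv).restrict (tsupport φ)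
  have : IsFiniteMeasure (volume.restrict (tsupport φ)) :=
    ⟨by simpa using hφ.2.isCompact.measure_lt_top⟩
  have h2 : IntegrableOn (fun y => φ y * v y) (tsupport φ) := h1.integrable (by norm_num)
  rw [← integrable_indicator_iff hφ.2.isCompact.measurableSet] at h2
  have h3 : ((tsupport φ).indicator fun y => φ y * v y) = fun y => φ y * v y := by
    funext y
    by_cases hy : y ∈ tsupport φ
    · simp [hy]
    · simp [hy, image_eq_zero_of_notMem_tsupport hy]
  rwa [h3] at h2

/-- If the gradients of the mollifications of `g` stay bounded in `L²`, then `g` has a weak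
derivative in `L²`: a weak limit point exists by the Banach–Alaoglu theorem. -/
lemma exists_weakDeriv_of_bounded {g : Model n → ℝ} (hg : Integrable g) {k : Fin n} {R C : ℝ}
    (hR : 0 < R) (hm : ∀ ε ∈ Ioo 0 R, MemLp (pd k (mollify ε g)) 2 volume)
    (hb : ∀ ε ∈ Ioo 0 R, ∫ y, (pd k (mollify ε g) y) ^ 2 ≤ C) :
    ∃ w, MemLp w 2 volume ∧ IsWeakDeriv univ k g w := by
  let ε : ℕ → ℝ := fun j => R / (j + 2)
  have hε : ∀ j, ε j ∈ Ioo 0 R := fun j => by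
    have hj : (0 : ℝ) ≤ j := Nat.cast_nonneg j
    refine ⟨by positivity, ?_⟩
    rw [div_lt_iff₀ (by positivity)]
    nlinarith
  have hεt : Filter.Tendsto ε Filter.atTop (𝓝[>] 0) := by
    refine tendsto_nhdsWithin_iff.2 ⟨?_, Filter.Eventually.of_forall fun j => (hε j).1⟩
    exact tendsto_const_nhds.div_atTop
      (Filter.tendsto_atTop_add_const_right _ _ tendsto_natCast_atTop_atTop)
  let D : ℕ → Lp ℝ 2 (volume : Measure (Model n)) := fun j => (hm _ (hε j)).toLp
  have hD : ∀ j (f : Lp ℝ 2 (volume : Measure (Model n))),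
      inner ℝ (D j) f = ∫ y, pd k (mollify (ε j) g) y * f y := by
    intro j f
    rw [L2.inner_def]
    refine integral_congr_ae ?_
    filter_upwards [(hm _ (hε j)).coeFn_toLp] with y hy
    change inner ℝ ((hm _ (hε j)).toLp _ y) (f y) = _
    rw [hy]
    simp [mul_comm]
  have hDn : ∀ j, ‖D j‖ ≤ Real.sqrt C := by
    intro j
    refine Real.le_sqrt_of_sq_le ?_
    rw [← real_inner_self_eq_norm_sq, hD]
    refine le_trans (le_of_eq ?_) (hb _ (hε j))
    refine integral_congr_ae ?_
    filter_upwards [(hm _ (hε j)).coeFn_toLp] with y hy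
    change _ * (hm _ (hε j)).toLp _ y = _
    rw [hy, sq]
  let X : ℕ → WeakDual ℝ (Lp ℝ 2 (volume : Measure (Model n))) := fun j =>
    StrongDual.toWeakDual (InnerProductSpace.toDual ℝ _ (D j))
  obtain ⟨ℓ, -, hℓ⟩ := (WeakDual.isCompact_closedBall (𝕜 := ℝ)
    (0 : StrongDual ℝ (Lp ℝ 2 (volume : Measure (Model n)))) (Real.sqrt C)).exists_mapClusterPt
    (f := Filter.atTop) (u := X) (by
      rw [Filter.le_principal_iff, Filter.mem_map]
      refine Filter.Eventually.of_forall fun j => ?_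
      simpa [X] using hDn j)
  let w := (InnerProductSpace.toDual ℝ _).symm (WeakDual.toStrongDual ℓ)
  refine ⟨w, Lp.memLp w, fun φ hφ => ?_⟩
  have hφ2 : MemLp φ 2 (volume : Measure (Model n)) := hφ.1.continuous.memLp_of_hasCompactSupport hφ.2
  let f := hφ2.toLp
  have h1 : MapClusterPt (ℓ f) Filter.atTop (fun j => X j f) :=
    hℓ.continuousAt_comp (WeakDual.eval_continuous f).continuousAt
  have h2 : ∀ j, X j f = -∫ y, mollify (ε j) g y * pd k φ y := by
    intro j
    change inner ℝ (D j) f = _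
    rw [hD, integral_pd_mul (contDiff_mollify (hε j).1 hg.locallyIntegrable) hφ.1 hφ.2, neg_neg]
    refine integral_congr_ae ?_
    filter_upwards [hφ2.coeFn_toLp] with y hy
    simp only [f, hy]
  have h3 : Filter.Tendsto (fun j => X j f) Filter.atTop (𝓝 (-∫ y, g y * pd k φ y)) := by
    simp only [h2]
    exact ((tendsto_integral_mollify_mul hg (contDiff_pd hφ.1 k).continuous
      (hasCompactSupport_pd hφ.2 k)).comp hεt).neg
  have h4 : ℓ f = -∫ y, g y * pd k φ y :=
    eq_of_nhds_neBot (h1.neBot.mono (inf_le_inf_left _ h3))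
  have h5 : ℓ f = ∫ y, w y * φ y := by
    have : ℓ f = inner ℝ w f := by
      simp only [w, InnerProductSpace.toDual_symm_apply]
      rfl
    rw [this, L2.inner_def]
    refine integral_congr_ae ?_
    filter_upwards [hφ2.coeFn_toLp] with y hy
    simp [f, hy, mul_comm]
  linarith

end Weak

/-! ### First order regularity of weak solutions -/

section Friedrichs

variable {n : ℕ} {κ ι : Type*} [Fintype ι]

/-- The lower order terms that appear when the cutoff `χ` is moved into a weak solution `v`. -/
def cutoffRhs (a : Fin n → κ → ι → Model n → ℝ) (b : κ → ι → Model n → ℝ) (χ : Model n → ℝ)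
    (v : ι → Model n → ℝ) (r : κ) (y : Model n) : ℝ :=
  (∑ k, ∑ l, a k r l y * pd k χ y * v l y) + ∑ l, b r l y * χ y * v l y

lemma pd_comp_const_sub {f : Model n → ℝ} (hf : Differentiable ℝ f) (k : Fin n) (x y : Model n) :
    pd k (fun y => f (x - y)) y = -pd k f (x - y) := by
  have h := (hf (x - y)).hasFDerivAt.comp y ((hasFDerivAt_id y).const_sub x)
  have h1 : fderiv ℝ (fun y => f (x - y)) y = _ := h.fderiv
  rw [pd, h1]
  simp [pd]

variable {U : Set (Model n)} (hU : IsOpen U) {a : Fin n → κ → ι → Model n → ℝ}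
  {b : κ → ι → Model n → ℝ} (ha : ∀ k r l, ContDiffOn ℝ ∞ (a k r l) U)
  (hb : ∀ r l, ContDiffOn ℝ ∞ (b r l) U) {v : ι → Model n → ℝ}
  (hv : ∀ l, MemLp (v l) 2 (volume.restrict U)) {χ : Model n → ℝ} (hχ : IsTest U χ)

include hU ha hb hv hχ

lemma memLp_cutoffRhs (r : κ) : MemLp (cutoffRhs a b χ v r) 2 volume := by
  refine MemLp.add (memLp_finsetSum _ fun k _ => memLp_finsetSum _ fun l _ => ?_)
    (memLp_finsetSum _ fun l _ => ?_)
  · exact ((hχ.pd k).mul_contDiffOn hU (ha k r l)).memLp_mul hU (hv l)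
  · exact (hχ.mul_contDiffOn hU (hb r l)).memLp_mul hU (hv l)

lemma integrable_cutoffRhs (r : κ) : Integrable (cutoffRhs a b χ v r) := by
  refine Integrable.add (integrable_finsetSum _ fun k _ => integrable_finsetSum _ fun l _ => ?_)
    (integrable_finsetSum _ fun l _ => ?_)
  · exact ((hχ.pd k).mul_contDiffOn hU (ha k r l)).integrable_mul hU (hv l)
  · exact (hχ.mul_contDiffOn hU (hb r l)).integrable_mul hU (hv l)

/-- Testing the system with `χ` times a translate of the mollifier. -/
lemma integral_mul_pd_moll (hsol : IsWeakSol U a b v) {ε : ℝ} (hε : 0 < ε) (r : κ) (x : Model n) :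
    ∫ y, ∑ k, ∑ l, a k r l y * (χ y * v l y) * pd k (moll n ε) (x - y) =
      ∫ y, cutoffRhs a b χ v r y * moll n ε (x - y) := by
  have hm : ContDiff ℝ ∞ (fun y => moll n ε (x - y)) :=
    (contDiff_moll ε).comp (contDiff_const.sub contDiff_id)
  have hφ : IsTest U (fun y => moll n ε (x - y) * χ y) :=
    hχ.mul_contDiffOn hU hm.contDiffOn
  have hpd : ∀ k y, pd k (fun y => moll n ε (x - y) * χ y) y =
      moll n ε (x - y) * pd k χ y - χ y * pd k (moll n ε) (x - y) := by
    intro k y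
    rw [pd_mul (hm.differentiable (by simp) y) (hχ.1.differentiable (by simp) y),
      pd_comp_const_sub ((contDiff_moll ε).differentiable (by simp))]
    ring
  have h0 := hsol r _ hφ
  have hi1 : Integrable fun y => cutoffRhs a b χ v r y * moll n ε (x - y) := by
    obtain ⟨C, hC⟩ := (hasCompactSupport_moll (n := n) hε).exists_bound_of_continuous
      (contDiff_moll ε).continuous
    exact (integrable_cutoffRhs hU ha hb hv hχ r).mul_bdd (c := C)
      hm.continuous.aestronglyMeasurable (Filter.Eventually.of_forall fun y => hC _)
  have hi2 : Integrable fun y =>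
      ∑ k, ∑ l, a k r l y * (χ y * v l y) * pd k (moll n ε) (x - y) := by
    refine integrable_finsetSum _ fun k _ => integrable_finsetSum _ fun l _ => ?_
    obtain ⟨C, hC⟩ := (hasCompactSupport_pd (hasCompactSupport_moll (n := n) hε)
      k).exists_bound_of_continuous (contDiff_pd (contDiff_moll ε) k).continuous
    have h := (hχ.mul_contDiffOn hU (ha k r l)).integrable_mul hU (hv l)
    simp only [mul_assoc] at h
    exact h.mul_bdd (c := C) ((contDiff_pd (contDiff_moll ε) k).continuous.comp
        (continuous_const.sub continuous_id)).aestronglyMeasurable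
      (Filter.Eventually.of_forall fun y => hC _)
  rw [eq_comm, ← sub_eq_zero, ← integral_sub hi1 hi2, ← h0]
  refine integral_congr_ae (Filter.Eventually.of_forall fun y => ?_)
  simp only [hpd, cutoffRhs, add_mul, Finset.sum_mul]
  rw [add_sub_right_comm, ← Finset.sum_sub_distrib]
  congr 1
  · refine Finset.sum_congr rfl fun k _ => ?_
    rw [← Finset.sum_sub_distrib]
    refine Finset.sum_congr rfl fun l _ => ?_
    ring
  · refine Finset.sum_congr rfl fun l _ => ?_
    ring

/-- **Friedrichs' commutator estimate**, pointwise: the operator applied to a mollification of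
`χ v` is dominated by the convolution of a kernel of bounded mass with a fixed `L²` function. -/
lemma enorm_op_mollify_le [Fintype κ] (hsol : IsWeakSol U a b v) {ε Λ : ℝ} (hε : 0 < ε)
    (hΛ : 0 ≤ Λ) (r : κ) (x : Model n)
    (hlip : ∀ k l, ∀ y ∈ tsupport χ, |a k r l x - a k r l y| ≤ Λ * ‖x - y‖) :
    ‖∑ k, ∑ l, a k r l x * pd k (mollify ε fun y => χ y * v l y) x‖ₑ ≤
      ∫⁻ y, ENNReal.ofReal (Λ * ‖x - y‖ * (∑ k, |pd k (moll n ε) (x - y)|) + moll n ε (x - y)) *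
        ENNReal.ofReal ((∑ l, |χ y * v l y|) + ∑ r, |cutoffRhs a b χ v r y|) := by
  have hg : ∀ l, Integrable (fun y => χ y * v l y) := fun l => hχ.integrable_mul hU (hv l)
  have hmc : ∀ k, Continuous fun y => pd k (moll n ε) (x - y) := fun k =>
    (contDiff_pd (contDiff_moll ε) k).continuous.comp (continuous_const.sub continuous_id)
  have hmb : ∀ k, ∃ C, ∀ z, ‖pd k (moll n ε) z‖ ≤ C := fun k =>
    (hasCompactSupport_pd (hasCompactSupport_moll (n := n) hε)
      k).exists_bound_of_continuous (contDiff_pd (contDiff_moll ε) k).continuous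
  have hi0 : ∀ k l, Integrable fun y => pd k (moll n ε) (x - y) * (χ y * v l y) := by
    intro k l
    obtain ⟨C, hC⟩ := hmb k
    exact (hg l).bdd_mul (c := C) (hmc k).aestronglyMeasurable
      (Filter.Eventually.of_forall fun y => hC _)
  have hi1 : Integrable fun y => ∑ k, ∑ l, a k r l x * (pd k (moll n ε) (x - y) *
      (χ y * v l y)) :=
    integrable_finsetSum _ fun k _ => integrable_finsetSum _ fun l _ => (hi0 k l).const_mul _
  have hi2 : Integrable fun y =>
      ∑ k, ∑ l, a k r l y * (χ y * v l y) * pd k (moll n ε) (x - y) := by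
    refine integrable_finsetSum _ fun k _ => integrable_finsetSum _ fun l _ => ?_
    obtain ⟨C, hC⟩ := hmb k
    have h := (hχ.mul_contDiffOn hU (ha k r l)).integrable_mul hU (hv l)
    simp only [mul_assoc] at h
    exact h.mul_bdd (c := C) (hmc k).aestronglyMeasurable
      (Filter.Eventually.of_forall fun y => hC _)
  have hi3 : Integrable fun y => cutoffRhs a b χ v r y * moll n ε (x - y) := by
    obtain ⟨C, hC⟩ := (hasCompactSupport_moll (n := n) hε).exists_bound_of_continuous
      (contDiff_moll ε).continuous
    exact (integrable_cutoffRhs hU ha hb hv hχ r).mul_bdd (c := C)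
      ((contDiff_moll ε).continuous.comp
        (continuous_const.sub continuous_id)).aestronglyMeasurable
      (Filter.Eventually.of_forall fun y => hC _)
  have e1 : ∑ k, ∑ l, a k r l x * pd k (mollify ε fun y => χ y * v l y) x =
      ∫ y, ((∑ k, ∑ l, a k r l x * (pd k (moll n ε) (x - y) * (χ y * v l y))) -
        (∑ k, ∑ l, a k r l y * (χ y * v l y) * pd k (moll n ε) (x - y)) +
        cutoffRhs a b χ v r y * moll n ε (x - y)) := by
    have hi12 : Integrable fun y =>
        (∑ k, ∑ l, a k r l x * (pd k (moll n ε) (x - y) * (χ y * v l y))) -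
        (∑ k, ∑ l, a k r l y * (χ y * v l y) * pd k (moll n ε) (x - y)) := hi1.sub hi2
    rw [integral_add hi12 hi3, integral_sub hi1 hi2,
      integral_mul_pd_moll hU ha hb hv hχ hsol hε, sub_add_cancel,
      integral_finsetSum _ fun k _ => integrable_finsetSum _ fun l _ => (hi0 k l).const_mul _]
    refine Finset.sum_congr rfl fun k _ => ?_
    rw [integral_finsetSum _ fun l _ => (hi0 k l).const_mul _]
    refine Finset.sum_congr rfl fun l _ => ?_
    rw [integral_const_mul, pd_mollify hε (hg l).locallyIntegrable]
  rw [e1]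
  refine (enorm_integral_le_lintegral_enorm _).trans (lintegral_mono fun y => ?_)
  have hm0 := moll_nonneg hε (x - y)
  have hK : 0 ≤ Λ * ‖x - y‖ * (∑ k, |pd k (moll n ε) (x - y)|) + moll n ε (x - y) :=
    add_nonneg (mul_nonneg (mul_nonneg hΛ (norm_nonneg _))
      (Finset.sum_nonneg fun k _ => abs_nonneg _)) hm0
  rw [← ENNReal.ofReal_mul hK, ← ofReal_norm]
  refine ENNReal.ofReal_le_ofReal ?_
  set A := ∑ l, |χ y * v l y|
  set B := ∑ r, |cutoffRhs a b χ v r y|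
  have hA : 0 ≤ A := Finset.sum_nonneg fun l _ => abs_nonneg _
  have hB : 0 ≤ B := Finset.sum_nonneg fun l _ => abs_nonneg _
  have hD : 0 ≤ Λ * ‖x - y‖ * ∑ k, |pd k (moll n ε) (x - y)| :=
    mul_nonneg (mul_nonneg hΛ (norm_nonneg _)) (Finset.sum_nonneg fun k _ => abs_nonneg _)
  have b1 : ‖(∑ k, ∑ l, a k r l x * (pd k (moll n ε) (x - y) * (χ y * v l y))) -
        (∑ k, ∑ l, a k r l y * (χ y * v l y) * pd k (moll n ε) (x - y))‖ ≤
      (Λ * ‖x - y‖ * ∑ k, |pd k (moll n ε) (x - y)|) * A := by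
    have hA' : (Λ * ‖x - y‖ * ∑ k, |pd k (moll n ε) (x - y)|) * A =
        ∑ k, ∑ l, Λ * ‖x - y‖ * |pd k (moll n ε) (x - y)| * |χ y * v l y| := by
      simp only [A, Finset.mul_sum, Finset.sum_mul]
      exact Finset.sum_comm
    rw [← Finset.sum_sub_distrib, hA']
    refine (norm_sum_le _ _).trans (Finset.sum_le_sum fun k _ => ?_)
    rw [← Finset.sum_sub_distrib]
    refine (norm_sum_le _ _).trans (Finset.sum_le_sum fun l _ => ?_)
    have : a k r l x * (pd k (moll n ε) (x - y) * (χ y * v l y)) -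
        a k r l y * (χ y * v l y) * pd k (moll n ε) (x - y) =
        (a k r l x - a k r l y) * pd k (moll n ε) (x - y) * (χ y * v l y) := by ring
    rw [this, norm_mul, norm_mul, Real.norm_eq_abs, Real.norm_eq_abs, Real.norm_eq_abs]
    by_cases hy : y ∈ tsupport χ
    · gcongr
      exact hlip k l y hy
    · simp [image_eq_zero_of_notMem_tsupport hy]
  have b2 : ‖cutoffRhs a b χ v r y * moll n ε (x - y)‖ ≤ moll n ε (x - y) * B := by
    rw [norm_mul, Real.norm_of_nonneg hm0, mul_comm]
    refine mul_le_mul_of_nonneg_left ?_ hm0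
    exact Finset.single_le_sum (f := fun r => |cutoffRhs a b χ v r y|)
      (fun r _ => abs_nonneg _) (Finset.mem_univ r)
  calc _ ≤ _ := norm_add_le _ _
    _ ≤ _ := add_le_add b1 b2
    _ ≤ _ := by
      rw [add_mul, mul_add, mul_add]
      have := mul_nonneg hD hB
      have := mul_nonneg hm0 hA
      linarith

/-- Friedrichs' commutator estimate in `L²`, uniformly in the mollification parameter. -/
lemma exists_lintegral_op_mollify_le [Fintype κ] (hsol : IsWeakSol U a b v) {Λ : ℝ} (hΛ : 0 ≤ Λ)
    {B : Set (Model n)} (hB : MeasurableSet B)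
    (hlip : ∀ k r l, ∀ x ∈ B, ∀ y ∈ tsupport χ, |a k r l x - a k r l y| ≤ Λ * ‖x - y‖) :
    ∃ M : ENNReal, M ≠ ⊤ ∧ ∀ ε > 0, ∀ r, ∫⁻ x in B,
      ‖∑ k, ∑ l, a k r l x * pd k (mollify ε fun y => χ y * v l y) x‖ₑ ^ 2 ≤ M := by
  set H : Model n → ℝ := fun y => (∑ l, |χ y * v l y|) + ∑ r, |cutoffRhs a b χ v r y| with hH
  have hHm : MemLp H 2 volume :=
    (memLp_finsetSum _ fun l _ => (hχ.memLp_mul hU (hv l)).abs).add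
      (memLp_finsetSum _ fun r _ => (memLp_cutoffRhs hU ha hb hv hχ r).abs)
  set h : Model n → ENNReal := fun y => ENNReal.ofReal (H y)
  have hh : AEMeasurable h volume := hHm.1.aemeasurable.ennreal_ofReal
  have hh2 : ∫⁻ y, h y ^ 2 ≠ ⊤ := by
    have h1 := hHm.integrable_sq.lintegral_lt_top
    refine ne_of_lt (lt_of_le_of_lt (le_of_eq (lintegral_congr fun y => ?_)) h1)
    rw [ENNReal.ofReal_pow]
    exact add_nonneg (Finset.sum_nonneg fun l _ => abs_nonneg _)
      (Finset.sum_nonneg fun l _ => abs_nonneg _)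
  set c := Λ * (∑ k : Fin n, ∫ z, ‖z‖ * |pd k (mollBase n) z|) + 1 with hc
  refine ⟨ENNReal.ofReal c ^ 2 * ∫⁻ y, h y ^ 2,
    ENNReal.mul_ne_top (ENNReal.pow_ne_top ENNReal.ofReal_ne_top) hh2, fun ε hε r => ?_⟩
  set k₀ : Model n → ℝ :=
    fun z => Λ * ‖z‖ * (∑ k, |pd k (moll n ε) z|) + moll n ε z with hk₀
  have hpc : ∀ k, Continuous (pd k (moll n ε)) := fun k =>
    (contDiff_pd (contDiff_moll ε) k).continuous
  have hk₀c : Continuous k₀ := by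
    have := (contDiff_moll (n := n) ε).continuous
    fun_prop
  have hk₀n : ∀ z, 0 ≤ k₀ z := fun z =>
    add_nonneg (mul_nonneg (mul_nonneg hΛ (norm_nonneg _))
      (Finset.sum_nonneg fun k _ => abs_nonneg _)) (moll_nonneg hε _)
  have hi1 : ∀ k, Integrable fun z => ‖z‖ * |pd k (moll n ε) z| := fun k =>
    (continuous_norm.mul (hpc k).abs).integrable_of_hasCompactSupport
      ((hasCompactSupport_pd (hasCompactSupport_moll hε) k).norm.mul_left)
  have hi2 : Integrable (moll n ε) :=
    (contDiff_moll ε).continuous.integrable_of_hasCompactSupport (hasCompactSupport_moll hε)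
  have hk₀e : k₀ = fun z => Λ * (∑ k, ‖z‖ * |pd k (moll n ε) z|) + moll n ε z := by
    funext z
    simp only [hk₀, Finset.mul_sum, mul_assoc]
  have hkI : Integrable k₀ := by
    rw [hk₀e]
    exact ((integrable_finsetSum _ fun k _ => hi1 k).const_mul _).add hi2
  have hkc : ∫ z, k₀ z = c := by
    rw [hk₀e, integral_add ((integrable_finsetSum _ fun k _ => hi1 k).const_mul _) hi2,
      integral_const_mul, integral_finsetSum _ fun k _ => hi1 k, integral_moll hε]
    simp only [integral_norm_mul_pd_moll hε, hc]
  have hkl : ∫⁻ z, ENNReal.ofReal (k₀ z) = ENNReal.ofReal c := by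
    rw [← ofReal_integral_eq_lintegral_ofReal hkI (Filter.Eventually.of_forall hk₀n), hkc]
  calc _ ≤ ∫⁻ x in B, (∫⁻ y, ENNReal.ofReal (k₀ (x - y)) * h y) ^ 2 := by
        refine setLIntegral_mono' hB fun x hx => ?_
        exact pow_le_pow_left' (enorm_op_mollify_le hU ha hb hv hχ hsol hε hΛ r x
          fun k l => hlip k r l x hx) 2
    _ ≤ ∫⁻ x, (∫⁻ y, ENNReal.ofReal (k₀ (x - y)) * h y) ^ 2 := setLIntegral_le_lintegral _ _
    _ = ∫⁻ x, (∫⁻ y, ENNReal.ofReal (k₀ (x - y)) * hh.mk h y) ^ 2 := by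
        refine lintegral_congr fun x => ?_
        congr 1
        refine lintegral_congr_ae ?_
        filter_upwards [hh.ae_eq_mk] with y hy
        rw [hy]
    _ ≤ _ := lintegral_conv_sq_le hk₀c.measurable.ennreal_ofReal hh.measurable_mk
    _ = _ := by
        rw [hkl]
        congr 1
        refine lintegral_congr_ae ?_
        filter_upwards [hh.ae_eq_mk] with y hy
        rw [hy]

end Friedrichs

section FirstOrderRegularity

variable {n : ℕ} {κ ι : Type*} [Fintype κ] [Fintype ι]

/-- A square integrable weak solution of a first order system whose symbol is injective at `y₀` has
weak derivatives in `L²` near `y₀`. On a small ball the coefficients are close to constants, so the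
constant coefficient estimate holds with an absorbable error, and Friedrichs' lemma bounds the
mollified solutions. -/
theorem IsWeakSol.exists_weakDeriv {U : Set (Model n)} (hU : IsOpen U) {y₀ : Model n} (hy₀ : y₀ ∈ U)
    {a : Fin n → κ → ι → Model n → ℝ} {b : κ → ι → Model n → ℝ}
    (ha : ∀ k r l, ContDiffOn ℝ ∞ (a k r l) U) (hb : ∀ r l, ContDiffOn ℝ ∞ (b r l) U)
    (hsym : ∀ ξ : Fin n → ℝ, ξ ≠ 0 → ∀ η : ι → ℝ,
      (∀ r, ∑ k, ∑ l, a k r l y₀ * ξ k * η l = 0) → η = 0)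
    {v : ι → Model n → ℝ} (hv : ∀ l, MemLp (v l) 2 (volume.restrict U))
    (hsol : IsWeakSol U a b v) :
    ∃ R > 0, Metric.ball y₀ R ⊆ U ∧ ∃ w : Fin n → ι → Model n → ℝ,
      (∀ k l, MemLp (w k l) 2 volume) ∧
      ∀ k l, IsWeakDeriv (Metric.ball y₀ R) k (v l) (w k l) := by
  obtain ⟨c, hc, hest⟩ := exists_const_coeff_estimate (fun k r l => a k r l y₀) hsym
  -- `δ` is so small that the oscillation of the coefficients can be absorbed
  set m : ℝ := Fintype.card κ * (n * Fintype.card ι) with hm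
  have hm0 : 0 ≤ m := by positivity
  obtain ⟨δ, hδ, hδc⟩ : ∃ δ > 0, 2 * m * δ ^ 2 ≤ c / 2 := by
    refine ⟨Real.sqrt (c / (4 * (m + 1))), by positivity, ?_⟩
    rw [Real.sq_sqrt (by positivity)]
    rw [mul_div_assoc', div_le_div_iff₀ (by positivity) (by norm_num)]
    nlinarith
  obtain ⟨R, hR, hRU, hosc⟩ : ∃ R > 0, Metric.closedBall y₀ (2 * R) ⊆ U ∧
      ∀ x ∈ Metric.closedBall y₀ (2 * R), ∀ k r l, |a k r l y₀ - a k r l x| ≤ δ := by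
    have h1 : ∀ᶠ x in 𝓝 y₀, x ∈ U ∧ ∀ k r l, |a k r l y₀ - a k r l x| ≤ δ := by
      refine (hU.eventually_mem hy₀).and ?_
      simp only [Filter.eventually_all]
      intro k r l
      have := ((ha k r l).continuousOn.continuousAt (hU.mem_nhds hy₀))
      filter_upwards [Metric.continuousAt_iff'.1 this δ hδ] with x hx
      rw [abs_sub_comm]
      exact hx.le
    obtain ⟨R, hR, h⟩ := Metric.nhds_basis_closedBall.mem_iff.1 h1
    refine ⟨R / 2, by positivity, ?_, ?_⟩ <;> rw [mul_div_cancel₀ _ (two_ne_zero)]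
    · exact fun x hx => (h hx).1
    · exact fun x hx => (h hx).2
  have hB2 : Metric.ball y₀ (2 * R) ⊆ U := Metric.ball_subset_closedBall.trans hRU
  obtain ⟨Λ, hΛ, hlip⟩ : ∃ Λ : ℝ, 0 ≤ Λ ∧ ∀ k r l, ∀ x ∈ Metric.ball y₀ (2 * R),
      ∀ y ∈ Metric.closedBall y₀ (2 * R), |a k r l x - a k r l y| ≤ Λ * ‖x - y‖ := by
    have h1 : ∀ k r l, ∃ K : NNReal, LipschitzOnWith K (a k r l) (Metric.closedBall y₀ (2 * R)) :=
      fun k r l => ((ha k r l).mono hRU).exists_lipschitzOnWith (by simp)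
        (convex_closedBall _ _) (isCompact_closedBall _ _)
    choose K hK using h1
    refine ⟨∑ k, ∑ r, ∑ l, (K k r l : ℝ), by positivity, fun k r l x hx y hy => ?_⟩
    have h2 := (hK k r l).dist_le_mul x (Metric.ball_subset_closedBall hx) y hy
    rw [Real.dist_eq, dist_eq_norm] at h2
    refine h2.trans (mul_le_mul_of_nonneg_right ?_ (norm_nonneg _))
    calc (K k r l : ℝ) ≤ ∑ l, (K k r l : ℝ) :=
          Finset.single_le_sum (f := fun l => (K k r l : ℝ)) (fun _ _ => by positivity)
            (Finset.mem_univ l)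
      _ ≤ ∑ r, ∑ l, (K k r l : ℝ) :=
          Finset.single_le_sum (f := fun r => ∑ l, (K k r l : ℝ)) (fun _ _ => by positivity)
            (Finset.mem_univ r)
      _ ≤ _ := Finset.single_le_sum (f := fun k => ∑ r, ∑ l, (K k r l : ℝ))
            (fun _ _ => by positivity) (Finset.mem_univ k)
  let χ : ContDiffBump y₀ := ⟨R / 2, R, by positivity, by linarith⟩
  have hχs : tsupport χ ⊆ Metric.closedBall y₀ (2 * R) := by
    rw [χ.tsupport_eq]
    exact Metric.closedBall_subset_closedBall (by change R ≤ _; linarith)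
  have hχ : IsTest U χ := ⟨χ.contDiff, χ.hasCompactSupport, hχs.trans hRU⟩
  obtain ⟨M, hM, hfr⟩ := exists_lintegral_op_mollify_le hU ha hb hv hχ hsol hΛ
    (B := Metric.ball y₀ (2 * R)) Metric.isOpen_ball.measurableSet
    (fun k r l x hx y hy => hlip k r l x hx y (hχs hy))
  let g : ι → Model n → ℝ := fun l y => χ y * v l y
  have hg : ∀ l, Integrable (g l) := fun l => hχ.integrable_mul hU (hv l)
  have hu : ∀ ε > 0, ∀ l, ContDiff ℝ ∞ (mollify ε (g l)) := fun ε hε l =>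
    contDiff_mollify hε (hg l).locallyIntegrable
  have hus : ∀ ε ∈ Ioo 0 R, ∀ l, tsupport (mollify ε (g l)) ⊆ Metric.closedBall y₀ (R + ε) := by
    intro ε hε l
    refine closure_minimal (fun x hx => ?_) Metric.isClosed_closedBall
    by_contra h
    refine hx (mollify_eq_zero (r := R) (y₀ := y₀) hε.1 (fun y hy => ?_)
      fun h' => h (Metric.ball_subset_closedBall h'))
    have : χ y = 0 := by
      have h1 := χ.support_eq
      by_contra h2
      have h3 : y ∈ Function.support χ := h2
      rw [h1] at h3
      exact hy h3
    simp [g, this]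
  have huc : ∀ ε ∈ Ioo 0 R, ∀ l, HasCompactSupport (mollify ε (g l)) := fun ε hε l =>
    (isCompact_closedBall _ _).of_isClosed_subset (isClosed_tsupport _) (hus ε hε l)
  have hpm : ∀ ε ∈ Ioo 0 R, ∀ k l, MemLp (pd k (mollify ε (g l))) 2 volume := fun ε hε k l =>
    (contDiff_pd (hu ε hε.1 l) k).continuous.memLp_of_hasCompactSupport
      (hasCompactSupport_pd (huc ε hε l) k)
  -- the uniform bound for the gradients
  have hbound : ∀ ε ∈ Ioo 0 R, ∑ k, ∑ l, ∫ y, (pd k (mollify ε (g l)) y) ^ 2 ≤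
      4 / c * (Fintype.card κ * M.toReal) := by
    intro ε hε
    set u : ι → Model n → ℝ := fun l => mollify ε (g l)
    set S := ∑ k, ∑ l, ∫ y, (pd k (u l) y) ^ 2 with hS
    have hsq : ∀ k l, Integrable fun y => (pd k (u l) y) ^ 2 := fun k l =>
      (hpm ε hε k l).integrable_sq
    let Q : κ → Model n → ℝ := fun r => (Metric.ball y₀ (2 * R)).indicator
      fun x => (∑ k, ∑ l, a k r l x * pd k (u l) x) ^ 2
    have hQm : ∀ r, AEStronglyMeasurable (Q r) volume := by
      intro r
      refine (aestronglyMeasurable_indicator_iff Metric.isOpen_ball.measurableSet).2 ?_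
      refine ContinuousOn.aestronglyMeasurable ?_ Metric.isOpen_ball.measurableSet
      refine ContinuousOn.pow (continuousOn_finsetSum _ fun k _ =>
        continuousOn_finsetSum _ fun l _ => ContinuousOn.mul ?_ ?_) 2
      · exact (ha k r l).continuousOn.mono hB2
      · exact (contDiff_pd (hu ε hε.1 l) k).continuous.continuousOn
    have hQn : ∀ r x, 0 ≤ Q r x := fun r x => indicator_nonneg (fun x _ => sq_nonneg _) x
    have hQl : ∀ r, ∫⁻ x, ENNReal.ofReal (Q r x) ≤ M := by
      intro r
      refine le_trans (le_of_eq ?_) (hfr ε hε.1 r)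
      rw [← lintegral_indicator Metric.isOpen_ball.measurableSet]
      refine lintegral_congr fun x => ?_
      by_cases hx : x ∈ Metric.ball y₀ (2 * R)
      · simp only [Q, indicator_of_mem hx, u, g]
        rw [← ofReal_norm, ← ENNReal.ofReal_pow (norm_nonneg _), Real.norm_eq_abs, sq_abs]
      · simp [Q, indicator_of_notMem hx]
    have hQi : ∀ r, Integrable (Q r) := fun r =>
      ⟨hQm r, (hasFiniteIntegral_iff_ofReal (Filter.Eventually.of_forall (hQn r))).2
        (lt_of_le_of_lt (hQl r) hM.lt_top)⟩
    have hQb : ∀ r, ∫ x, Q r x ≤ M.toReal := fun r => by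
      rw [integral_eq_lintegral_of_nonneg_ae (Filter.Eventually.of_forall (hQn r)) (hQm r)]
      exact ENNReal.toReal_mono hM (hQl r)
    have hpt : ∀ r x, (∑ k, ∑ l, a k r l y₀ * pd k (u l) x) ^ 2 ≤
        2 * ((n * Fintype.card ι) * δ ^ 2 * ∑ k, ∑ l, (pd k (u l) x) ^ 2) + 2 * Q r x := by
      intro r x
      by_cases hx : x ∈ Metric.ball y₀ (2 * R)
      · have e1 : ∑ k, ∑ l, a k r l y₀ * pd k (u l) x =
            (∑ k, ∑ l, (a k r l y₀ - a k r l x) * pd k (u l) x) +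
              ∑ k, ∑ l, a k r l x * pd k (u l) x := by
          simp only [← Finset.sum_add_distrib]
          refine Finset.sum_congr rfl fun k _ => Finset.sum_congr rfl fun l _ => ?_
          ring
        have e2 : (∑ k, ∑ l, (a k r l y₀ - a k r l x) * pd k (u l) x) ^ 2 ≤
            (n * Fintype.card ι) * δ ^ 2 * ∑ k, ∑ l, (pd k (u l) x) ^ 2 := by
          rw [← Fintype.sum_prod_type', ← Fintype.sum_prod_type', mul_assoc, Finset.mul_sum]
          refine sq_sum_le_card_mul_sum_sq.trans ?_
          rw [Finset.card_univ, Fintype.card_prod, Fintype.card_fin]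
          push_cast
          refine mul_le_mul_of_nonneg_left (Finset.sum_le_sum fun q _ => ?_) (by positivity)
          rw [mul_pow]
          refine mul_le_mul_of_nonneg_right ?_ (sq_nonneg _)
          rw [← sq_abs]
          exact pow_le_pow_left₀ (abs_nonneg _)
            (hosc x (Metric.ball_subset_closedBall hx) _ _ _) 2
        have e3 : Q r x = (∑ k, ∑ l, a k r l x * pd k (u l) x) ^ 2 := indicator_of_mem hx _
        rw [e3, e1]
        nlinarith [sq_nonneg ((∑ k, ∑ l, (a k r l y₀ - a k r l x) * pd k (u l) x) -
          ∑ k, ∑ l, a k r l x * pd k (u l) x)]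
      · have : ∀ k l, pd k (u l) x = 0 := fun k l => by
          refine pd_eq_zero_of_notMem_tsupport fun h => hx ?_
          have h1 := hus ε hε l h
          rw [Metric.mem_closedBall] at h1
          rw [Metric.mem_ball]
          linarith [hε.2]
        simp only [this]
        have := hQn r x
        simp
        linarith
    have hmain : c * S ≤ 2 * m * δ ^ 2 * S + 2 * (Fintype.card κ * M.toReal) := by
      refine (hest u (hu ε hε.1) (huc ε hε)).trans ?_
      have hI : Integrable fun x => ∑ k, ∑ l, (pd k (u l) x) ^ 2 :=
        integrable_finsetSum _ fun k _ => integrable_finsetSum _ fun l _ => hsq k l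
      have hIS : ∫ x, ∑ k, ∑ l, (pd k (u l) x) ^ 2 = S := by
        rw [integral_finsetSum _ fun k _ => integrable_finsetSum _ fun l _ => hsq k l]
        exact Finset.sum_congr rfl fun k _ => integral_finsetSum _ fun l _ => hsq k l
      have hr : ∀ r, ∫ x, (∑ k, ∑ l, a k r l y₀ * pd k (u l) x) ^ 2 ≤
          2 * ((n * Fintype.card ι) * δ ^ 2 * S) + 2 * M.toReal := by
        intro r
        calc _ ≤ ∫ x, (2 * ((n * Fintype.card ι) * δ ^ 2 * ∑ k, ∑ l, (pd k (u l) x) ^ 2) +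
              2 * Q r x) := by
              refine integral_mono_of_nonneg (Filter.Eventually.of_forall fun x => sq_nonneg _)
                (((hI.const_mul _).const_mul _).add ((hQi r).const_mul _))
                (Filter.Eventually.of_forall (hpt r))
          _ = 2 * ((n * Fintype.card ι) * δ ^ 2 * S) + 2 * ∫ x, Q r x := by
              rw [integral_add ((hI.const_mul _).const_mul _) ((hQi r).const_mul _),
                integral_const_mul, integral_const_mul, integral_const_mul, hIS]
          _ ≤ _ := by linarith [hQb r]
      refine (Finset.sum_le_sum fun r _ => hr r).trans (le_of_eq ?_)
      rw [Finset.sum_const, Finset.card_univ, nsmul_eq_mul, hm]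
      ring
    have hS0 : 0 ≤ S := Finset.sum_nonneg fun k _ => Finset.sum_nonneg fun l _ =>
      integral_nonneg fun x => sq_nonneg _
    have h1 : c / 2 * S ≤ 2 * (Fintype.card κ * M.toReal) := by nlinarith
    rw [div_mul_eq_mul_div, le_div_iff₀ hc]
    linarith
  have hex : ∀ k l, ∃ w, MemLp w 2 volume ∧ IsWeakDeriv univ k (g l) w := by
    intro k l
    refine exists_weakDeriv_of_bounded (hg l) hR (fun ε hε => hpm ε hε k l)
      (C := 4 / c * (Fintype.card κ * M.toReal)) fun ε hε => ?_
    refine le_trans ?_ (hbound ε hε)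
    have h0 : ∀ k l, 0 ≤ ∫ y, (pd k (mollify ε (g l)) y) ^ 2 := fun k l =>
      integral_nonneg fun x => sq_nonneg _
    exact (Finset.single_le_sum (f := fun l => ∫ y, (pd k (mollify ε (g l)) y) ^ 2)
      (fun l _ => h0 k l) (Finset.mem_univ l)).trans
      (Finset.single_le_sum (f := fun k => ∑ l, ∫ y, (pd k (mollify ε (g l)) y) ^ 2)
      (fun k _ => Finset.sum_nonneg fun l _ => h0 k l) (Finset.mem_univ k))
  choose w hw hwd using hex
  refine ⟨R / 2, by positivity, (Metric.ball_subset_ball (by linarith)).trans hB2, w, hw,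
    fun k l φ hφ => ?_⟩
  rw [← hwd k l φ (hφ.mono (subset_univ _))]
  refine integral_congr_ae (Filter.Eventually.of_forall fun y => ?_)
  by_cases hy : y ∈ tsupport φ
  · have : χ y = 1 := χ.one_of_mem_closedBall (Metric.ball_subset_closedBall (hφ.3 hy))
    simp [g, this]
  · simp [pd_eq_zero_of_notMem_tsupport hy]

end FirstOrderRegularity

/-! ### Prolongation and weak derivatives of all orders -/

section Prolongation

variable {n : ℕ}

/-- The function `v` has integrable weak derivatives of order at most `m` on `U`. -/
def HasWeakDerivs : ℕ → Set (Model n) → (Model n → ℝ) → Prop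
  | 0, U, v => IntegrableOn v U
  | m + 1, U, v => IntegrableOn v U ∧ ∃ w : Fin n → Model n → ℝ,
      ∀ k, IsWeakDeriv U k v (w k) ∧ HasWeakDerivs m U (w k)

lemma HasWeakDerivs.integrableOn {m : ℕ} {U : Set (Model n)} {v : Model n → ℝ}
    (h : HasWeakDerivs m U v) : IntegrableOn v U := by
  cases m with
  | zero => exact h
  | succ m => exact h.1

variable {κ ι : Type*}

/-- The leading coefficients of the prolonged system, which is satisfied by `(v, ∂v)` if `v` is a
solution of the original one: its rows are the rows of the original system and their partial
derivatives. The index `none` stands for the functions themselves, `some j` for the `j`-th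
derivatives. -/
def prolongCoeff (a : Fin n → κ → ι → Model n → ℝ) :
    Fin n → Option (Fin n) × κ → Option (Fin n) × ι → Model n → ℝ
  | k, (none, r), (none, l) => a k r l
  | _, (none, _), (some _, _) => fun _ => 0
  | k, (some j, r), (none, l) => pd j (a k r l)
  | k, (some j, r), (some j', l) => if j = j' then a k r l else fun _ => 0

/-- The lower order coefficients of the prolonged system. -/
def prolongLower (b : κ → ι → Model n → ℝ) :
    Option (Fin n) × κ → Option (Fin n) × ι → Model n → ℝ
  | (none, r), (none, l) => b r l
  | (none, _), (some _, _) => fun _ => 0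
  | (some j, r), (none, l) => pd j (b r l)
  | (some j, r), (some j', l) => if j = j' then b r l else fun _ => 0

/-- The functions `v` together with their derivatives `w`. -/
def prolongFun (v : ι → Model n → ℝ) (w : Fin n → ι → Model n → ℝ) :
    Option (Fin n) × ι → Model n → ℝ
  | (none, l) => v l
  | (some j, l) => w j l

lemma contDiffOn_prolongCoeff {U : Set (Model n)} (hU : IsOpen U)
    {a : Fin n → κ → ι → Model n → ℝ} (ha : ∀ k r l, ContDiffOn ℝ ∞ (a k r l) U) :
    ∀ k r l, ContDiffOn ℝ ∞ (prolongCoeff a k r l) U := by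
  rintro k ⟨_ | j, r⟩ ⟨_ | j', l⟩
  · exact ha k r l
  · exact contDiffOn_const
  · exact contDiffOn_pd hU (ha k r l) j
  · by_cases h : j = j'
    · simpa [prolongCoeff, h] using ha k r l
    · simpa [prolongCoeff, h] using contDiffOn_const

lemma contDiffOn_prolongLower {U : Set (Model n)} (hU : IsOpen U)
    {b : κ → ι → Model n → ℝ} (hb : ∀ r l, ContDiffOn ℝ ∞ (b r l) U) :
    ∀ r l, ContDiffOn ℝ ∞ (prolongLower b r l) U := by
  rintro ⟨_ | j, r⟩ ⟨_ | j', l⟩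
  · exact hb r l
  · exact contDiffOn_const
  · exact contDiffOn_pd hU (hb r l) j
  · by_cases h : j = j'
    · simpa [prolongLower, h] using hb r l
    · simpa [prolongLower, h] using contDiffOn_const

/-- The symbol of the prolonged system is block triangular with the original symbol in the diagonal
blocks, hence injective if the original symbol is. -/
lemma prolongCoeff_symbol_injective [Fintype ι] {a : Fin n → κ → ι → Model n → ℝ} {y₀ : Model n}
    (hsym : ∀ ξ : Fin n → ℝ, ξ ≠ 0 → ∀ η : ι → ℝ,
      (∀ r, ∑ k, ∑ l, a k r l y₀ * ξ k * η l = 0) → η = 0) :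
    ∀ ξ : Fin n → ℝ, ξ ≠ 0 → ∀ η : Option (Fin n) × ι → ℝ,
      (∀ r, ∑ k, ∑ l, prolongCoeff a k r l y₀ * ξ k * η l = 0) → η = 0 := by
  intro ξ hξ η h
  have h0 : ∀ l, η (none, l) = 0 := by
    refine congrFun (hsym ξ hξ (fun l => η (none, l)) fun r => ?_)
    have := h (none, r)
    simpa [Fintype.sum_prod_type, Fintype.sum_option, prolongCoeff] using this
  have h1 : ∀ j l, η (some j, l) = 0 := by
    intro j
    refine congrFun (hsym ξ hξ (fun l => η (some j, l)) fun r => ?_)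
    have := h (some j, r)
    simp only [Fintype.sum_prod_type, Fintype.sum_option, prolongCoeff, h0, mul_zero,
      Finset.sum_const_zero, zero_add] at this
    rw [← this]
    refine Finset.sum_congr rfl fun k _ => ?_
    rw [Finset.sum_eq_single j]
    · simp
    · intro j' _ hj'
      simp [Ne.symm hj']
    · simp
  funext q
  obtain ⟨_ | j, l⟩ := q
  · exact h0 l
  · exact h1 j l

/-- If `w` is the weak gradient of a weak solution `v`, then `(v, w)` is a weak solution of the
prolonged system: test the original system with derivatives of test functions. -/
lemma IsWeakSol.prolong [Fintype ι] {U : Set (Model n)} (hU : IsOpen U)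
    {a : Fin n → κ → ι → Model n → ℝ} {b : κ → ι → Model n → ℝ}
    (ha : ∀ k r l, ContDiffOn ℝ ∞ (a k r l) U) (hb : ∀ r l, ContDiffOn ℝ ∞ (b r l) U)
    {v : ι → Model n → ℝ} {w : Fin n → ι → Model n → ℝ}
    (hv : ∀ l, MemLp (v l) 2 (volume.restrict U))
    (hw : ∀ k l, MemLp (w k l) 2 (volume.restrict U))
    (hwd : ∀ k l, IsWeakDeriv U k (v l) (w k l)) (hsol : IsWeakSol U a b v) :
    IsWeakSol U (prolongCoeff a) (prolongLower b) (prolongFun v w) := by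
  rintro ⟨_ | j, r⟩ φ hφ
  · simpa [Fintype.sum_prod_type, Fintype.sum_option, prolongCoeff, prolongLower, prolongFun]
      using hsol r φ hφ
  have key : ∀ f ψ : Model n → ℝ, ContDiffOn ℝ ∞ f U → IsTest U ψ → ∀ l,
      Integrable (fun y => f y * v l y * pd j ψ y) ∧
      Integrable (fun y => f y * w j l y * ψ y + pd j f y * v l y * ψ y) ∧
      ∫ y, f y * v l y * pd j ψ y = -∫ y, (f y * w j l y * ψ y + pd j f y * v l y * ψ y) := by
    intro f ψ hf hψ l
    have h1 := hwd j l _ (hψ.mul_contDiffOn hU hf)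
    have hpd : ∀ y, v l y * pd j (fun y => f y * ψ y) y =
        f y * v l y * pd j ψ y + pd j f y * v l y * ψ y := by
      intro y
      by_cases hy : y ∈ tsupport ψ
      · rw [pd_mul ((hf.contDiffAt (hU.mem_nhds (hψ.3 hy))).differentiableAt (by simp))
          (hψ.1.differentiable (by simp) y)]
        ring
      · rw [pd_eq_zero_of_notMem_tsupport fun h => hy (tsupport_mul_subset_right h),
          pd_eq_zero_of_notMem_tsupport hy, image_eq_zero_of_notMem_tsupport hy]
        ring
    simp only [hpd] at h1
    have i1 : Integrable fun y => f y * v l y * pd j ψ y := by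
      refine (((hψ.pd j).mul_contDiffOn hU hf).integrable_mul hU (hv l)).congr
        (Filter.Eventually.of_forall fun y => ?_)
      simp only
      ring
    have i2 : Integrable fun y => pd j f y * v l y * ψ y := by
      refine ((hψ.mul_contDiffOn hU (contDiffOn_pd hU hf j)).integrable_mul hU (hv l)).congr
        (Filter.Eventually.of_forall fun y => ?_)
      simp only
      ring
    have i3 : Integrable fun y => f y * w j l y * ψ y := by
      refine ((hψ.mul_contDiffOn hU hf).integrable_mul hU (hw j l)).congr
        (Filter.Eventually.of_forall fun y => ?_)
      simp only
      ring
    refine ⟨i1, i3.add i2, ?_⟩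
    rw [integral_add i1 i2] at h1
    rw [integral_add i3 i2]
    have h2 : ∫ y, w j l y * (f y * ψ y) = ∫ y, f y * w j l y * ψ y :=
      integral_congr_ae (Filter.Eventually.of_forall fun y => by simp only; ring)
    linarith
  have h1 := hsol r _ (hφ.pd j)
  have e1 : ∀ k, pd k (pd j φ) = pd j (pd k φ) := fun k => pd_comm hφ.1 k j
  simp only [e1] at h1
  have k1 := fun k l => key (a k r l) (pd k φ) (ha k r l) (hφ.pd k) l
  have k2 := fun l => key (b r l) φ (hb r l) hφ l
  rw [integral_add (integrable_finsetSum _ fun k _ => integrable_finsetSum _ fun l _ => (k1 k l).1)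
    (integrable_finsetSum _ fun l _ => (k2 l).1),
    integral_finsetSum _ fun k _ => integrable_finsetSum _ fun l _ => (k1 k l).1,
    integral_finsetSum _ fun l _ => (k2 l).1] at h1
  simp_rw [integral_finsetSum _ fun l _ => (k1 _ l).1, (k1 _ _).2.2, (k2 _).2.2] at h1
  simp only [Finset.sum_neg_distrib] at h1
  simp_rw [← integral_finsetSum Finset.univ fun l _ => (k1 _ l).2.1] at h1
  rw [← integral_finsetSum _ fun k _ => integrable_finsetSum _ fun l _ => (k1 k l).2.1,
    ← integral_finsetSum _ fun l _ => (k2 l).2.1, ← neg_add, neg_eq_zero,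
    ← integral_add (integrable_finsetSum _ fun k _ =>
      integrable_finsetSum _ fun l _ => (k1 k l).2.1)
      (integrable_finsetSum _ fun l _ => (k2 l).2.1)] at h1
  rw [← h1]
  refine integral_congr_ae (Filter.Eventually.of_forall fun y => ?_)
  have hsing : ∀ F : Fin n → ℝ, ∑ j', (if j = j' then F j' else 0) = F j := fun F => by simp
  simp only [Fintype.sum_prod_type, Fintype.sum_option, prolongCoeff, prolongLower, prolongFun]
  congr 1
  · refine Finset.sum_congr rfl fun k _ => ?_
    rw [Finset.sum_add_distrib, add_comm]
    congr 1
    rw [Finset.sum_eq_single j]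
    · simp
    · intro j' _ hj'
      simp [Ne.symm hj']
    · simp
  · rw [Finset.sum_add_distrib, add_comm]
    congr 1
    rw [Finset.sum_eq_single j]
    · simp
    · intro j' _ hj'
      simp [Ne.symm hj']
    · simp

/-- A square integrable weak solution of a first order system with injective symbol at `y₀` has weak
derivatives of any given order near `y₀`. -/
theorem IsWeakSol.hasWeakDerivs (m : ℕ) [Fintype κ] [Fintype ι]
    {U : Set (Model n)} (hU : IsOpen U) {y₀ : Model n} (hy₀ : y₀ ∈ U)
    {a : Fin n → κ → ι → Model n → ℝ} {b : κ → ι → Model n → ℝ}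
    (ha : ∀ k r l, ContDiffOn ℝ ∞ (a k r l) U) (hb : ∀ r l, ContDiffOn ℝ ∞ (b r l) U)
    (hsym : ∀ ξ : Fin n → ℝ, ξ ≠ 0 → ∀ η : ι → ℝ,
      (∀ r, ∑ k, ∑ l, a k r l y₀ * ξ k * η l = 0) → η = 0)
    {v : ι → Model n → ℝ} (hv : ∀ l, MemLp (v l) 2 (volume.restrict U))
    (hsol : IsWeakSol U a b v) :
    ∃ R > 0, Metric.ball y₀ R ⊆ U ∧ ∀ l, HasWeakDerivs m (Metric.ball y₀ R) (v l) := by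
  have hint : ∀ (R : ℝ), Metric.ball y₀ R ⊆ U → ∀ l, IntegrableOn (v l) (Metric.ball y₀ R) := by
    intro R hR l
    have : IsFiniteMeasure (volume.restrict (Metric.ball y₀ R)) :=
      ⟨by simpa using measure_ball_lt_top⟩
    exact ((hv l).mono_measure (Measure.restrict_mono hR le_rfl)).integrable (by norm_num)
  induction m generalizing κ ι U with
  | zero =>
    obtain ⟨R, hR, h⟩ := Metric.isOpen_iff.1 hU y₀ hy₀
    exact ⟨R, hR, h, hint R h⟩
  | succ m ih =>
    obtain ⟨R, hR, hRU, w, hw, hwd⟩ := hsol.exists_weakDeriv hU hy₀ ha hb hsym hv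
    have hv' : ∀ l, MemLp (v l) 2 (volume.restrict (Metric.ball y₀ R)) := fun l =>
      (hv l).mono_measure (Measure.restrict_mono hRU le_rfl)
    have ha' := fun k r l => (ha k r l).mono hRU
    have hb' := fun r l => (hb r l).mono hRU
    have hV : ∀ q, MemLp (prolongFun v w q) 2 (volume.restrict (Metric.ball y₀ R)) := by
      rintro ⟨_ | j, l⟩
      · exact hv' l
      · exact (hw j l).restrict _
    obtain ⟨R', hR', hRR', hder⟩ := ih (U := Metric.ball y₀ R) Metric.isOpen_ball (Metric.mem_ball_self hR)
      (contDiffOn_prolongCoeff Metric.isOpen_ball ha')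
      (contDiffOn_prolongLower Metric.isOpen_ball hb') (prolongCoeff_symbol_injective hsym) hV
      ((hsol.mono hRU).prolong Metric.isOpen_ball ha' hb' hv'
        (fun k l => (hw k l).restrict _) hwd) (fun R'' h q => by
          have : IsFiniteMeasure (volume.restrict (Metric.ball y₀ R'')) :=
            ⟨by simpa using measure_ball_lt_top⟩
          exact ((hV q).mono_measure (Measure.restrict_mono h le_rfl)).integrable (by norm_num))
    refine ⟨R', hR', hRR'.trans hRU, fun l => ⟨hint R' (hRR'.trans hRU) l, fun k => w k l,
      fun k => ⟨(hwd k l).mono hRR', hder (some k, l)⟩⟩⟩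

end Prolongation

/-! ### Smoothness of weak solutions -/

section Smoothness

variable {n : ℕ}

/-- The real plane wave with frequency `ξ` and phase `α`. -/
def wave (ξ : Model n) (α : ℝ) (y : Model n) : ℝ := Real.cos (2 * Real.pi * inner ℝ y ξ + α)

lemma contDiff_wave (ξ : Model n) (α : ℝ) : ContDiff ℝ ∞ (wave ξ α) :=
  Real.contDiff_cos.comp ((contDiff_const.mul (contDiff_id.inner ℝ contDiff_const)).add
    contDiff_const)

lemma pd_wave (ξ : Model n) (α : ℝ) (k : Fin n) (y : Model n) :
    pd k (wave ξ α) y = 2 * Real.pi * ξ k * wave ξ (α + Real.pi / 2) y := by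
  have h1 : HasFDerivAt (fun y : Model n => 2 * Real.pi * inner ℝ y ξ + α)
      ((2 * Real.pi) • (innerSL ℝ ξ)) y := by
    have h0 : HasFDerivAt (fun y : Model n => inner ℝ y ξ) (innerSL ℝ ξ) y := by
      have := (innerSL ℝ ξ).hasFDerivAt (x := y)
      refine this.congr_of_eventuallyEq (Filter.Eventually.of_forall fun z => ?_)
      simp [real_inner_comm]
    exact (h0.const_mul (2 * Real.pi)).add_const α
  have h2 : fderiv ℝ (wave ξ α) y = _ := h1.cos.fderiv
  rw [pd, h2, wave, ← add_assoc, Real.cos_add_pi_div_two]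
  have h3 : inner ℝ ξ (EuclideanSpace.single k (1 : ℝ)) = ξ k := by
    simp [EuclideanSpace.inner_single_right]
  simp [h3]
  ring

lemma IsTest.mul_wave {U : Set (Model n)} (hU : IsOpen U) {χ : Model n → ℝ} (hχ : IsTest U χ)
    (ξ : Model n) (α : ℝ) : IsTest U (fun y => wave ξ α y * χ y) :=
  hχ.mul_contDiffOn hU (contDiff_wave ξ α).contDiffOn

lemma norm_le_sum_abs (ξ : Model n) : ‖ξ‖ ≤ ∑ k, |ξ k| := by
  conv_lhs => rw [← (EuclideanSpace.basisFun (Fin n) ℝ).sum_repr ξ]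
  refine (norm_sum_le _ _).trans (Finset.sum_le_sum fun k _ => ?_)
  simp [norm_smul]

/-- Weak derivatives of order `m` give decay of order `m` of the Fourier coefficients of the
localized function; integrating by parts against a plane wave gains one factor of the frequency. -/
lemma HasWeakDerivs.exists_decay {m : ℕ} {U : Set (Model n)} (hU : IsOpen U) {v : Model n → ℝ}
    (hv : HasWeakDerivs m U v) {χ : Model n → ℝ} (hχ : IsTest U χ) :
    ∃ C, ∀ (ξ : Model n) (α : ℝ), ‖ξ‖ ^ m * |∫ y, v y * (wave ξ α y * χ y)| ≤ C := by
  induction m generalizing v χ with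
  | zero =>
    refine ⟨∫ y, |χ y * v y|, fun ξ α => ?_⟩
    rw [pow_zero, one_mul]
    refine (abs_integral_le_integral_abs).trans (integral_mono_of_nonneg
      (Filter.Eventually.of_forall fun y => abs_nonneg _)
      (hχ.integrable_mul_of_integrableOn hU hv.integrableOn).abs
      (Filter.Eventually.of_forall fun y => ?_))
    simp only [abs_mul]
    have h1 : |wave ξ α y| ≤ 1 := Real.abs_cos_le_one _
    have h2 := mul_le_mul_of_nonneg_right h1 (mul_nonneg (abs_nonneg (v y)) (abs_nonneg (χ y)))
    linarith
  | succ m ih =>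
    obtain ⟨hvi, w, hw⟩ := hv
    have hv' : HasWeakDerivs m U v := by
      clear ih
      induction m generalizing v w with
      | zero => exact hvi
      | succ m ih' =>
        refine ⟨hvi, w, fun k => ⟨(hw k).1, ?_⟩⟩
        obtain ⟨h1, w', hw'⟩ := (hw k).2
        exact ih' h1 w' hw'
    choose C₁ hC₁ using fun k => ih hv' (hχ.pd k)
    choose C₂ hC₂ using fun k => ih (hw k).2 hχ
    have hid : ∀ k (ξ : Model n) (α : ℝ),
        2 * Real.pi * ξ k * ∫ y, v y * (wave ξ (α + Real.pi / 2) y * χ y) =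
        -(∫ y, v y * (wave ξ α y * pd k χ y)) - ∫ y, w k y * (wave ξ α y * χ y) := by
      intro k ξ α
      have h := (hw k).1 _ (hχ.mul_wave hU ξ α)
      have hpd : ∀ y, v y * pd k (fun y => wave ξ α y * χ y) y = v y * (wave ξ α y * pd k χ y) +
          2 * Real.pi * ξ k * (v y * (wave ξ (α + Real.pi / 2) y * χ y)) := by
        intro y
        rw [pd_mul ((contDiff_wave ξ α).differentiable (by simp) y)
          (hχ.1.differentiable (by simp) y), pd_wave]
        ring
      have i1 : Integrable fun y => v y * (wave ξ α y * pd k χ y) := by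
        refine (((hχ.pd k).mul_wave hU ξ α).integrable_mul_of_integrableOn hU hvi).congr
          (Filter.Eventually.of_forall fun y => mul_comm _ _)
      have i2 : Integrable fun y => v y * (wave ξ (α + Real.pi / 2) y * χ y) := by
        refine ((hχ.mul_wave hU ξ _).integrable_mul_of_integrableOn hU hvi).congr
          (Filter.Eventually.of_forall fun y => mul_comm _ _)
      simp only [hpd] at h
      rw [integral_add i1 (i2.const_mul _), integral_const_mul] at h
      linarith
    refine ⟨∑ k, (C₁ k + C₂ k), fun ξ α => ?_⟩
    set I := ∫ y, v y * (wave ξ α y * χ y)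
    have hk : ∀ k, |ξ k| * (‖ξ‖ ^ m * |I|) ≤ C₁ k + C₂ k := by
      intro k
      have h := hid k ξ (α - Real.pi / 2)
      rw [sub_add_cancel] at h
      have h1 := hC₁ k ξ (α - Real.pi / 2)
      have h2 := hC₂ k ξ (α - Real.pi / 2)
      have h3 : |2 * Real.pi * ξ k * I| ≤
          |∫ y, v y * (wave ξ (α - Real.pi / 2) y * pd k χ y)| +
          |∫ y, w k y * (wave ξ (α - Real.pi / 2) y * χ y)| := by
        rw [h]
        refine (abs_sub _ _).trans (le_of_eq ?_)
        rw [abs_neg]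
      have h4 : |ξ k| * |I| ≤ |2 * Real.pi * ξ k * I| := by
        rw [abs_mul, abs_mul, abs_of_pos (by positivity : (0 : ℝ) < 2 * Real.pi), mul_assoc]
        have : 0 ≤ |ξ k| * |I| := by positivity
        nlinarith [Real.pi_gt_three]
      calc |ξ k| * (‖ξ‖ ^ m * |I|) = ‖ξ‖ ^ m * (|ξ k| * |I|) := by ring
        _ ≤ ‖ξ‖ ^ m * (|∫ y, v y * (wave ξ (α - Real.pi / 2) y * pd k χ y)| +
          |∫ y, w k y * (wave ξ (α - Real.pi / 2) y * χ y)|) :=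
            mul_le_mul_of_nonneg_left (h4.trans h3) (by positivity)
        _ ≤ _ := by rw [mul_add]; exact add_le_add h1 h2
    calc ‖ξ‖ ^ (m + 1) * |I| = ‖ξ‖ * (‖ξ‖ ^ m * |I|) := by ring
      _ ≤ (∑ k, |ξ k|) * (‖ξ‖ ^ m * |I|) :=
          mul_le_mul_of_nonneg_right (norm_le_sum_abs ξ) (by positivity)
      _ = ∑ k, |ξ k| * (‖ξ‖ ^ m * |I|) := by rw [Finset.sum_mul]
      _ ≤ _ := Finset.sum_le_sum fun k _ => hk k

lemma HasWeakDerivs.zero_of {m : ℕ} {U : Set (Model n)} {v : Model n → ℝ}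
    (hv : HasWeakDerivs m U v) : HasWeakDerivs 0 U v := hv.integrableOn

open scoped FourierTransform in
/-- A continuous function with weak derivatives of order `m + n + 1` is of class `C^m`, by Fourier
inversion. -/
lemma HasWeakDerivs.contDiff_mul {m : ℕ} {U : Set (Model n)} (hU : IsOpen U) {v : Model n → ℝ}
    (hv : HasWeakDerivs (m + n + 1) U v) (hc : ContinuousOn v U) {χ : Model n → ℝ}
    (hχ : IsTest U χ) : ContDiff ℝ m (fun y => χ y * v y) := by
  let f : Model n → ℂ := fun y => ((χ y * v y : ℝ) : ℂ)
  have hcont : Continuous fun y => χ y * v y := by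
    rw [continuous_iff_continuousAt]
    intro y
    by_cases hy : y ∈ U
    · exact hχ.1.continuous.continuousAt.mul (hc.continuousAt (hU.mem_nhds hy))
    · have h0 : (fun y => χ y * v y) =ᶠ[𝓝 y] fun _ => 0 := by
        have : (tsupport χ)ᶜ ∈ 𝓝 y :=
          (isClosed_tsupport χ).isOpen_compl.mem_nhds fun h => hy (hχ.3 h)
        filter_upwards [this] with z hz
        simp [image_eq_zero_of_notMem_tsupport hz]
      exact continuousAt_const.congr h0.symm
  have hi : Integrable fun y => χ y * v y :=
    hcont.integrable_of_hasCompactSupport hχ.2.mul_right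
  have hfi : Integrable f := hi.ofReal
  have hfc : Continuous f := Complex.continuous_ofReal.comp hcont
  have hF : ∀ ξ, 𝓕 f ξ = ((∫ y, v y * (wave ξ 0 y * χ y) : ℝ) : ℂ) +
      ((∫ y, v y * (wave ξ (Real.pi / 2) y * χ y) : ℝ) : ℂ) * Complex.I := by
    intro ξ
    have i : ∀ α, Integrable fun y => v y * (wave ξ α y * χ y) := by
      intro α
      refine ((hχ.mul_wave hU ξ α).integrable_mul_of_integrableOn hU hv.integrableOn).congr
          (Filter.Eventually.of_forall fun y => mul_comm _ _)
    have i' : ∀ α, Integrable fun y => ((v y * (wave ξ α y * χ y) : ℝ) : ℂ) := fun α =>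
      (i α).ofReal
    rw [Real.fourier_eq', ← integral_complex_ofReal, ← integral_complex_ofReal,
      ← integral_mul_const, ← integral_add (i' 0) ((i' _).mul_const _)]
    refine integral_congr_ae (Filter.Eventually.of_forall fun y => ?_)
    simp only [wave, f, add_zero, Real.cos_add_pi_div_two]
    have : ((-2 * Real.pi * inner ℝ y ξ : ℝ) : ℂ) = -((2 * Real.pi * inner ℝ y ξ : ℝ) : ℂ) := by
      push_cast; ring
    rw [this, Complex.exp_mul_I, Complex.cos_neg, Complex.sin_neg, ← Complex.ofReal_cos,
      ← Complex.ofReal_sin, smul_eq_mul]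
    push_cast
    ring
  have hFc : Continuous (𝓕 f) := by
    have := (Real.contDiff_fourier (f := f) (N := 0) (by
      intro j hj
      have : j = 0 := by simpa using hj
      simpa [this] using hfi.norm)).continuous
    exact this
  obtain ⟨C₀, hC₀⟩ := hv.zero_of.exists_decay hU hχ
  obtain ⟨C₁, hC₁⟩ := hv.exists_decay hU hχ
  have hdecay : ∀ j : ℕ, j ≤ m → Integrable fun ξ => ‖ξ‖ ^ j * ‖𝓕 f ξ‖ := by
    intro j hj
    set N := m + n + 1 with hN
    have hb : ∀ ξ, (1 + ‖ξ‖) ^ N * ‖𝓕 f ξ‖ ≤ 2 ^ N * (2 * C₀ + 2 * C₁) := by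
      intro ξ
      have h1 : ‖𝓕 f ξ‖ ≤ |∫ y, v y * (wave ξ 0 y * χ y)| +
          |∫ y, v y * (wave ξ (Real.pi / 2) y * χ y)| := by
        rw [hF]
        refine (norm_add_le _ _).trans (le_of_eq ?_)
        simp only [norm_mul, Complex.norm_I, mul_one, Complex.norm_real, Real.norm_eq_abs]
      have h2 : (1 + ‖ξ‖) ^ N ≤ 2 ^ N * (1 + ‖ξ‖ ^ N) := by
        calc (1 + ‖ξ‖) ^ N ≤ (2 * max 1 ‖ξ‖) ^ N := by
              refine pow_le_pow_left₀ (by positivity) ?_ N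
              have := le_max_left 1 ‖ξ‖
              have := le_max_right 1 ‖ξ‖
              linarith
          _ = 2 ^ N * (max 1 ‖ξ‖) ^ N := mul_pow _ _ _
          _ ≤ _ := by
              refine mul_le_mul_of_nonneg_left ?_ (by positivity)
              rcases max_choice 1 ‖ξ‖ with h | h <;> rw [h]
              · rw [one_pow]
                linarith [pow_nonneg (norm_nonneg ξ) N]
              · linarith
      have a0 := hC₀ ξ 0
      have a1 := hC₀ ξ (Real.pi / 2)
      have a2 := hC₁ ξ 0
      have a3 := hC₁ ξ (Real.pi / 2)
      rw [pow_zero, one_mul] at a0 a1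
      calc (1 + ‖ξ‖) ^ N * ‖𝓕 f ξ‖ ≤ (2 ^ N * (1 + ‖ξ‖ ^ N)) *
            (|∫ y, v y * (wave ξ 0 y * χ y)| + |∫ y, v y * (wave ξ (Real.pi / 2) y * χ y)|) :=
              mul_le_mul h2 h1 (norm_nonneg _) (by positivity)
        _ ≤ _ := by
            rw [mul_assoc]
            refine mul_le_mul_of_nonneg_left ?_ (by positivity)
            rw [add_mul, one_mul, mul_add]
            linarith
    have hmaj := (integrable_one_add_norm (E := Model n) (μ := volume) (r := n + 1)
      (by simp)).const_mul (2 ^ N * (2 * C₀ + 2 * C₁))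
    refine hmaj.mono' ((continuous_norm.pow j).mul hFc.norm).aestronglyMeasurable
      (Filter.Eventually.of_forall fun ξ => ?_)
    have hp : (0 : ℝ) < 1 + ‖ξ‖ := by positivity
    rw [Real.norm_of_nonneg (by positivity), Real.rpow_neg hp.le, ← div_eq_mul_inv,
      le_div_iff₀ (by positivity)]
    have e : (1 + ‖ξ‖) ^ ((n : ℝ) + 1) = (1 + ‖ξ‖) ^ (n + 1) := by
      rw [← Real.rpow_natCast]; push_cast; rfl
    rw [e]
    refine le_trans ?_ (hb ξ)
    calc ‖ξ‖ ^ j * ‖𝓕 f ξ‖ * (1 + ‖ξ‖) ^ (n + 1)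
        ≤ (1 + ‖ξ‖) ^ m * ‖𝓕 f ξ‖ * (1 + ‖ξ‖) ^ (n + 1) := by
          gcongr
          calc ‖ξ‖ ^ j ≤ (1 + ‖ξ‖) ^ j := by gcongr; linarith
            _ ≤ (1 + ‖ξ‖) ^ m := pow_le_pow_right₀ (by linarith [norm_nonneg ξ]) hj
      _ = _ := by rw [hN]; ring
  have hFi : Integrable (𝓕 f) := by
    have := hdecay 0 (Nat.zero_le _)
    simp only [pow_zero, one_mul] at this
    exact (integrable_norm_iff hFc.aestronglyMeasurable).1 this
  have hinv : f = 𝓕⁻ (𝓕 f) := (hfc.fourierInv_fourier_eq hfi hFi).symm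
  have hsm : ContDiff ℝ m (𝓕 (𝓕 f)) := Real.contDiff_fourier (N := m) fun j hj =>
    hdecay j (by exact_mod_cast hj)
  have hsf : ContDiff ℝ m f := by
    rw [hinv]
    have : 𝓕⁻ (𝓕 f) = fun y => 𝓕 (𝓕 f) (-y) := by
      funext y
      exact Real.fourierInv_eq_fourier_neg _ _
    rw [this]
    exact hsm.comp contDiff_neg
  have : (fun y => χ y * v y) = fun y => (f y).re := by
    funext y
    simp [f]
  rw [this]
  exact Complex.reCLM.contDiff.comp hsf

/-- **Elliptic regularity**: a continuous weak solution of a first order system with smooth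
coefficients is smooth at every point at which the symbol of the system is injective. -/
theorem IsWeakSol.contDiffAt {κ ι : Type*} [Fintype κ] [Fintype ι]
    {U : Set (Model n)} (hU : IsOpen U) {y₀ : Model n} (hy₀ : y₀ ∈ U)
    {a : Fin n → κ → ι → Model n → ℝ} {b : κ → ι → Model n → ℝ}
    (ha : ∀ k r l, ContDiffOn ℝ ∞ (a k r l) U) (hb : ∀ r l, ContDiffOn ℝ ∞ (b r l) U)
    (hsym : ∀ ξ : Fin n → ℝ, ξ ≠ 0 → ∀ η : ι → ℝ,
      (∀ r, ∑ k, ∑ l, a k r l y₀ * ξ k * η l = 0) → η = 0)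
    {v : ι → Model n → ℝ} (hv : ∀ l, ContinuousOn (v l) U) (hsol : IsWeakSol U a b v) (l : ι) :
    ContDiffAt ℝ ∞ (v l) y₀ := by
  rw [contDiffAt_infty]
  intro m
  obtain ⟨R₀, hR₀, hR₀U⟩ := Metric.nhds_basis_closedBall.mem_iff.1 (hU.mem_nhds hy₀)
  have hbU : Metric.ball y₀ R₀ ⊆ U := Metric.ball_subset_closedBall.trans hR₀U
  have hmem : ∀ l, MemLp (v l) 2 (volume.restrict (Metric.ball y₀ R₀)) := by
    intro l
    obtain ⟨C, hC⟩ := (isCompact_closedBall y₀ R₀).exists_bound_of_continuousOn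
      ((hv l).mono hR₀U)
    have : IsFiniteMeasure (volume.restrict (Metric.ball y₀ R₀)) :=
      ⟨by simpa using measure_ball_lt_top⟩
    exact MemLp.of_bound (((hv l).mono hbU).aestronglyMeasurable
      Metric.isOpen_ball.measurableSet) C
      (ae_restrict_of_forall_mem Metric.isOpen_ball.measurableSet fun y hy =>
        hC y (Metric.ball_subset_closedBall hy))
  obtain ⟨R, hR, hRR, hder⟩ := (hsol.mono hbU).hasWeakDerivs (m + n + 1) Metric.isOpen_ball
    (Metric.mem_ball_self hR₀) (fun k r l => (ha k r l).mono hbU) (fun r l => (hb r l).mono hbU)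
    hsym hmem
  let χ : ContDiffBump y₀ := ⟨R / 3, R / 2, by positivity, by linarith⟩
  have hχ : IsTest (Metric.ball y₀ R) χ := by
    refine ⟨χ.contDiff, χ.hasCompactSupport, ?_⟩
    rw [χ.tsupport_eq]
    exact Metric.closedBall_subset_ball (by change R / 2 < R; linarith)
  have h := (hder l).contDiff_mul Metric.isOpen_ball ((hv l).mono (hRR.trans hbU)) hχ
  refine h.contDiffAt.congr_of_eventuallyEq ?_
  filter_upwards [χ.eventuallyEq_one] with y hy
  simp [hy]

end Smoothness

/-! ### Sections in local coordinates -/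

section LocalSections

set_option linter.unusedSectionVars false

variable {n : ℕ} {X : Type*} [TopologicalSpace X] [ChartedSpace (Model n) X]

section OneBundle

variable {F : Type*} [NormedAddCommGroup F] [NormedSpace ℝ F]
  {E : X → Type*} [TopologicalSpace (TotalSpace F E)]
  [∀ x, NormedAddCommGroup (E x)] [∀ x, InnerProductSpace ℝ (E x)] [FiberBundle F E]

variable (n F) in
/-- The section `u` is of class `C^k` at the point `x`. -/
abbrev IsCkAt (k : ℕ∞ω) (u : ∀ x, E x) (x : X) : Prop :=
  ContMDiffAt (𝓡 n) ((𝓡 n).prod 𝓘(ℝ, F)) k (fun x => TotalSpace.mk' F x (u x)) x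

variable (n F) in
/-- The section `u` is of class `C^k`. -/
abbrev IsCk (k : ℕ∞ω) (u : ∀ x, E x) : Prop := ∀ x, IsCkAt n F k u x

lemma IsSmoothSection.isCk {u : ∀ x, E x} (h : IsSmoothSection n F u) (k : ℕ∞) : IsCk n F k u :=
  fun x => (h x).of_le (by exact_mod_cast le_top)

lemma isCk_one_of_isSmoothSection {u : ∀ x, E x} (h : IsSmoothSection n F u) : IsCk n F 1 u :=
  h.isCk 1

variable (n F E) in
/-- The points of `X` over which both the chart and the trivialization around `x₀` are defined. -/
def patch (x₀ : X) : Set X :=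
  (chartAt (Model n) x₀).source ∩ (trivializationAt F E x₀).baseSet

lemma isOpen_patch (x₀ : X) : IsOpen (patch n F E x₀) :=
  (chartAt (Model n) x₀).open_source.inter (trivializationAt F E x₀).open_baseSet

lemma mem_patch_self (x₀ : X) : x₀ ∈ patch n F E x₀ :=
  ⟨mem_chart_source _ x₀, mem_baseSet_trivializationAt F E x₀⟩

lemma isOpen_coordDomain (x₀ : X) : IsOpen (coordDomain n F E x₀) :=
  (chartAt (Model n) x₀).isOpen_inter_preimage_symm (trivializationAt F E x₀).open_baseSet

lemma chartAt_mem_coordDomain {x₀ x : X} (hx : x ∈ patch n F E x₀) :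
    chartAt (Model n) x₀ x ∈ coordDomain n F E x₀ := by
  refine ⟨(chartAt (Model n) x₀).map_source hx.1, ?_⟩
  rw [mem_preimage, (chartAt (Model n) x₀).left_inv hx.1]
  exact hx.2

lemma symm_mem_patch {x₀ : X} {y : Model n} (hy : y ∈ coordDomain n F E x₀) :
    (chartAt (Model n) x₀).symm y ∈ patch n F E x₀ :=
  ⟨(chartAt (Model n) x₀).map_target hy.1, hy.2⟩

variable [VectorBundle ℝ F E]

lemma localRep_eq (x₀ : X) (u : ∀ x, E x) {y : Model n} (hy : y ∈ coordDomain n F E x₀) :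
    localRep n F x₀ u y = (trivializationAt F E x₀).continuousLinearMapAt ℝ
      ((chartAt (Model n) x₀).symm y) (u ((chartAt (Model n) x₀).symm y)) :=
  ((trivializationAt F E x₀).continuousLinearMapAt_apply_of_mem (R := ℝ) hy.2 _).symm

lemma symmL_localRep (x₀ : X) (u : ∀ x, E x) {y : Model n} (hy : y ∈ coordDomain n F E x₀) :
    (trivializationAt F E x₀).symmL ℝ ((chartAt (Model n) x₀).symm y) (localRep n F x₀ u y) =
      u ((chartAt (Model n) x₀).symm y) := by
  rw [localRep_eq x₀ u hy, Trivialization.symmL_continuousLinearMapAt _ hy.2]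

lemma symmL_localRep_chartAt {x₀ x : X} (u : ∀ x, E x) (hx : x ∈ patch n F E x₀) :
    (trivializationAt F E x₀).symmL ℝ x (localRep n F x₀ u (chartAt (Model n) x₀ x)) = u x := by
  have h := symmL_localRep x₀ u (chartAt_mem_coordDomain hx)
  rw [(chartAt (Model n) x₀).left_inv hx.1] at h
  exact h

lemma localRep_congr {x₀ : X} {u v : ∀ x, E x} {y : Model n}
    (h : u ((chartAt (Model n) x₀).symm y) = v ((chartAt (Model n) x₀).symm y)) :
    localRep n F x₀ u y = localRep n F x₀ v y := by
  rw [localRep, localRep, h]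

lemma localRep_add (x₀ : X) (u v : ∀ x, E x) {y : Model n} (hy : y ∈ coordDomain n F E x₀) :
    localRep n F x₀ (fun x => u x + v x) y = localRep n F x₀ u y + localRep n F x₀ v y := by
  simp only [localRep_eq x₀ _ hy, map_add]

lemma localRep_smul (x₀ : X) (g : X → ℝ) (u : ∀ x, E x) {y : Model n}
    (hy : y ∈ coordDomain n F E x₀) :
    localRep n F x₀ (fun x => g x • u x) y =
      g ((chartAt (Model n) x₀).symm y) • localRep n F x₀ u y := by
  simp only [localRep_eq x₀ _ hy, map_smul]

lemma localRep_zero (x₀ : X) {y : Model n} (hy : y ∈ coordDomain n F E x₀) :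
    localRep n F x₀ (fun x => (0 : E x)) y = 0 := by
  simp only [localRep_eq x₀ _ hy, map_zero]

/-- The section over the patch around `x₀` with coordinate representation `φ`, continued by zero. -/
def ofLocal (x₀ : X) (φ : Model n → F) (x : X) : E x :=
  open Classical in
  if x ∈ (chartAt (Model n) x₀).source then
    (trivializationAt F E x₀).symmL ℝ x (φ (chartAt (Model n) x₀ x)) else 0

lemma ofLocal_of_mem {x₀ x : X} (φ : Model n → F) (hx : x ∈ (chartAt (Model n) x₀).source) :
    ofLocal (E := E) x₀ φ x =
      (trivializationAt F E x₀).symmL ℝ x (φ (chartAt (Model n) x₀ x)) := if_pos hx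

lemma ofLocal_symm {x₀ : X} (φ : Model n → F) {y : Model n}
    (hy : y ∈ (chartAt (Model n) x₀).target) :
    ofLocal (E := E) x₀ φ ((chartAt (Model n) x₀).symm y) =
      (trivializationAt F E x₀).symmL ℝ ((chartAt (Model n) x₀).symm y) (φ y) := by
  rw [ofLocal_of_mem φ ((chartAt (Model n) x₀).map_target hy), (chartAt (Model n) x₀).right_inv hy]

lemma localRep_ofLocal (x₀ : X) (φ : Model n → F) {y : Model n} (hy : y ∈ coordDomain n F E x₀) :
    localRep n F x₀ (ofLocal (E := E) x₀ φ) y = φ y := by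
  rw [localRep_eq x₀ _ hy, ofLocal_symm φ hy.1, Trivialization.continuousLinearMapAt_symmL _ hy.2]

lemma ofLocal_eq_zero {x₀ : X} {φ : Model n → F} {x : X}
    (h : x ∉ (chartAt (Model n) x₀).symm '' tsupport φ) : ofLocal (E := E) x₀ φ x = 0 := by
  by_cases hx : x ∈ (chartAt (Model n) x₀).source
  · have h0 : φ (chartAt (Model n) x₀ x) = 0 := image_eq_zero_of_notMem_tsupport
      fun h' => h ⟨_, h', (chartAt (Model n) x₀).left_inv hx⟩
    rw [ofLocal_of_mem φ hx, h0, map_zero]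
  · exact if_neg hx

/-- A compactly supported function in the coordinate domain gives a section vanishing near every
point outside a compact subset of the patch. -/
lemma ofLocal_eventuallyEq_zero [T2Space X] {x₀ : X} {φ : Model n → F} (hc : HasCompactSupport φ)
    (hs : tsupport φ ⊆ (chartAt (Model n) x₀).target) {x : X}
    (h : x ∉ (chartAt (Model n) x₀).symm '' tsupport φ) :
    ∀ᶠ x' in 𝓝 x, ofLocal (E := E) x₀ φ x' = 0 := by
  have hK : IsCompact ((chartAt (Model n) x₀).symm '' tsupport φ) :=
    IsCompact.image_of_continuousOn hc ((chartAt (Model n) x₀).continuousOn_symm.mono hs)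
  filter_upwards [hK.isClosed.isOpen_compl.mem_nhds h] with x' hx' using ofLocal_eq_zero hx'

lemma isCkAt_zero (k : ℕ∞ω) (x : X) : IsCkAt n F k (fun x => (0 : E x)) x :=
  contMDiff_zeroSection ℝ E x

lemma isCkAt_congr {k : ℕ∞ω} {u v : ∀ x, E x} {x : X} (h : ∀ᶠ x' in 𝓝 x, u x' = v x')
    (hv : IsCkAt n F k v x) : IsCkAt n F k u x :=
  hv.congr_of_eventuallyEq (h.mono fun _ h' => by simp only [h'])

variable [IsManifold (𝓡 n) ∞ X] [ContMDiffVectorBundle ∞ F E (𝓡 n)]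

lemma contMDiffVectorBundle_of_le (k : ℕ∞) : ContMDiffVectorBundle k F E (𝓡 n) :=
  ContMDiffVectorBundle.of_le (n := ∞) (by exact_mod_cast le_top)

/-- A section of class `C^k` has a coordinate representation of class `C^k`. -/
lemma IsCkAt.contDiffAt_localRep {k : ℕ∞} {x₀ : X} {u : ∀ x, E x} {y : Model n}
    (hy : y ∈ coordDomain n F E x₀) (hu : IsCkAt n F k u ((chartAt (Model n) x₀).symm y)) :
    ContDiffAt ℝ k (localRep n F x₀ u) y := by
  have := contMDiffVectorBundle_of_le (n := n) (F := F) (E := E) k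
  have : IsManifold (𝓡 n) k X := .of_le (n := ∞) (by exact_mod_cast le_top)
  have h1 := ((trivializationAt F E x₀).contMDiffAt_section_iff hy.2).1 hu
  have h2 : ContMDiffAt (𝓡 n) (𝓡 n) k (chartAt (Model n) x₀).symm y :=
    contMDiffOn_chart_symm.contMDiffAt ((chartAt (Model n) x₀).open_target.mem_nhds hy.1)
  exact contMDiffAt_iff_contDiffAt.1 (h1.comp y h2)

/-- A section whose coordinate representation is of class `C^k` is of class `C^k`. -/
lemma isCkAt_of_contDiffAt_localRep {k : ℕ∞} {x₀ x : X} {u : ∀ x, E x}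
    (hx : x ∈ patch n F E x₀)
    (hu : ContDiffAt ℝ k (localRep n F x₀ u) (chartAt (Model n) x₀ x)) : IsCkAt n F k u x := by
  have := contMDiffVectorBundle_of_le (n := n) (F := F) (E := E) k
  have : IsManifold (𝓡 n) k X := .of_le (n := ∞) (by exact_mod_cast le_top)
  refine ((trivializationAt F E x₀).contMDiffAt_section_iff hx.2).2 ?_
  have h2 : ContMDiffAt (𝓡 n) (𝓡 n) k (chartAt (Model n) x₀) x :=
    contMDiffOn_chart.contMDiffAt ((chartAt (Model n) x₀).open_source.mem_nhds hx.1)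
  have h3 := (contMDiffAt_iff_contDiffAt.2 hu).comp x h2
  refine h3.congr_of_eventuallyEq ?_
  filter_upwards [(chartAt (Model n) x₀).open_source.mem_nhds hx.1] with x' hx'
  have h4 : TotalSpace.mk' F ((chartAt (Model n) x₀).symm (chartAt (Model n) x₀ x'))
      (u ((chartAt (Model n) x₀).symm (chartAt (Model n) x₀ x'))) = TotalSpace.mk' F x' (u x') := by
    rw [(chartAt (Model n) x₀).left_inv hx']
  exact (congrArg (fun z => (trivializationAt F E x₀ z).2) h4).symm

lemma isCk_ofLocal [T2Space X] {k : ℕ∞} {x₀ : X} {φ : Model n → F} (hφ : ContDiff ℝ k φ)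
    (hc : HasCompactSupport φ) (hs : tsupport φ ⊆ coordDomain n F E x₀) :
    IsCk n F k (ofLocal (E := E) x₀ φ) := by
  intro x
  by_cases hx : x ∈ (chartAt (Model n) x₀).symm '' tsupport φ
  · obtain ⟨y, hy, rfl⟩ := hx
    have hyd := hs hy
    refine isCkAt_of_contDiffAt_localRep (symm_mem_patch hyd) ?_
    rw [(chartAt (Model n) x₀).right_inv hyd.1]
    refine hφ.contDiffAt.congr_of_eventuallyEq ?_
    filter_upwards [(isOpen_coordDomain x₀).mem_nhds hyd] with y' hy' using localRep_ofLocal x₀ φ hy'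
  · exact isCkAt_congr (ofLocal_eventuallyEq_zero hc (hs.trans inter_subset_left) hx)
      (isCkAt_zero k x)

end OneBundle

end LocalSections

/-! ### First order operators on sections -/

section Operators

set_option linter.unusedSectionVars false

variable {n : ℕ} {X : Type*} [TopologicalSpace X] [ChartedSpace (Model n) X]

section OneBundle

variable {F : Type*} [NormedAddCommGroup F] [NormedSpace ℝ F]
  {E : X → Type*} [TopologicalSpace (TotalSpace F E)]
  [∀ x, NormedAddCommGroup (E x)] [∀ x, InnerProductSpace ℝ (E x)] [FiberBundle F E]
  [VectorBundle ℝ F E]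

lemma IsCkAt.add {k : ℕ∞ω} {u v : ∀ x, E x} {x : X} (hu : IsCkAt n F k u x)
    (hv : IsCkAt n F k v x) : IsCkAt n F k (fun x => u x + v x) x :=
  ContMDiffAt.add_section hu hv

lemma IsCkAt.sub {k : ℕ∞ω} {u v : ∀ x, E x} {x : X} (hu : IsCkAt n F k u x)
    (hv : IsCkAt n F k v x) : IsCkAt n F k (fun x => u x - v x) x :=
  ContMDiffAt.sub_section hu hv

lemma IsCkAt.smul {k : ℕ∞ω} {g : X → ℝ} {u : ∀ x, E x} {x : X}
    (hg : ContMDiffAt (𝓡 n) 𝓘(ℝ, ℝ) k g x)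
    (hu : IsCkAt n F k u x) : IsCkAt n F k (fun x => g x • u x) x :=
  ContMDiffAt.smul_section hg hu

lemma isCkAt_sum {k : ℕ∞ω} {ι : Type*} {s : Finset ι} {u : ι → ∀ x, E x} {x : X}
    (hu : ∀ i ∈ s, IsCkAt n F k (u i) x) : IsCkAt n F k (fun x => ∑ i ∈ s, u i x) x := by
  classical
  induction s using Finset.induction_on with
  | empty => simpa using isCkAt_zero k x
  | insert i s hi ih =>
    simp only [Finset.sum_insert hi]
    exact (hu i (by simp)).add (ih fun j hj => hu j (by simp [hj]))

lemma localRep_eventuallyEq {x₀ : X} {u v : ∀ x, E x} {y : Model n}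
    (hy : y ∈ (chartAt (Model n) x₀).target)
    (h : ∀ᶠ x' in 𝓝 ((chartAt (Model n) x₀).symm y), u x' = v x') :
    localRep n F x₀ u =ᶠ[𝓝 y] localRep n F x₀ v :=
  (((chartAt (Model n) x₀).continuousAt_symm hy).eventually h).mono fun _ h' => localRep_congr h'

end OneBundle

variable {F₁ : Type*} [NormedAddCommGroup F₁] [NormedSpace ℝ F₁]
  {E₁ : X → Type*} [TopologicalSpace (TotalSpace F₁ E₁)]
  [∀ x, NormedAddCommGroup (E₁ x)] [∀ x, InnerProductSpace ℝ (E₁ x)] [FiberBundle F₁ E₁]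
  {F₂ : Type*} [NormedAddCommGroup F₂] [NormedSpace ℝ F₂]
  {E₂ : X → Type*} [TopologicalSpace (TotalSpace F₂ E₂)]
  [∀ x, NormedAddCommGroup (E₂ x)] [∀ x, InnerProductSpace ℝ (E₂ x)] [FiberBundle F₂ E₂]

variable (n F₁ E₁ F₂ E₂) in
/-- The part of the coordinate patch around `x₀` over which both bundles are trivialized. -/
def coordDomain₂ (x₀ : X) : Set (Model n) := coordDomain n F₁ E₁ x₀ ∩ coordDomain n F₂ E₂ x₀

variable (n F₁ E₁ F₂ E₂) in
/-- The points of the patch around `x₀` over which both bundles are trivialized. -/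
def patch₂ (x₀ : X) : Set X := patch n F₁ E₁ x₀ ∩ patch n F₂ E₂ x₀

lemma isOpen_coordDomain₂ (x₀ : X) : IsOpen (coordDomain₂ n F₁ E₁ F₂ E₂ x₀) :=
  (isOpen_coordDomain x₀).inter (isOpen_coordDomain x₀)

lemma isOpen_patch₂ (x₀ : X) : IsOpen (patch₂ n F₁ E₁ F₂ E₂ x₀) :=
  (isOpen_patch x₀).inter (isOpen_patch x₀)

lemma mem_patch₂_self (x₀ : X) : x₀ ∈ patch₂ n F₁ E₁ F₂ E₂ x₀ :=
  ⟨mem_patch_self x₀, mem_patch_self x₀⟩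

lemma chartAt_mem_coordDomain₂ {x₀ x : X} (hx : x ∈ patch₂ n F₁ E₁ F₂ E₂ x₀) :
    chartAt (Model n) x₀ x ∈ coordDomain₂ n F₁ E₁ F₂ E₂ x₀ :=
  ⟨chartAt_mem_coordDomain hx.1, chartAt_mem_coordDomain hx.2⟩

namespace FirstOrderOp

variable (A : FirstOrderOp n F₁ E₁ F₂ E₂)

/-- The leading coefficient of the operator in the coordinates around `x₀`. -/
def coeffA (x₀ : X) : Model n → (Model n →L[ℝ] F₁) →L[ℝ] F₂ := (A.local_formula x₀).choose

/-- The zeroth order coefficient of the operator in the coordinates around `x₀`. -/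
def coeffB (x₀ : X) : Model n → F₁ →L[ℝ] F₂ := (A.local_formula x₀).choose_spec.choose

lemma contDiffOn_coeffA (x₀ : X) : ContDiffOn ℝ ∞ (A.coeffA x₀) (coordDomain₂ n F₁ E₁ F₂ E₂ x₀) :=
  (A.local_formula x₀).choose_spec.choose_spec.1

lemma contDiffOn_coeffB (x₀ : X) : ContDiffOn ℝ ∞ (A.coeffB x₀) (coordDomain₂ n F₁ E₁ F₂ E₂ x₀) :=
  (A.local_formula x₀).choose_spec.choose_spec.2.1

lemma localRep_apply (x₀ : X) {u : ∀ x, E₁ x} {y : Model n}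
    (hy : y ∈ coordDomain₂ n F₁ E₁ F₂ E₂ x₀) (hu : DifferentiableAt ℝ (localRep n F₁ x₀ u) y) :
    localRep n F₂ x₀ (A u) y =
      A.coeffA x₀ y (fderiv ℝ (localRep n F₁ x₀ u) y) + A.coeffB x₀ y (localRep n F₁ x₀ u y) :=
  (A.local_formula x₀).choose_spec.choose_spec.2.2 u y hy hu

variable [VectorBundle ℝ F₁ E₁] [VectorBundle ℝ F₂ E₂]
  [IsManifold (𝓡 n) ∞ X] [ContMDiffVectorBundle ∞ F₁ E₁ (𝓡 n)]

lemma _root_.NavierStokesComplex.IsCkAt.differentiableAt_localRep {x₀ x : X} {u : ∀ x, E₁ x}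
    (hx : x ∈ patch n F₁ E₁ x₀) (hu : IsCkAt n F₁ 1 u x) :
    DifferentiableAt ℝ (localRep n F₁ x₀ u) (chartAt (Model n) x₀ x) := by
  have hu' : IsCkAt n F₁ (1 : ℕ∞) u
      ((chartAt (Model n) x₀).symm (chartAt (Model n) x₀ x)) := by
    rw [(chartAt (Model n) x₀).left_inv hx.1]; exact hu
  exact (IsCkAt.contDiffAt_localRep (chartAt_mem_coordDomain hx) hu').differentiableAt
    (by simp)

/-- The operator at a point of the patch around `x₀`. -/
lemma apply_eq {x₀ x : X} {u : ∀ x, E₁ x} (hx : x ∈ patch₂ n F₁ E₁ F₂ E₂ x₀)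
    (hu : IsCkAt n F₁ 1 u x) :
    A u x = (trivializationAt F₂ E₂ x₀).symmL ℝ x
      (A.coeffA x₀ (chartAt (Model n) x₀ x)
        (fderiv ℝ (localRep n F₁ x₀ u) (chartAt (Model n) x₀ x)) +
      A.coeffB x₀ (chartAt (Model n) x₀ x) (localRep n F₁ x₀ u (chartAt (Model n) x₀ x))) := by
  rw [← symmL_localRep_chartAt (n := n) (A u) hx.2, A.localRep_apply x₀
    (chartAt_mem_coordDomain₂ hx) (hu.differentiableAt_localRep hx.1)]

/-- The value at `x` depends on the germ at `x` only. -/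
lemma congr {u v : ∀ x, E₁ x} {x : X} (h : ∀ᶠ x' in 𝓝 x, u x' = v x')
    (hv : IsCkAt n F₁ 1 v x) : A u x = A v x := by
  have hx : x ∈ patch₂ n F₁ E₁ F₂ E₂ x := mem_patch₂_self x
  have h1 : localRep n F₁ x u =ᶠ[𝓝 (chartAt (Model n) x x)] localRep n F₁ x v := by
    refine localRep_eventuallyEq ((chartAt (Model n) x).map_source (mem_chart_source _ x)) ?_
    rwa [(chartAt (Model n) x).left_inv (mem_chart_source _ x)]
  rw [A.apply_eq hx hv, A.apply_eq hx (isCkAt_congr h hv), h1.fderiv_eq, h1.eq_of_nhds]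

lemma map_add {u v : ∀ x, E₁ x} {x : X} (hu : IsCkAt n F₁ 1 u x) (hv : IsCkAt n F₁ 1 v x) :
    A (fun x => u x + v x) x = A u x + A v x := by
  have hx : x ∈ patch₂ n F₁ E₁ F₂ E₂ x := mem_patch₂_self x
  have hy := chartAt_mem_coordDomain hx.1
  have h1 : localRep n F₁ x (fun x => u x + v x) =ᶠ[𝓝 (chartAt (Model n) x x)]
      localRep n F₁ x u + localRep n F₁ x v :=
    Filter.eventually_of_mem ((isOpen_coordDomain x).mem_nhds hy)
      fun y' hy' => localRep_add x u v hy'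
  rw [A.apply_eq hx hu, A.apply_eq hx hv, A.apply_eq hx (hu.add hv), h1.fderiv_eq, h1.eq_of_nhds,
    fderiv_add (hu.differentiableAt_localRep hx.1) (hv.differentiableAt_localRep hx.1)]
  simp only [Pi.add_apply, _root_.map_add]
  abel

/-- The Leibniz rule: the commutator with a function is given by the leading coefficient. -/
lemma map_smul {x₀ x : X} {g : X → ℝ} {u : ∀ x, E₁ x} (hx : x ∈ patch₂ n F₁ E₁ F₂ E₂ x₀)
    (hg : ContMDiffAt (𝓡 n) 𝓘(ℝ, ℝ) 1 g x)
    (hu : IsCkAt n F₁ 1 u x) :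
    A (fun x => g x • u x) x = g x • A u x + (trivializationAt F₂ E₂ x₀).symmL ℝ x
      (A.coeffA x₀ (chartAt (Model n) x₀ x)
        ((fderiv ℝ (g ∘ (chartAt (Model n) x₀).symm) (chartAt (Model n) x₀ x)).smulRight
          (localRep n F₁ x₀ u (chartAt (Model n) x₀ x)))) := by
  have hy := chartAt_mem_coordDomain hx.1
  have : IsManifold (𝓡 n) 1 X := .of_le (n := ∞) (by exact_mod_cast le_top)
  have hgd : DifferentiableAt ℝ (g ∘ (chartAt (Model n) x₀).symm) (chartAt (Model n) x₀ x) := by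
    have h2 : ContMDiffAt (𝓡 n) (𝓡 n) 1 (chartAt (Model n) x₀).symm (chartAt (Model n) x₀ x) :=
      contMDiffOn_chart_symm.contMDiffAt ((chartAt (Model n) x₀).open_target.mem_nhds hy.1)
    have hg' : ContMDiffAt (𝓡 n) 𝓘(ℝ, ℝ) 1 g
        ((chartAt (Model n) x₀).symm (chartAt (Model n) x₀ x)) := by
      rw [(chartAt (Model n) x₀).left_inv hx.1.1]; exact hg
    exact (contMDiffAt_iff_contDiffAt.1 (hg'.comp _ h2)).differentiableAt (by simp)
  have h1 : localRep n F₁ x₀ (fun x => g x • u x) =ᶠ[𝓝 (chartAt (Model n) x₀ x)]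
      fun y => (g ∘ (chartAt (Model n) x₀).symm) y • localRep n F₁ x₀ u y :=
    Filter.eventually_of_mem ((isOpen_coordDomain x₀).mem_nhds hy)
      fun y' hy' => localRep_smul x₀ g u hy'
  have hgx : (g ∘ (chartAt (Model n) x₀).symm) (chartAt (Model n) x₀ x) = g x := by
    simp only [Function.comp, (chartAt (Model n) x₀).left_inv hx.1.1]
  rw [A.apply_eq hx hu, A.apply_eq hx (hu.smul hg), h1.fderiv_eq, h1.eq_of_nhds,
    fderiv_fun_smul hgd (hu.differentiableAt_localRep hx.1), hgx]
  simp only [_root_.map_add, _root_.map_smul, smul_add]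
  abel

lemma map_zero (x : X) : A (fun x => (0 : E₁ x)) x = 0 := by
  have h := A.map_add (isCkAt_zero (F := F₁) (E := E₁) 1 x) (isCkAt_zero 1 x)
  simpa using h

lemma map_sub {u v : ∀ x, E₁ x} {x : X} (hu : IsCkAt n F₁ 1 u x) (hv : IsCkAt n F₁ 1 v x) :
    A (fun x => u x - v x) x = A u x - A v x := by
  have h := A.map_add (hu.sub hv) hv
  simp only [sub_add_cancel] at h
  exact eq_sub_of_add_eq h.symm

lemma map_sum {ι : Type*} {s : Finset ι} {u : ι → ∀ x, E₁ x} {x : X}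
    (hu : ∀ i ∈ s, IsCkAt n F₁ 1 (u i) x) :
    A (fun x => ∑ i ∈ s, u i x) x = ∑ i ∈ s, A (u i) x := by
  classical
  induction s using Finset.induction_on with
  | empty => simpa using A.map_zero x
  | insert i s hi ih =>
    simp only [Finset.sum_insert hi]
    rw [A.map_add (hu i (by simp)) (isCkAt_sum fun j hj => hu j (by simp [hj])),
      ih fun j hj => hu j (by simp [hj])]

variable [ContMDiffVectorBundle ∞ F₂ E₂ (𝓡 n)]

/-- A first order operator maps sections of class `C^{k+1}` to sections of class `C^k`. -/
lemma isCk {k l : ℕ∞} (hkl : k + 1 ≤ l) {u : ∀ x, E₁ x} (hu : IsCk n F₁ l u) :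
    IsCk n F₂ k (A u) := by
  intro x
  have hx : x ∈ patch₂ n F₁ E₁ F₂ E₂ x := mem_patch₂_self x
  have hy := chartAt_mem_coordDomain₂ hx
  have hD := (isOpen_coordDomain₂ (n := n) (F₁ := F₁) (E₁ := E₁) (F₂ := F₂) (E₂ := E₂) x).mem_nhds hy
  refine isCkAt_of_contDiffAt_localRep hx.2 ?_
  have hk1 : (k : ℕ∞ω) + 1 ≤ l := by exact_mod_cast hkl
  have hl : (1 : ℕ∞ω) ≤ l := le_trans (by simp) hk1
  have h1 : ∀ y ∈ coordDomain₂ n F₁ E₁ F₂ E₂ x, ContDiffAt ℝ l (localRep n F₁ x u) y :=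
    fun y hy => IsCkAt.contDiffAt_localRep hy.1 (hu _)
  have h2 := (((A.contDiffOn_coeffA x).contDiffAt hD).of_le
      (m := k) (by exact_mod_cast le_top)).clm_apply ((h1 _ hy).fderiv_right hk1)
  have h3 := (((A.contDiffOn_coeffB x).contDiffAt hD).of_le
      (m := k) (by exact_mod_cast le_top)).clm_apply ((h1 _ hy).of_le (le_trans (by simp) hk1))
  refine (h2.add h3).congr_of_eventuallyEq ?_
  filter_upwards [hD] with y hy'
  exact A.localRep_apply x hy' ((h1 y hy').differentiableAt (by
    rintro h0; rw [h0] at hl; simp at hl))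

lemma isSmoothSection {u : ∀ x, E₁ x} (hu : IsSmoothSection n F₁ u) :
    IsSmoothSection n F₂ (A u) :=
  A.isCk (k := ⊤) (l := ⊤) le_top hu

end FirstOrderOp

end Operators

/-! ### The volume density and the `L²` pairing -/

section Volume

set_option linter.unusedSectionVars false

variable {n : ℕ} {X : Type*} [TopologicalSpace X] [ChartedSpace (Model n) X]
  [MeasurableSpace X] [BorelSpace X] {vol : Measure X}

/-- A smooth density is finite on compact coordinate sets, hence locally finite. -/
lemma IsSmoothDensity.isFiniteMeasure [CompactSpace X] (hvol : IsSmoothDensity n vol) :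
    IsFiniteMeasure vol := by
  have : IsLocallyFiniteMeasure vol := by
    refine ⟨fun x₀ => ?_⟩
    obtain ⟨ρ, hρ, -, hvolρ⟩ := hvol x₀
    have hy := (chartAt (Model n) x₀).map_source (mem_chart_source _ x₀)
    obtain ⟨r, hr, hK⟩ := Metric.nhds_basis_closedBall.mem_iff.1
      ((chartAt (Model n) x₀).open_target.mem_nhds hy)
    have hKc : IsCompact (Metric.closedBall (chartAt (Model n) x₀ x₀) r) := isCompact_closedBall _ _
    refine ⟨(chartAt (Model n) x₀).symm '' Metric.closedBall (chartAt (Model n) x₀ x₀) r, ?_, ?_⟩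
    · have h := (chartAt (Model n) x₀).symm.image_mem_nhds (by simp)
        (Metric.closedBall_mem_nhds (chartAt (Model n) x₀ x₀) hr)
      rwa [(chartAt (Model n) x₀).left_inv (mem_chart_source _ x₀)] at h
    · rw [hvolρ _ hKc.measurableSet hK]
      have hint : IntegrableOn ρ (Metric.closedBall (chartAt (Model n) x₀ x₀) r) :=
        (hρ.continuousOn.mono hK).integrableOn_compact hKc
      exact hint.lintegral_lt_top
  exact CompactSpace.isFiniteMeasure

lemma IsSmoothDensity.isOpenPosMeasure (hvol : IsSmoothDensity n vol) :
    vol.IsOpenPosMeasure := by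
  refine ⟨fun V hV ⟨x₀, hx₀⟩ h0 => ?_⟩
  obtain ⟨ρ, hρ, hpos, hvolρ⟩ := hvol x₀
  set W := (chartAt (Model n) x₀).target ∩ (chartAt (Model n) x₀).symm ⁻¹' V with hW
  have hWo : IsOpen W := (chartAt (Model n) x₀).isOpen_inter_preimage_symm hV
  have hWn : W.Nonempty := ⟨chartAt (Model n) x₀ x₀,
    (chartAt (Model n) x₀).map_source (mem_chart_source _ x₀), by
      rw [mem_preimage, (chartAt (Model n) x₀).left_inv (mem_chart_source _ x₀)]; exact hx₀⟩
  have h1 : vol ((chartAt (Model n) x₀).symm '' W) = 0 :=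
    measure_mono_null (by rintro _ ⟨y, hy, rfl⟩; exact hy.2) h0
  have hm : AEMeasurable (fun y => ENNReal.ofReal (ρ y)) (volume.restrict W) :=
    ((hρ.continuousOn.mono inter_subset_left).aemeasurable hWo.measurableSet).ennreal_ofReal
  rw [hvolρ W hWo.measurableSet inter_subset_left, lintegral_eq_zero_iff' hm] at h1
  have h2 := (ae_restrict_iff' hWo.measurableSet).1 h1
  refine (hWo.measure_pos volume hWn).ne' (measure_mono_null (fun y hy => ?_) h2)
  simpa [hy] using hpos y hy.1

/-- Integration in a chart: the integral of a function vanishing outside the chart around `x₀` is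
the Lebesgue integral of its coordinate expression times a smooth positive density. -/
lemma IsSmoothDensity.exists_integral_eq (hvol : IsSmoothDensity n vol) (x₀ : X) :
    ∃ ρ : Model n → ℝ, ContDiffOn ℝ ∞ ρ (chartAt (Model n) x₀).target ∧
      (∀ y ∈ (chartAt (Model n) x₀).target, 0 < ρ y) ∧
      ∀ f : X → ℝ, Continuous f → (∀ x ∉ (chartAt (Model n) x₀).source, f x = 0) →
        ∫ x, f x ∂vol =
          ∫ y in (chartAt (Model n) x₀).target, ρ y * f ((chartAt (Model n) x₀).symm y) := by
  obtain ⟨ρ, hρ, hpos, hvolρ⟩ := hvol x₀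
  refine ⟨ρ, hρ, hpos, fun f hf hf0 => ?_⟩
  set e := chartAt (Model n) x₀
  have hmt : MeasurableSet e.target := e.open_target.measurableSet
  have hρm : AEMeasurable (fun y => ENNReal.ofReal (ρ y)) (volume.restrict e.target) :=
    (hρ.continuousOn.aemeasurable hmt).ennreal_ofReal
  set ν := (volume.restrict e.target).withDensity fun y => ENNReal.ofReal (ρ y) with hν
  have hem : AEMeasurable e.symm (volume.restrict e.target) := e.continuousOn_symm.aemeasurable hmt
  have hemν : AEMeasurable e.symm ν := hem.mono_ac (withDensity_absolutelyContinuous _ _)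
  have hmap : vol.restrict e.source = ν.map e.symm := by
    ext s hs
    rw [Measure.map_apply_of_aemeasurable hemν hs, Measure.restrict_apply hs]
    have hset : MeasurableSet (e.target ∩ e.symm ⁻¹' s) := by
      have h2 := (MeasurableEmbedding.subtype_coe hmt).measurableSet_image.2
        ((e.continuousOn_symm.domRestrict).measurable hs)
      convert h2 using 1
      ext y
      simp only [mem_inter_iff, mem_preimage, mem_image, Subtype.exists, domRestrict_apply,
        exists_and_right, exists_eq_right, exists_prop]
    have himg : s ∩ e.source = e.symm '' (e.target ∩ e.symm ⁻¹' s) := by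
      ext x
      constructor
      · rintro ⟨h1, h2⟩
        exact ⟨e x, ⟨e.map_source h2, by rwa [mem_preimage, e.left_inv h2]⟩, e.left_inv h2⟩
      · rintro ⟨y, ⟨h1, h2⟩, rfl⟩
        exact ⟨h2, e.map_target h1⟩
    rw [himg, hvolρ _ hset inter_subset_left, hν, withDensity_apply',
      Measure.restrict_restrict' hmt, inter_comm]
  rw [← setIntegral_eq_integral_of_forall_compl_eq_zero hf0, hmap,
    integral_map hemν hf.measurable.aestronglyMeasurable, hν,
    integral_withDensity_eq_integral_toReal_smul₀ hρm (by simp)]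
  refine setIntegral_congr_fun hmt fun y hy => ?_
  simp only [ENNReal.toReal_ofReal (hpos y hy).le, smul_eq_mul]

end Volume

section Pairing

set_option linter.unusedSectionVars false

variable {n : ℕ} {X : Type*} [TopologicalSpace X] [CompactSpace X] [ChartedSpace (Model n) X]
  [MeasurableSpace X] [BorelSpace X] {vol : Measure X} [IsFiniteMeasure vol]
  {F : Type*} [NormedAddCommGroup F] [NormedSpace ℝ F]
  {E : X → Type*} [TopologicalSpace (TotalSpace F E)]
  [∀ x, NormedAddCommGroup (E x)] [∀ x, InnerProductSpace ℝ (E x)] [FiberBundle F E]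
  [VectorBundle ℝ F E]

variable (n F E) in
/-- The fibre metric is continuous in the sense of topological vector bundles. -/
lemma isContinuousRiemannianBundle [IsContMDiffRiemannianBundle (𝓡 n) ∞ F E] :
    IsContinuousRiemannianBundle F E := by
  obtain ⟨g, hg, h⟩ := IsContMDiffRiemannianBundle.exists_contMDiff (IB := 𝓡 n) (n := ∞)
    (F := F) (E := E)
  exact ⟨g, hg.continuous, h⟩

lemma IsCk.continuous {k : ℕ∞ω} {u : ∀ x, E x} (hu : IsCk n F k u) :
    Continuous (fun x => TotalSpace.mk' F x (u x)) :=
  ContMDiff.continuous hu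

variable [IsContinuousRiemannianBundle F E]

lemma continuous_inner_section {u v : ∀ x, E x} (hu : Continuous (fun x => TotalSpace.mk' F x (u x)))
    (hv : Continuous (fun x => TotalSpace.mk' F x (v x))) :
    Continuous (fun x => (inner ℝ (u x) (v x) : ℝ)) :=
  hu.inner_bundle hv

lemma integrable_inner_section (vol : Measure X) [IsFiniteMeasure vol] {u v : ∀ x, E x}
    (hu : Continuous (fun x => TotalSpace.mk' F x (u x)))
    (hv : Continuous (fun x => TotalSpace.mk' F x (v x))) :
    Integrable (fun x => (inner ℝ (u x) (v x) : ℝ)) vol :=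
  (continuous_inner_section hu hv).integrable_of_hasCompactSupport
    (HasCompactSupport.of_compactSpace _)

lemma exists_norm_section_le {u : ∀ x, E x} (hu : Continuous (fun x => TotalSpace.mk' F x (u x))) :
    ∃ K, 0 ≤ K ∧ ∀ x, ‖u x‖ ≤ K := by
  obtain ⟨K, hK⟩ := isCompact_univ.exists_bound_of_continuousOn
    (continuous_inner_section hu hu).continuousOn
  refine ⟨√K, by positivity, fun x => ?_⟩
  have h := hK x (mem_univ x)
  rw [real_inner_self_eq_norm_sq, Real.norm_of_nonneg (by positivity)] at h
  exact Real.le_sqrt_of_sq_le h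

/-- A continuous section whose `L²` norm vanishes is zero. -/
lemma eq_zero_of_integral_inner_self_eq_zero (hvol : IsSmoothDensity n vol) {u : ∀ x, E x}
    (hu : Continuous (fun x => TotalSpace.mk' F x (u x)))
    (h0 : ∫ x, inner ℝ (u x) (u x) ∂vol = 0) (x : X) : u x = 0 := by
  have := hvol.isOpenPosMeasure
  have hc := continuous_inner_section hu hu
  have h1 := (integral_eq_zero_iff_of_nonneg (fun x => real_inner_self_nonneg)
    (integrable_inner_section vol hu hu)).1 h0
  have h2 := Measure.eq_of_ae_eq h1 hc continuous_const
  exact inner_self_eq_zero.1 (congrFun h2 x)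

end Pairing

/-! ### Approximation of `C¹` sections by smooth sections -/

section Density

set_option linter.unusedSectionVars false

variable {n : ℕ} {X : Type*} [TopologicalSpace X] [T2Space X] [CompactSpace X]
  [ChartedSpace (Model n) X] [IsManifold (𝓡 n) ∞ X]
  {F₁ : Type*} [NormedAddCommGroup F₁] [NormedSpace ℝ F₁] [FiniteDimensional ℝ F₁]
  {E₁ : X → Type*} [TopologicalSpace (TotalSpace F₁ E₁)]
  [∀ x, NormedAddCommGroup (E₁ x)] [∀ x, InnerProductSpace ℝ (E₁ x)] [FiberBundle F₁ E₁]
  [VectorBundle ℝ F₁ E₁] [ContMDiffVectorBundle ∞ F₁ E₁ (𝓡 n)] [IsContinuousRiemannianBundle F₁ E₁]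
  {F₂ : Type*} [NormedAddCommGroup F₂] [NormedSpace ℝ F₂]
  {E₂ : X → Type*} [TopologicalSpace (TotalSpace F₂ E₂)]
  [∀ x, NormedAddCommGroup (E₂ x)] [∀ x, InnerProductSpace ℝ (E₂ x)] [FiberBundle F₂ E₂]
  [VectorBundle ℝ F₂ E₂] [IsContinuousRiemannianBundle F₂ E₂]

lemma eventually_norm_comp_chartAt_lt {G : Type*} [SeminormedAddCommGroup G] {c : Model n → G}
    {x₀ : X} {D : Set (Model n)} (hD : D ∈ 𝓝 (chartAt (Model n) x₀ x₀)) (hc : ContinuousOn c D) :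
    ∀ᶠ x in 𝓝 x₀, ‖c (chartAt (Model n) x₀ x)‖ < ‖c (chartAt (Model n) x₀ x₀)‖ + 1 := by
  have hch : ContinuousAt (chartAt (Model n) x₀) x₀ :=
    (chartAt (Model n) x₀).continuousAt (mem_chart_source _ x₀)
  exact (ContinuousAt.comp (g := c) (hc.continuousAt hD) hch).norm.eventually_lt
    continuousAt_const (lt_add_one _)

set_option synthInstance.maxHeartbeats 200000 in
/-- Near any point, the sizes of the fibre trivializations and of the coefficients of a first order
operator are bounded. -/
lemma FirstOrderOp.exists_bounds (B : FirstOrderOp n F₁ E₁ F₂ E₂) (x₀ : X) :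
    ∃ V : Set X, IsOpen V ∧ x₀ ∈ V ∧ V ⊆ patch₂ n F₁ E₁ F₂ E₂ x₀ ∧ ∃ C, 0 < C ∧ ∀ x ∈ V,
      ‖(trivializationAt F₁ E₁ x₀).symmL ℝ x‖ ≤ C ∧ ‖(trivializationAt F₂ E₂ x₀).symmL ℝ x‖ ≤ C ∧
      ‖B.coeffA x₀ (chartAt (Model n) x₀ x)‖ ≤ C ∧ ‖B.coeffB x₀ (chartAt (Model n) x₀ x)‖ ≤ C := by
  obtain ⟨C₁, hC₁, h1⟩ := eventually_norm_symmL_trivializationAt_lt F₁ E₁ x₀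
  obtain ⟨C₂, hC₂, h2⟩ := eventually_norm_symmL_trivializationAt_lt F₂ E₂ x₀
  have hx : x₀ ∈ patch₂ n F₁ E₁ F₂ E₂ x₀ := mem_patch₂_self x₀
  have hD := (isOpen_coordDomain₂ (n := n) (F₁ := F₁) (E₁ := E₁) (F₂ := F₂) (E₂ := E₂) x₀).mem_nhds
    (chartAt_mem_coordDomain₂ hx)
  have h3 := eventually_norm_comp_chartAt_lt hD (B.contDiffOn_coeffA x₀).continuousOn
  have h4 := eventually_norm_comp_chartAt_lt hD (B.contDiffOn_coeffB x₀).continuousOn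
  obtain ⟨V, hV, hVo, hxV⟩ := eventually_nhds_iff.1
    (h1.and (h2.and (h3.and (h4.and ((isOpen_patch₂ x₀).mem_nhds hx)))))
  refine ⟨V, hVo, hxV, fun x hx => (hV x hx).2.2.2.2, C₁ + C₂ +
    (‖B.coeffA x₀ (chartAt (Model n) x₀ x₀)‖ + 1) + (‖B.coeffB x₀ (chartAt (Model n) x₀ x₀)‖ + 1),
    by positivity, fun x hx => ?_⟩
  obtain ⟨k1, k2, k3, k4, -⟩ := hV x hx
  have := norm_nonneg (B.coeffA x₀ (chartAt (Model n) x₀ x₀))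
  have := norm_nonneg (B.coeffB x₀ (chartAt (Model n) x₀ x₀))
  refine ⟨?_, ?_, ?_, ?_⟩ <;> linarith

/-- Sections of class `C¹` supported in a small patch are approximated, together with their image
under a first order operator, by mollifying their coordinate representation. -/
lemma FirstOrderOp.exists_smooth_approx_local (B : FirstOrderOp n F₁ E₁ F₂ E₂) (x₀ : X) :
    ∃ V : Set X, IsOpen V ∧ x₀ ∈ V ∧ ∀ (φ : ∀ x, E₁ x) (K : Set X), IsCk n F₁ 1 φ → IsCompact K →
      K ⊆ V → (∀ x ∉ K, φ x = 0) → ∀ ε > 0, ∃ ψ : ∀ x, E₁ x, IsSmoothSection n F₁ ψ ∧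
        ∀ x, ‖ψ x - φ x‖ ≤ ε ∧ ‖B ψ x - B φ x‖ ≤ ε := by
  obtain ⟨V, hVo, hxV, hVp, C, hC, hbd⟩ := B.exists_bounds x₀
  refine ⟨V, hVo, hxV, fun φ K hφ hK hKV hφ0 ε hε => ?_⟩
  set e := chartAt (Model n) x₀ with he
  set D := coordDomain₂ n F₁ E₁ F₂ E₂ x₀ with hDdef
  have hDo : IsOpen D := isOpen_coordDomain₂ x₀
  have hDt : D ⊆ e.target := fun y hy => hy.1.1
  set g : Model n → F₁ := D.indicator (localRep n F₁ x₀ φ) with hg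
  set K' := e '' K with hK'
  have hK'c : IsCompact K' := hK.image_of_continuousOn
    (e.continuousOn.mono fun x hx => (hVp (hKV hx)).1.1)
  set W := D ∩ (e.target ∩ e.symm ⁻¹' V) with hW
  have hWo : IsOpen W := hDo.inter (e.isOpen_inter_preimage_symm hVo)
  have hK'W : K' ⊆ W := by
    rintro _ ⟨x, hx, rfl⟩
    have hxp := hVp (hKV hx)
    refine ⟨chartAt_mem_coordDomain₂ hxp, e.map_source hxp.1.1, ?_⟩
    rw [mem_preimage, e.left_inv hxp.1.1]
    exact hKV hx
  have hgD : ∀ y ∈ D, g =ᶠ[𝓝 y] localRep n F₁ x₀ φ := fun y hy =>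
    Filter.eventually_of_mem (hDo.mem_nhds hy) fun y' hy' => indicator_of_mem hy' _
  have hg0 : ∀ y ∉ K', g y = 0 := by
    intro y hy
    by_cases hyD : y ∈ D
    · have hφy : φ (e.symm y) = 0 := hφ0 _ fun h => hy ⟨_, h, e.right_inv (hDt hyD)⟩
      rw [hg, indicator_of_mem hyD, localRep_congr (v := fun x => 0) hφy, localRep_zero _ hyD.1]
    · exact indicator_of_notMem hyD _
  have hgs : tsupport g ⊆ K' := closure_minimal
    (fun y hy => by by_contra h; exact hy (hg0 y h)) hK'c.isClosed
  have hgc : HasCompactSupport g := hK'c.of_isClosed_subset (isClosed_tsupport g) hgs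
  have hgsm : ContDiff ℝ 1 g := by
    rw [contDiff_iff_contDiffAt]
    intro y
    by_cases hy : y ∈ K'
    · have hyD := (hK'W hy).1
      exact (IsCkAt.contDiffAt_localRep (k := 1) hyD.1 (hφ _)).congr_of_eventuallyEq (hgD y hyD)
    · refine (contDiffAt_const (c := 0)).congr_of_eventuallyEq ?_
      filter_upwards [hK'c.isClosed.isOpen_compl.mem_nhds hy] with y' hy' using hg0 y' hy'
  have hdg : Continuous (fderiv ℝ g) := hgsm.continuous_fderiv (by simp)
  obtain ⟨δ₀, hδ₀, hthick⟩ := hK'c.exists_cthickening_subset_open hWo hK'W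
  set δ := ε / (C + C * (C + C)) with hδ
  have hδpos : 0 < δ := by positivity
  have hCδ : C * δ + C * (C * δ + C * δ) = ε := by rw [hδ]; field_simp
  obtain ⟨r, ⟨hr1, hr2⟩, hrpos, hrle⟩ :=
    (((eventually_dist_mollify_le hgsm.continuous hgc hδpos).and
      (eventually_dist_mollify_le hdg (hgc.fderiv ℝ) hδpos)).and
      (Ioc_mem_nhdsGT hδ₀)).exists
  set G := mollify r g with hG
  have hGs : tsupport G ⊆ W := (tsupport_mollify_subset hrpos g).trans
    ((Metric.cthickening_mono hrle _).trans ((Metric.cthickening_subset_of_subset _ hgs).trans hthick))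
  have hGc : HasCompactSupport G := (hgc.cthickening (r := r)).of_isClosed_subset
    (isClosed_tsupport G) (tsupport_mollify_subset hrpos g)
  have hGsm : ContDiff ℝ (⊤ : ℕ∞) G := contDiff_mollify hrpos hgsm.continuous.locallyIntegrable
  have hψ : IsCk n F₁ (⊤ : ℕ∞) (ofLocal (E := E₁) x₀ G) :=
    isCk_ofLocal hGsm hGc fun y hy => (hGs hy).1.1
  have hψ1 : IsCk n F₁ 1 (ofLocal (E := E₁) x₀ G) := isCk_one_of_isSmoothSection hψ
  refine ⟨ofLocal x₀ G, hψ, fun x => ?_⟩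
  by_cases hx : x ∈ V
  · have hxp := hVp hx
    have hyD : e x ∈ D := chartAt_mem_coordDomain₂ hxp
    have hψrep : localRep n F₁ x₀ (ofLocal (E := E₁) x₀ G) =ᶠ[𝓝 (e x)] G :=
      Filter.eventually_of_mem (hDo.mem_nhds hyD) fun y' hy' => localRep_ofLocal x₀ G hy'.1
    obtain ⟨b1, b2, b3, b4⟩ := hbd x hx
    have d0 : ‖G (e x) - g (e x)‖ ≤ δ := by rw [← dist_eq_norm]; exact hr1 _
    have d1 : ‖fderiv ℝ G (e x) - fderiv ℝ g (e x)‖ ≤ δ := by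
      rw [← dist_eq_norm, hG, fderiv_mollify hgsm hgc]; exact hr2 _
    have hbound : ∀ {w : F₂} {c : ℝ}, ‖w‖ ≤ c → ‖(trivializationAt F₂ E₂ x₀).symmL ℝ x w‖ ≤ C * c :=
      fun {w c} hw => (ContinuousLinearMap.le_opNorm _ _).trans (by gcongr)
    constructor
    · rw [← symmL_localRep_chartAt (n := n) φ hxp.1, ofLocal_of_mem G hxp.1.1,
        ← (hgD _ hyD).eq_of_nhds, ← _root_.map_sub]
      refine (ContinuousLinearMap.le_opNorm _ _).trans
        ((mul_le_mul b1 d0 (norm_nonneg _) hC.le).trans ?_)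
      have : 0 ≤ C * (C * δ + C * δ) := by positivity
      linarith
    · rw [B.apply_eq hxp (hψ1 x), B.apply_eq hxp (hφ x), hψrep.fderiv_eq, hψrep.eq_of_nhds,
        ← (hgD _ hyD).fderiv_eq, ← (hgD _ hyD).eq_of_nhds, ← _root_.map_sub, add_sub_add_comm, ← _root_.map_sub,
        ← _root_.map_sub]
      refine (hbound (c := C * δ + C * δ) ((norm_add_le _ _).trans (add_le_add
        ((ContinuousLinearMap.le_opNorm _ _).trans (mul_le_mul b3 d1 (norm_nonneg _) hC.le))
        ((ContinuousLinearMap.le_opNorm _ _).trans (mul_le_mul b4 d0 (norm_nonneg _) hC.le))))).trans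
        ?_
      have : 0 ≤ C * δ := by positivity
      linarith
  · have h1 : ∀ᶠ x' in 𝓝 x, ofLocal (E := E₁) x₀ G x' = 0 := by
      refine ofLocal_eventuallyEq_zero hGc (fun y hy => hDt (hGs hy).1) ?_
      rintro ⟨y, hy, rfl⟩
      exact hx (hGs hy).2.2
    have h2 : ∀ᶠ x' in 𝓝 x, φ x' = 0 := by
      filter_upwards [hK.isClosed.isOpen_compl.mem_nhds fun h => hx (hKV h)] with x' hx'
        using hφ0 x' hx'
    rw [B.congr h1 (isCkAt_zero 1 x), B.congr h2 (isCkAt_zero 1 x), h1.self_of_nhds,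
      h2.self_of_nhds]
    simp [hε.le]

/-- Sections of class `C¹` are uniform limits of smooth sections, together with their images under
a given first order operator. -/
theorem FirstOrderOp.exists_smooth_approx (B : FirstOrderOp n F₁ E₁ F₂ E₂) {φ : ∀ x, E₁ x}
    (hφ : IsCk n F₁ 1 φ) {ε : ℝ} (hε : 0 < ε) :
    ∃ ψ : ∀ x, E₁ x, IsSmoothSection n F₁ ψ ∧
      ∀ x, ‖ψ x - φ x‖ ≤ ε ∧ ‖B ψ x - B φ x‖ ≤ ε := by
  choose V hVo hxV hV using B.exists_smooth_approx_local
  obtain ⟨t, -, ht⟩ := isCompact_univ.elim_nhds_subcover V fun x _ => (hVo x).mem_nhds (hxV x)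
  obtain ⟨f, hf⟩ := SmoothPartitionOfUnity.exists_isSubordinate (𝓡 n) (isClosed_univ (X := X))
    (fun i : t => V i) (fun i => hVo i) (fun x hx => by
      obtain ⟨i, hi, hxi⟩ := mem_iUnion₂.1 (ht hx)
      exact mem_iUnion.2 ⟨⟨i, hi⟩, hxi⟩)
  have hfsm : ∀ (i : t) x, ContMDiffAt (𝓡 n) 𝓘(ℝ, ℝ) 1 (f i) x := fun i x =>
    (f i).contMDiff.contMDiffAt.of_le (by exact_mod_cast le_top)
  have hfφ : ∀ i : t, IsCk n F₁ 1 (fun x => f i x • φ x) := fun i x => (hφ x).smul (hfsm i x)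
  set N : ℝ := (Fintype.card t : ℝ) + 1 with hN
  have hNpos : 0 < N := by positivity
  choose ψ hψsm hψ using fun i : t => hV i (fun x => f i x • φ x) (tsupport (f i)) (hfφ i)
    (isClosed_tsupport _).isCompact (hf i)
    (fun x hx => by rw [image_eq_zero_of_notMem_tsupport hx, zero_smul]) (ε / N) (by positivity)
  have hsum : (fun x => ∑ i, f i x • φ x) = φ := by
    funext x
    have h1 := f.sum_eq_one (mem_univ x)
    rw [finsum_eq_sum_of_fintype] at h1
    rw [← Finset.sum_smul, h1, one_smul]
  have hle : (Fintype.card t : ℝ) * (ε / N) ≤ ε := by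
    rw [mul_div_assoc', div_le_iff₀ hNpos, hN]
    nlinarith
  refine ⟨fun x => ∑ i, ψ i x, fun x => isCkAt_sum fun i _ => hψsm i x, fun x => ⟨?_, ?_⟩⟩
  · have h2 : φ x = ∑ i, f i x • φ x := (congrFun hsum x).symm
    rw [h2, ← Finset.sum_sub_distrib]
    refine (norm_sum_le _ _).trans ((Finset.sum_le_sum fun i _ => (hψ i x).1).trans ?_)
    simpa using hle
  · have h2 : B φ x = ∑ i, B (fun x => f i x • φ x) x := by
      rw [← B.map_sum fun i _ => hfφ i x, hsum]
    rw [h2, B.map_sum fun i _ => isCk_one_of_isSmoothSection (hψsm i) x, ← Finset.sum_sub_distrib]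
    refine (norm_sum_le _ _).trans ((Finset.sum_le_sum fun i _ => (hψ i x).2).trans ?_)
    simpa using hle

end Density

/-! ### Duality with test sections of class `C¹` -/

section Duality

set_option linter.unusedSectionVars false

variable {n : ℕ} {X : Type*} [TopologicalSpace X] [T2Space X] [CompactSpace X]
  [ChartedSpace (Model n) X] [IsManifold (𝓡 n) ∞ X]
  [MeasurableSpace X] [BorelSpace X] {vol : Measure X}
  {F₁ : Type*} [NormedAddCommGroup F₁] [NormedSpace ℝ F₁] [FiniteDimensional ℝ F₁]
  {E₁ : X → Type*} [TopologicalSpace (TotalSpace F₁ E₁)]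
  [∀ x, NormedAddCommGroup (E₁ x)] [∀ x, InnerProductSpace ℝ (E₁ x)] [FiberBundle F₁ E₁]
  [VectorBundle ℝ F₁ E₁] [ContMDiffVectorBundle ∞ F₁ E₁ (𝓡 n)] [IsContinuousRiemannianBundle F₁ E₁]
  {F₂ : Type*} [NormedAddCommGroup F₂] [NormedSpace ℝ F₂] [FiniteDimensional ℝ F₂]
  {E₂ : X → Type*} [TopologicalSpace (TotalSpace F₂ E₂)]
  [∀ x, NormedAddCommGroup (E₂ x)] [∀ x, InnerProductSpace ℝ (E₂ x)] [FiberBundle F₂ E₂]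
  [VectorBundle ℝ F₂ E₂] [ContMDiffVectorBundle ∞ F₂ E₂ (𝓡 n)] [IsContinuousRiemannianBundle F₂ E₂]

/-- The pairing with a bounded section (which need not be measurable) passes to uniform limits. -/
lemma tendsto_integral_inner [IsFiniteMeasure vol] {w φ : ∀ x, E₁ x} {ψ : ℕ → ∀ x, E₁ x} {K K' : ℝ}
    (hK : 0 ≤ K) (hw : ∀ x, ‖w x‖ ≤ K) (hφ : ∀ x, ‖φ x‖ ≤ K')
    (hψ : ∀ k x, ‖ψ k x - φ x‖ ≤ 1 / ((k : ℝ) + 1))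
    (hint : ∀ k, Integrable (fun x => (inner ℝ (w x) (ψ k x) : ℝ)) vol) :
    Integrable (fun x => (inner ℝ (w x) (φ x) : ℝ)) vol ∧
      Filter.Tendsto (fun k => ∫ x, inner ℝ (w x) (ψ k x) ∂vol) Filter.atTop
        (𝓝 (∫ x, inner ℝ (w x) (φ x) ∂vol)) := by
  have hlim : ∀ x, Filter.Tendsto (fun k => (inner ℝ (w x) (ψ k x) : ℝ)) Filter.atTop
      (𝓝 (inner ℝ (w x) (φ x))) := by
    intro x
    have h1 : Filter.Tendsto (fun k => ψ k x) Filter.atTop (𝓝 (φ x)) :=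
      tendsto_iff_norm_sub_tendsto_zero.2 (squeeze_zero (fun _ => norm_nonneg _)
        (fun k => hψ k x) tendsto_one_div_add_atTop_nhds_zero_nat)
    exact tendsto_const_nhds.inner h1
  have hmeas := aestronglyMeasurable_of_tendsto_ae Filter.atTop
    (fun k => (hint k).aestronglyMeasurable) (Filter.Eventually.of_forall hlim)
  refine ⟨Integrable.of_bound hmeas (K * K') (Filter.Eventually.of_forall fun x =>
    (norm_inner_le_norm _ _).trans (mul_le_mul (hw x) (hφ x) (norm_nonneg _) hK)), ?_⟩
  refine tendsto_integral_of_dominated_convergence (fun _ => K * (K' + 1))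
    (fun k => (hint k).aestronglyMeasurable) (integrable_const _)
    (fun k => Filter.Eventually.of_forall fun x => (norm_inner_le_norm _ _).trans
      (mul_le_mul (hw x) ?_ (norm_nonneg _) hK)) (Filter.Eventually.of_forall hlim)
  have h2 : 1 / ((k : ℝ) + 1) ≤ 1 := by
    rw [div_le_one (by positivity)]
    linarith [(Nat.cast_nonneg k : (0 : ℝ) ≤ k)]
  calc ‖ψ k x‖ = ‖φ x + (ψ k x - φ x)‖ := by rw [add_sub_cancel]
    _ ≤ K' + 1 := (norm_add_le _ _).trans (add_le_add (hφ x) ((hψ k x).trans h2))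

/-- A distributional equation between bounded sections may be tested with sections of class `C¹`. -/
lemma DistribEq.of_isCk_one [IsFiniteMeasure vol] {As : FirstOrderOp n F₂ E₂ F₁ E₁}
    {v : ∀ x, E₁ x} {w : ∀ x, E₂ x} (h : DistribEq vol As v w)
    {K : ℝ} (hK : 0 ≤ K) (hv : ∀ x, ‖v x‖ ≤ K) (hw : ∀ x, ‖w x‖ ≤ K)
    {φ : ∀ x, E₂ x} (hφ : IsCk n F₂ 1 φ) :
    Integrable (fun x => (inner ℝ (w x) (φ x) : ℝ)) vol ∧
    Integrable (fun x => (inner ℝ (v x) (As φ x) : ℝ)) vol ∧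
    ∫ x, inner ℝ (w x) (φ x) ∂vol = ∫ x, inner ℝ (v x) (As φ x) ∂vol := by
  have hAφ : IsCk n F₁ (0 : ℕ∞) (As φ) := As.isCk (l := 1) (by simp) hφ
  obtain ⟨K₁, -, hK₁⟩ := exists_norm_section_le hφ.continuous
  obtain ⟨K₂, -, hK₂⟩ := exists_norm_section_le hAφ.continuous
  choose ψ hψs hψ using fun k : ℕ => As.exists_smooth_approx hφ (ε := 1 / ((k : ℝ) + 1))
    (by positivity)
  have h1 := tendsto_integral_inner hK hw hK₁ (fun k x => (hψ k x).1) fun k => (h _ (hψs k)).1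
  have h2 := tendsto_integral_inner hK hv hK₂ (fun k x => (hψ k x).2) fun k => (h _ (hψs k)).2.1
  refine ⟨h1.1, h2.1, tendsto_nhds_unique h1.2 ?_⟩
  simp only [fun k => (h _ (hψs k)).2.2]
  exact h2.2

/-- The formal adjoint identity extends to sections of class `C¹`. -/
lemma IsFormalAdjoint.of_isCk_one [IsFiniteMeasure vol] {A : FirstOrderOp n F₁ E₁ F₂ E₂}
    {As : FirstOrderOp n F₂ E₂ F₁ E₁} (h : IsFormalAdjoint vol A As) {u : ∀ x, E₁ x}
    {v : ∀ x, E₂ x} (hu : IsCk n F₁ 1 u) (hv : IsCk n F₂ 1 v) :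
    ∫ x, inner ℝ (A u x) (v x) ∂vol = ∫ x, inner ℝ (u x) (As v x) ∂vol := by
  have hAc : ∀ {u : ∀ x, E₁ x}, IsCk n F₁ 1 u →
      Continuous (fun x => TotalSpace.mk' F₂ x (A u x)) := fun hu =>
    IsCk.continuous (n := n) (k := (0 : ℕ∞)) (A.isCk (l := 1) (by simp) hu)
  have hAsc : ∀ {v : ∀ x, E₂ x}, IsCk n F₂ 1 v →
      Continuous (fun x => TotalSpace.mk' F₁ x (As v x)) := fun hv =>
    IsCk.continuous (n := n) (k := (0 : ℕ∞)) (As.isCk (l := 1) (by simp) hv)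
  have h1 : ∀ v : ∀ x, E₂ x, IsSmoothSection n F₂ v → DistribEq vol A v (As v) := by
    intro v hv φ hφ
    have hv1 := isCk_one_of_isSmoothSection hv
    have hφ1 := isCk_one_of_isSmoothSection hφ
    refine ⟨integrable_inner_section vol (hAsc hv1) hφ1.continuous,
      integrable_inner_section vol hv1.continuous (hAc hφ1), ?_⟩
    simpa only [real_inner_comm] using (h φ v hφ hv).symm
  have h2 : DistribEq vol As u (A u) := by
    intro φ hφ
    have hφ1 := isCk_one_of_isSmoothSection hφ
    refine ⟨integrable_inner_section vol (hAc hu) hφ1.continuous,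
      integrable_inner_section vol hu.continuous (hAsc hφ1), ?_⟩
    obtain ⟨K₁, hK₁, hb₁⟩ := exists_norm_section_le hφ1.continuous
    obtain ⟨K₂, hK₂, hb₂⟩ := exists_norm_section_le (hAsc hφ1)
    have := ((h1 φ hφ).of_isCk_one (K := max K₁ K₂) (le_max_of_le_left hK₁)
      (fun x => (hb₁ x).trans (le_max_left _ _)) (fun x => (hb₂ x).trans (le_max_right _ _)) hu).2.2
    simpa only [real_inner_comm] using this.symm
  obtain ⟨K₁, hK₁, hb₁⟩ := exists_norm_section_le hu.continuous
  obtain ⟨K₂, hK₂, hb₂⟩ := exists_norm_section_le (hAc hu)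
  exact (h2.of_isCk_one (K := max K₁ K₂) (le_max_of_le_left hK₁)
    (fun x => (hb₁ x).trans (le_max_left _ _)) (fun x => (hb₂ x).trans (le_max_right _ _)) hv).2.2

/-- A section of class `C²` that is annihilated by the adjoint in the sense of distributions is
annihilated pointwise. -/
lemma IsFormalAdjoint.apply_eq_zero [IsFiniteMeasure vol] (hvol : IsSmoothDensity n vol)
    {A : FirstOrderOp n F₁ E₁ F₂ E₂}
    {As : FirstOrderOp n F₂ E₂ F₁ E₁} (h : IsFormalAdjoint vol A As) {u : ∀ x, E₂ x}
    (hu : IsCk n F₂ 2 u) (h0 : DistribEq vol A u (fun _ => 0)) (x : X) : As u x = 0 := by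
  have hw : IsCk n F₁ (1 : ℕ∞) (As u) := As.isCk (l := 2) (by norm_num) hu
  have hu1 : IsCk n F₂ 1 u := fun x => (hu x).of_le (by norm_num)
  obtain ⟨K, hK, hb⟩ := exists_norm_section_le hu.continuous
  have h1 := (h0.of_isCk_one hK hb (fun x => by simpa using hK) hw).2.2
  have h2 := h.of_isCk_one hw hu1
  refine eq_zero_of_integral_inner_self_eq_zero hvol hw.continuous ?_ x
  rw [← h2]
  simpa [real_inner_comm] using h1.symm

end Duality

/-! ### The symbol of an elliptic Laplacian -/

section Symbol

set_option linter.unusedSectionVars false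

variable {n : ℕ} {X : Type*} [TopologicalSpace X] [T2Space X] [CompactSpace X]
  [ChartedSpace (Model n) X] [IsManifold (𝓡 n) ∞ X]

/-- There is a smooth function on the manifold vanishing at `x₀` with prescribed derivative. -/
lemma exists_smooth_fderiv_eq (x₀ : X) (θ : Model n →L[ℝ] ℝ) :
    ∃ g : X → ℝ, ContMDiff (𝓡 n) 𝓘(ℝ, ℝ) ∞ g ∧ g x₀ = 0 ∧
      fderiv ℝ (g ∘ (chartAt (Model n) x₀).symm) (chartAt (Model n) x₀ x₀) = θ ∧
      (θ ≠ 0 → mfderiv (𝓡 n) 𝓘(ℝ, ℝ) g x₀ ≠ 0) := by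
  set e := chartAt (Model n) x₀ with he
  have hx₀ : x₀ ∈ e.source := mem_chart_source _ x₀
  obtain ⟨χ⟩ : Nonempty (SmoothBumpFunction (𝓡 n) x₀) := inferInstance
  have hsm : ContMDiff (𝓡 n) 𝓘(ℝ, ℝ) ∞ fun x => χ x • θ (e x - e x₀) := by
    refine χ.contMDiff_smul ?_
    have h1 : ContMDiffOn (𝓡 n) (𝓡 n) ∞ e e.source := contMDiffOn_chart
    have h2 : ContDiff ℝ ∞ fun y : Model n => θ (y - e x₀) := by fun_prop
    exact h2.contMDiff.comp_contMDiffOn h1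
  have hev : (fun x => χ x • θ (e x - e x₀)) ∘ e.symm =ᶠ[𝓝 (e x₀)] fun y => θ (y - e x₀) := by
    have hc : Filter.Tendsto e.symm (𝓝 (e x₀)) (𝓝 x₀) := by
      have := e.continuousAt_symm (e.map_source hx₀)
      rwa [ContinuousAt, e.left_inv hx₀] at this
    filter_upwards [hc.eventually χ.eventuallyEq_one, e.open_target.mem_nhds (e.map_source hx₀)]
      with y hy hyt
    simp only [Function.comp, hy, Pi.one_apply, one_smul, e.right_inv hyt]
  have hfd : fderiv ℝ ((fun x => χ x • θ (e x - e x₀)) ∘ e.symm) (e x₀) = θ := by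
    rw [hev.fderiv_eq, fderiv_comp_sub (𝕜 := ℝ) (f := fun y => θ y) (a := e x₀)]
    exact θ.fderiv
  refine ⟨_, hsm, by simp, hfd, fun hθ h0 => hθ ?_⟩
  rw [(hsm.mdifferentiable (by simp)).mdifferentiableAt.mfderiv] at h0
  rw [← hfd]
  have h1 : writtenInExtChartAt (𝓡 n) 𝓘(ℝ, ℝ) x₀ (fun x => χ x • θ (e x - e x₀)) =
      (fun x => χ x • θ (e x - e x₀)) ∘ e.symm := by
    ext y; rfl
  rw [h1, ModelWithCorners.range_eq_univ, fderivWithin_univ] at h0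
  exact h0

variable {F₁ : Type*} [NormedAddCommGroup F₁] [NormedSpace ℝ F₁]
  {E₁ : X → Type*} [TopologicalSpace (TotalSpace F₁ E₁)]
  [∀ x, NormedAddCommGroup (E₁ x)] [∀ x, InnerProductSpace ℝ (E₁ x)] [FiberBundle F₁ E₁]
  [VectorBundle ℝ F₁ E₁] [ContMDiffVectorBundle ∞ F₁ E₁ (𝓡 n)]
  {F₂ : Type*} [NormedAddCommGroup F₂] [NormedSpace ℝ F₂]
  {E₂ : X → Type*} [TopologicalSpace (TotalSpace F₂ E₂)]
  [∀ x, NormedAddCommGroup (E₂ x)] [∀ x, InnerProductSpace ℝ (E₂ x)] [FiberBundle F₂ E₂]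
  [VectorBundle ℝ F₂ E₂] [ContMDiffVectorBundle ∞ F₂ E₂ (𝓡 n)]

/-- A first order operator applied to `g² u` is divisible by `g`. -/
lemma FirstOrderOp.exists_apply_sq_smul (A : FirstOrderOp n F₁ E₁ F₂ E₂) {g : X → ℝ}
    (hg : ContMDiff (𝓡 n) 𝓘(ℝ, ℝ) ∞ g) {u : ∀ x, E₁ x} (hu : IsSmoothSection n F₁ u) :
    ∃ z : ∀ x, E₂ x, IsSmoothSection n F₂ z ∧
      ∀ x, A (fun x => g x ^ 2 • u x) x = g x • z x := by
  have hg1 : ContMDiff (𝓡 n) 𝓘(ℝ, ℝ) 1 g := hg.of_le (by exact_mod_cast le_top)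
  have hgu : IsSmoothSection n F₁ (fun x => g x • u x) := fun x => IsCkAt.smul (hg x) (hu x)
  refine ⟨fun x => A (fun x => g x • u x) x + (A (fun x => g x • u x) x - g x • A u x),
    fun x => IsCkAt.add (A.isSmoothSection hgu x) (IsCkAt.sub (A.isSmoothSection hgu x)
      (IsCkAt.smul (hg x) (A.isSmoothSection hu x))), fun x => ?_⟩
  have hx : x ∈ patch₂ n F₁ E₁ F₂ E₂ x := mem_patch₂_self x
  have hy := chartAt_mem_coordDomain hx.1
  have h1 := A.map_smul hx (hg1 x) (isCk_one_of_isSmoothSection hu x)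
  have h2 := A.map_smul hx (hg1 x) (isCk_one_of_isSmoothSection hgu x)
  have h3 : (fun x => g x ^ 2 • u x) = fun x => g x • g x • u x := by
    funext x; rw [smul_smul, sq]
  have h4 : ∀ (L : Model n →L[ℝ] ℝ) (c : ℝ) (w : F₁), L.smulRight (c • w) = c • L.smulRight w := by
    intro L c w; ext1 z; exact smul_comm _ _ _
  have hgx : g ((chartAt (Model n) x).symm (chartAt (Model n) x x)) = g x := by
    rw [(chartAt (Model n) x).left_inv hx.1.1]
  rw [localRep_smul x g u hy, hgx, h4, _root_.map_smul, _root_.map_smul,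
    ← sub_eq_iff_eq_add'.2 h1] at h2
  rw [h3, h2, smul_add]

/-- If the operators `P'`, `P` are composed after multiplication by the square of a function
vanishing at `x₀`, the result lies in the range of the symbol of `P`. -/
lemma FirstOrderOp.exists_comp_sq_smul (P' : FirstOrderOp n F₁ E₁ F₂ E₂)
    (P : FirstOrderOp n F₂ E₂ F₁ E₁) {g : X → ℝ} (hg : ContMDiff (𝓡 n) 𝓘(ℝ, ℝ) ∞ g)
    {u : ∀ x, E₁ x} (hu : IsSmoothSection n F₁ u) {x₀ : X} (h0 : g x₀ = 0) :
    ∃ f : F₂, P (P' (fun x => g x ^ 2 • u x)) x₀ = (trivializationAt F₁ E₁ x₀).symmL ℝ x₀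
      (P.coeffA x₀ (chartAt (Model n) x₀ x₀)
        ((fderiv ℝ (g ∘ (chartAt (Model n) x₀).symm) (chartAt (Model n) x₀ x₀)).smulRight f)) := by
  have hg1 : ContMDiff (𝓡 n) 𝓘(ℝ, ℝ) 1 g := hg.of_le (by exact_mod_cast le_top)
  obtain ⟨z, hz, hzeq⟩ := P'.exists_apply_sq_smul hg hu
  have h1 : P' (fun x => g x ^ 2 • u x) = fun x => g x • z x := funext hzeq
  rw [h1, P.map_smul (mem_patch₂_self x₀) (hg1 x₀) (isCk_one_of_isSmoothSection hz x₀), h0,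
    zero_smul, zero_add]
  exact ⟨_, rfl⟩

variable {F : Type*} [NormedAddCommGroup F] [NormedSpace ℝ F]
  {E : X → Type*} [TopologicalSpace (TotalSpace F E)]
  [∀ x, NormedAddCommGroup (E x)] [∀ x, InnerProductSpace ℝ (E x)] [FiberBundle F E]
  [VectorBundle ℝ F E] [ContMDiffVectorBundle ∞ F E (𝓡 n)]

/-- If `P P' + Q Q'` is strongly elliptic, no nonzero vector is orthogonal to the ranges of the
symbols of `P` and `Q` at a nonzero covector. -/
lemma IsStronglyElliptic.eq_zero_of_inner_symbol {P : FirstOrderOp n F₁ E₁ F E}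
    {P' : FirstOrderOp n F E F₁ E₁} {Q : FirstOrderOp n F₂ E₂ F E} {Q' : FirstOrderOp n F E F₂ E₂}
    (hell : IsStronglyElliptic n F (E := E) (fun u x => P (P' u) x + Q (Q' u) x)) {x₀ : X}
    {θ : Model n →L[ℝ] ℝ} (hθ : θ ≠ 0) {w : F}
    (hP : ∀ f : F₁, (inner ℝ ((trivializationAt F E x₀).symmL ℝ x₀ w)
      ((trivializationAt F E x₀).symmL ℝ x₀
        (P.coeffA x₀ (chartAt (Model n) x₀ x₀) (θ.smulRight f))) : ℝ) = 0)
    (hQ : ∀ f : F₂, (inner ℝ ((trivializationAt F E x₀).symmL ℝ x₀ w)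
      ((trivializationAt F E x₀).symmL ℝ x₀
        (Q.coeffA x₀ (chartAt (Model n) x₀ x₀) (θ.smulRight f))) : ℝ) = 0) : w = 0 := by
  by_contra hw
  have hx₀ : x₀ ∈ patch n F E x₀ := mem_patch_self x₀
  have hy := chartAt_mem_coordDomain hx₀
  obtain ⟨g, hg, hg0, hgθ, hgm⟩ := exists_smooth_fderiv_eq x₀ θ
  -- a smooth section with value `w` at `x₀`
  obtain ⟨r, hr, hrD⟩ := Metric.nhds_basis_closedBall.mem_iff.1 ((isOpen_coordDomain x₀).mem_nhds hy)
  let χ : ContDiffBump (chartAt (Model n) x₀ x₀) := ⟨r / 2, r, by positivity, by linarith⟩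
  have hφ : ContDiff ℝ (⊤ : ℕ∞) fun y => χ y • w := χ.contDiff.smul contDiff_const
  have hts : tsupport (fun y => χ y • w) ⊆ Metric.closedBall (chartAt (Model n) x₀ x₀) r :=
    (closure_mono (Function.support_smul_subset_left _ _)).trans χ.tsupport_eq.subset
  have hφc : HasCompactSupport fun y => χ y • w :=
    (isCompact_closedBall _ _).of_isClosed_subset (isClosed_tsupport _) hts
  have hu : IsSmoothSection n F (ofLocal (E := E) x₀ fun y => χ y • w) :=
    isCk_ofLocal hφ hφc (hts.trans hrD)
  have hux : ofLocal (E := E) x₀ (fun y => χ y • w) x₀ =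
      (trivializationAt F E x₀).symmL ℝ x₀ w := by
    rw [ofLocal_of_mem _ hx₀.1, χ.one_of_mem_closedBall, one_smul]
    exact Metric.mem_closedBall_self (by positivity)
  have hw' : (trivializationAt F E x₀).symmL ℝ x₀ w ≠ 0 := by
    intro h
    apply hw
    rw [← Trivialization.continuousLinearMapAt_symmL (R := ℝ) (trivializationAt F E x₀) hx₀.2 w, h,
      map_zero]
  have hneg := hell x₀ g _ hg hu hg0 (hgm hθ) (hux ▸ hw')
  obtain ⟨f₁, hf₁⟩ := P'.exists_comp_sq_smul P hg hu hg0
  obtain ⟨f₂, hf₂⟩ := Q'.exists_comp_sq_smul Q hg hu hg0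
  simp only [hf₁, hf₂, hux, hgθ] at hneg
  rw [inner_add_left, real_inner_comm, hP, real_inner_comm, hQ] at hneg
  simp at hneg

end Symbol

/-! ### Elliptic regularity on the manifold -/

section Regularity

set_option linter.unusedSectionVars false

variable {n : ℕ} {X : Type*} [TopologicalSpace X] [T2Space X] [CompactSpace X]
  [ChartedSpace (Model n) X] [IsManifold (𝓡 n) ∞ X]
  [MeasurableSpace X] [BorelSpace X] {vol : Measure X}
  {F : Type*} [NormedAddCommGroup F] [NormedSpace ℝ F] [FiniteDimensional ℝ F]
  {E : X → Type*} [TopologicalSpace (TotalSpace F E)]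
  [∀ x, NormedAddCommGroup (E x)] [∀ x, InnerProductSpace ℝ (E x)] [FiberBundle F E]
  [VectorBundle ℝ F E] [ContMDiffVectorBundle ∞ F E (𝓡 n)]
  [IsContMDiffRiemannianBundle (𝓡 n) ∞ F E]
  {F₁ : Type*} [NormedAddCommGroup F₁] [NormedSpace ℝ F₁] [FiniteDimensional ℝ F₁]
  {E₁ : X → Type*} [TopologicalSpace (TotalSpace F₁ E₁)]
  [∀ x, NormedAddCommGroup (E₁ x)] [∀ x, InnerProductSpace ℝ (E₁ x)] [FiberBundle F₁ E₁]
  [VectorBundle ℝ F₁ E₁] [ContMDiffVectorBundle ∞ F₁ E₁ (𝓡 n)]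
  {F₂ : Type*} [NormedAddCommGroup F₂] [NormedSpace ℝ F₂] [FiniteDimensional ℝ F₂]
  {E₂ : X → Type*} [TopologicalSpace (TotalSpace F₂ E₂)]
  [∀ x, NormedAddCommGroup (E₂ x)] [∀ x, InnerProductSpace ℝ (E₂ x)] [FiberBundle F₂ E₂]
  [VectorBundle ℝ F₂ E₂] [ContMDiffVectorBundle ∞ F₂ E₂ (𝓡 n)]

lemma smulRight_eq_sum {G ι : Type*} [NormedAddCommGroup G] [NormedSpace ℝ G] [Fintype ι]
    (β : Module.Basis ι ℝ G) (ξ : Fin n → ℝ) (dx : Fin n → Model n →L[ℝ] ℝ) (f : G) :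
    (∑ k, ξ k • dx k).smulRight f = ∑ r, β.repr f r • ∑ k, ξ k • (dx k).smulRight (β r) := by
  have h1 : ∀ g : G, ∑ k, ξ k • (dx k).smulRight g = (∑ k, ξ k • dx k).smulRight g := by
    intro g
    ext z
    simp [Finset.sum_smul, smul_smul]
  simp only [h1]
  ext z
  conv_lhs => rw [← β.sum_repr f]
  simp only [ContinuousLinearMap.smulRight_apply, sum_apply, smul_apply, Finset.smul_sum]
  exact Finset.sum_congr rfl fun r _ => smul_comm _ _ _

variable (E) in
/-- The fibre metric in the trivialization around `x₀`. -/
def localMetric (x₀ : X) (y : Model n) (w w' : F) : ℝ :=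
  inner ℝ ((trivializationAt F E x₀).symmL ℝ ((chartAt (Model n) x₀).symm y) w)
    ((trivializationAt F E x₀).symmL ℝ ((chartAt (Model n) x₀).symm y) w')

lemma contDiffOn_localMetric (x₀ : X) {U : Set (Model n)} (hU : U ⊆ coordDomain n F E x₀)
    (hUo : IsOpen U) {c c' : Model n → F} (hc : ContDiffOn ℝ ∞ c U) (hc' : ContDiffOn ℝ ∞ c' U) :
    ContDiffOn ℝ ∞ (fun y => localMetric E x₀ y (c y) (c' y)) U := by
  intro y hy
  have key : ∀ c : Model n → F, ContDiffOn ℝ ∞ c U →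
      ContMDiffAt (𝓡 n) ((𝓡 n).prod 𝓘(ℝ, F)) ∞ (fun y => TotalSpace.mk' F
        ((chartAt (Model n) x₀).symm y)
        ((trivializationAt F E x₀).symmL ℝ ((chartAt (Model n) x₀).symm y) (c y))) y := by
    intro c hc
    have hsrc : TotalSpace.mk' F ((chartAt (Model n) x₀).symm y)
        ((trivializationAt F E x₀).symmL ℝ ((chartAt (Model n) x₀).symm y) (c y)) ∈
          (trivializationAt F E x₀).source := (Trivialization.mem_source _).2 (hU hy).2
    refine ((trivializationAt F E x₀).contMDiffAt_iff (f := fun y => TotalSpace.mk' F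
        ((chartAt (Model n) x₀).symm y) ((trivializationAt F E x₀).symmL ℝ
          ((chartAt (Model n) x₀).symm y) (c y))) hsrc).2 ⟨contMDiffOn_chart_symm.contMDiffAt
      ((chartAt (Model n) x₀).open_target.mem_nhds (hU hy).1), ?_⟩
    refine (contMDiffAt_iff_contDiffAt.2 (hc.contDiffAt (hUo.mem_nhds hy))).congr_of_eventuallyEq ?_
    filter_upwards [hUo.mem_nhds hy] with y' hy'
    have := Trivialization.continuousLinearMapAt_symmL (R := ℝ) (trivializationAt F E x₀)
      (hU hy').2 (c y')
    rwa [Trivialization.continuousLinearMapAt_apply_of_mem _ _ (hU hy').2] at this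
  exact (contMDiffAt_iff_contDiffAt.1 ((key c hc).inner_bundle (key c' hc'))).contDiffWithinAt

/-- The integral of `(p, P ψ)` for a test section `ψ = φ f` supported in a patch, in coordinates. -/
lemma integral_inner_apply_ofLocal {x₀ : X} {ρ : Model n → ℝ} [IsContinuousRiemannianBundle F E]
    (hρ : ∀ f : X → ℝ, Continuous f → (∀ x ∉ (chartAt (Model n) x₀).source, f x = 0) →
        ∫ x, f x ∂vol =
          ∫ y in (chartAt (Model n) x₀).target, ρ y * f ((chartAt (Model n) x₀).symm y))
    (P : FirstOrderOp n F₁ E₁ F E) {p : ∀ x, E x}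
    (hp : Continuous fun x => TotalSpace.mk' F x (p x)) {ι : Type*} [Fintype ι]
    (β : Module.Basis ι ℝ F) (f : F₁) {φ : Model n → ℝ}
    (hφ : IsTest (coordDomain₂ n F₁ E₁ F E x₀) φ) :
    ∫ x, inner ℝ (p x) (P (ofLocal x₀ fun y => φ y • f) x) ∂vol =
      ∫ y, ((∑ k, ∑ l, (ρ y * localMetric E x₀ y (β l) (P.coeffA x₀ y
          ((EuclideanSpace.proj k : Model n →L[ℝ] ℝ).smulRight f))) *
          β.repr (localRep n F x₀ p y) l * pd k φ y) +
        ∑ l, (ρ y * localMetric E x₀ y (β l) (P.coeffB x₀ y f)) *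
          β.repr (localRep n F x₀ p y) l * φ y) := by
  set e := chartAt (Model n) x₀
  set D := coordDomain₂ n F₁ E₁ F E x₀ with hDdef
  have hDo : IsOpen D := isOpen_coordDomain₂ x₀
  have hψ' : ContDiff ℝ (⊤ : ℕ∞) fun y => φ y • f := hφ.contDiff.smul contDiff_const
  have hts : tsupport (fun y => φ y • f) ⊆ tsupport φ :=
    closure_mono (Function.support_smul_subset_left _ _)
  have hψc : HasCompactSupport fun y => φ y • f :=
    hφ.hasCompactSupport.of_isClosed_subset (isClosed_tsupport _) hts
  have hψ : IsCk n F₁ (⊤ : ℕ∞) (ofLocal (E := E₁) x₀ fun y => φ y • f) :=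
    isCk_ofLocal hψ' hψc fun y hy => (hφ.tsupport_subset (hts hy)).1
  have hψ1 := isCk_one_of_isSmoothSection hψ
  have hPc : Continuous fun x => TotalSpace.mk' F x (P (ofLocal x₀ fun y => φ y • f) x) :=
    IsCk.continuous (n := n) (P.isSmoothSection hψ)
  have hP0 : ∀ x ∉ e.symm '' tsupport φ, P (ofLocal x₀ fun y => φ y • f) x = 0 := by
    intro x hx
    rw [P.congr (ofLocal_eventuallyEq_zero hψc (fun y hy => (hφ.tsupport_subset (hts hy)).1.1)
      fun h => hx (image_mono hts h)) (isCkAt_zero 1 x), P.map_zero]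
  rw [hρ _ (continuous_inner_section hp hPc) (fun x hx => by
    rw [hP0, inner_zero_right]
    rintro ⟨y, hy, rfl⟩
    exact hx (e.map_target (hφ.tsupport_subset hy).1.1)),
    ← integral_indicator e.open_target.measurableSet]
  refine integral_congr_ae (Filter.Eventually.of_forall fun y => ?_)
  by_cases hy : y ∈ tsupport φ
  · have hyD := hφ.tsupport_subset hy
    have hrep : localRep n F₁ x₀ (ofLocal (E := E₁) x₀ fun y => φ y • f) =ᶠ[𝓝 y]
        fun y => φ y • f :=
      Filter.eventually_of_mem (hDo.mem_nhds hyD) fun y' hy' => localRep_ofLocal x₀ _ hy'.1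
    have hφd : DifferentiableAt ℝ φ y := (hφ.contDiff.differentiable (by simp)) y
    have hfd : fderiv ℝ (fun y => φ y • f) y = ∑ k, pd k φ y •
        (EuclideanSpace.proj k : Model n →L[ℝ] ℝ).smulRight f := by
      rw [fderiv_smul_const hφd]
      ext ξ
      simp [fderiv_eq_sum_pd φ y ξ, Finset.sum_smul, smul_smul, mul_comm]
    have hPy : P (ofLocal x₀ fun y => φ y • f) (e.symm y) =
        (trivializationAt F E x₀).symmL ℝ (e.symm y)
          ((∑ k, pd k φ y • P.coeffA x₀ y
            ((EuclideanSpace.proj k : Model n →L[ℝ] ℝ).smulRight f)) +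
            φ y • P.coeffB x₀ y f) := by
      have := P.apply_eq (x₀ := x₀) (x := e.symm y) ⟨symm_mem_patch hyD.1, symm_mem_patch hyD.2⟩
        (hψ1 _)
      rw [this, e.right_inv hyD.1.1, hrep.fderiv_eq, hrep.eq_of_nhds, hfd]
      simp only [map_sum, _root_.map_smul]
    have hpy : p (e.symm y) = ∑ l, β.repr (localRep n F x₀ p y) l •
        (trivializationAt F E x₀).symmL ℝ (e.symm y) (β l) := by
      rw [← symmL_localRep x₀ p hyD.2]
      conv_lhs => rw [← β.sum_repr (localRep n F x₀ p y)]
      simp only [map_sum, _root_.map_smul]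
      rfl
    rw [indicator_of_mem hyD.1.1]
    simp only [hPy, hpy, localMetric, _root_.map_add, map_sum, _root_.map_smul, inner_add_right,
      inner_sum, sum_inner, inner_smul_left, inner_smul_right, mul_add, Finset.mul_sum]
    congr 1
    · refine Finset.sum_congr rfl fun k _ => Finset.sum_congr rfl fun l _ => ?_
      simp only [conj_trivial]; ring
    · refine Finset.sum_congr rfl fun l _ => ?_
      simp only [conj_trivial]; ring
  · have h1 : φ y = 0 := image_eq_zero_of_notMem_tsupport hy
    have h2 : ∀ k, pd k φ y = 0 := fun k => pd_eq_zero_of_notMem_tsupport hy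
    simp only [h1, h2, mul_zero, Finset.sum_const_zero, add_zero]
    refine indicator_apply_eq_zero.2 fun hyt => ?_
    rw [hP0, inner_zero_right, mul_zero]
    rintro ⟨y', hy', h⟩
    exact hy (e.symm.injOn (hφ.tsupport_subset hy').1.1 hyt h ▸ hy')

/-- Elliptic regularity: if `P P' + Q Q'` is strongly elliptic, a continuous section orthogonal to
the ranges of `P` and `Q` is smooth. -/
theorem isSmoothSection_of_orthogonal (hvol : IsSmoothDensity n vol)
    {P : FirstOrderOp n F₁ E₁ F E}
    {P' : FirstOrderOp n F E F₁ E₁} {Q : FirstOrderOp n F₂ E₂ F E} {Q' : FirstOrderOp n F E F₂ E₂}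
    (hell : IsStronglyElliptic n F (E := E) (fun u x => P (P' u) x + Q (Q' u) x)) {p : ∀ x, E x}
    (hp : Continuous fun x => TotalSpace.mk' F x (p x))
    (hpP : ∀ φ : ∀ x, E₁ x, IsSmoothSection n F₁ φ → ∫ x, inner ℝ (p x) (P φ x) ∂vol = 0)
    (hpQ : ∀ φ : ∀ x, E₂ x, IsSmoothSection n F₂ φ → ∫ x, inner ℝ (p x) (Q φ x) ∂vol = 0) :
    IsSmoothSection n F p := by
  have := isContinuousRiemannianBundle n F E
  intro x₀
  obtain ⟨ρ, hρ, hpos, hint⟩ := hvol.exists_integral_eq x₀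
  have hx₁ : x₀ ∈ patch₂ n F₁ E₁ F E x₀ := mem_patch₂_self x₀
  have hx₂ : x₀ ∈ patch₂ n F₂ E₂ F E x₀ := mem_patch₂_self x₀
  set U := coordDomain₂ n F₁ E₁ F E x₀ ∩ coordDomain₂ n F₂ E₂ F E x₀ with hUdef
  have hUo : IsOpen U := (isOpen_coordDomain₂ x₀).inter (isOpen_coordDomain₂ x₀)
  have hy₀ : chartAt (Model n) x₀ x₀ ∈ U :=
    ⟨chartAt_mem_coordDomain₂ hx₁, chartAt_mem_coordDomain₂ hx₂⟩
  have hUE : U ⊆ coordDomain n F E x₀ := fun y hy => hy.1.2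
  have hρU : ContDiffOn ℝ ∞ ρ U := hρ.mono fun y hy => hy.1.2.1
  let β := Module.finBasis ℝ F
  let β₁ := Module.finBasis ℝ F₁
  let β₂ := Module.finBasis ℝ F₂
  let dx : Fin n → Model n →L[ℝ] ℝ := fun k => EuclideanSpace.proj k
  let S : Fin n → (Fin (Module.finrank ℝ F₁) ⊕ Fin (Module.finrank ℝ F₂)) → Model n → F :=
    fun k r y => Sum.elim (fun r => P.coeffA x₀ y ((dx k).smulRight (β₁ r)))
      (fun r => Q.coeffA x₀ y ((dx k).smulRight (β₂ r))) r
  let S₀ : (Fin (Module.finrank ℝ F₁) ⊕ Fin (Module.finrank ℝ F₂)) → Model n → F :=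
    fun r y => Sum.elim (fun r => P.coeffB x₀ y (β₁ r)) (fun r => Q.coeffB x₀ y (β₂ r)) r
  have hS : ∀ k r, ContDiffOn ℝ ∞ (S k r) U := by
    rintro k (r | r)
    · exact ((P.contDiffOn_coeffA x₀).mono inter_subset_left).clm_apply contDiffOn_const
    · exact ((Q.contDiffOn_coeffA x₀).mono inter_subset_right).clm_apply contDiffOn_const
  have hS₀ : ∀ r, ContDiffOn ℝ ∞ (S₀ r) U := by
    rintro (r | r)
    · exact ((P.contDiffOn_coeffB x₀).mono inter_subset_left).clm_apply contDiffOn_const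
    · exact ((Q.contDiffOn_coeffB x₀).mono inter_subset_right).clm_apply contDiffOn_const
  let a : Fin n → (Fin (Module.finrank ℝ F₁) ⊕ Fin (Module.finrank ℝ F₂)) →
      Fin (Module.finrank ℝ F) → Model n → ℝ :=
    fun k r l y => ρ y * localMetric E x₀ y (β l) (S k r y)
  let b : (Fin (Module.finrank ℝ F₁) ⊕ Fin (Module.finrank ℝ F₂)) →
      Fin (Module.finrank ℝ F) → Model n → ℝ :=
    fun r l y => ρ y * localMetric E x₀ y (β l) (S₀ r y)
  let v : Fin (Module.finrank ℝ F) → Model n → ℝ := fun l y => β.repr (localRep n F x₀ p y) l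
  have ha : ∀ k r l, ContDiffOn ℝ ∞ (a k r l) U := fun k r l =>
    hρU.mul (contDiffOn_localMetric x₀ hUE hUo contDiffOn_const (hS k r))
  have hb : ∀ r l, ContDiffOn ℝ ∞ (b r l) U := fun r l =>
    hρU.mul (contDiffOn_localMetric x₀ hUE hUo contDiffOn_const (hS₀ r))
  have hcoord : ∀ l, ContDiff ℝ ∞ fun w : F => β.repr w l := fun l =>
    (LinearMap.toContinuousLinearMap (β.coord l)).contDiff
  have hp0 : IsCk n F (0 : ℕ∞) p := contMDiff_zero_iff.2 hp
  have hv : ∀ l, ContinuousOn (v l) U := fun l y hy =>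
    ((hcoord l).continuous.continuousAt.comp
      (IsCkAt.contDiffAt_localRep (hUE hy) (hp0 _)).continuousAt).continuousWithinAt
  have hsol : IsWeakSol U a b v := by
    rintro (r | r) φ hφ
    · have h1 := integral_inner_apply_ofLocal hint P hp β (β₁ r) (hφ.mono inter_subset_left)
      rw [hpP] at h1
      · exact h1.symm
      · refine isCk_ofLocal (hφ.contDiff.smul contDiff_const) ?_ ?_
        · exact hφ.hasCompactSupport.smul_right
        · exact (closure_mono (Function.support_smul_subset_left _ _)).trans
            (hφ.tsupport_subset.trans fun y hy => hy.1.1)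
    · have h1 := integral_inner_apply_ofLocal hint Q hp β (β₂ r) (hφ.mono inter_subset_right)
      rw [hpQ] at h1
      · exact h1.symm
      · refine isCk_ofLocal (hφ.contDiff.smul contDiff_const) ?_ ?_
        · exact hφ.hasCompactSupport.smul_right
        · exact (closure_mono (Function.support_smul_subset_left _ _)).trans
            (hφ.tsupport_subset.trans fun y hy => hy.2.1)
  have hsym : ∀ ξ : Fin n → ℝ, ξ ≠ 0 → ∀ η : Fin (Module.finrank ℝ F) → ℝ,
      (∀ r, ∑ k, ∑ l, a k r l (chartAt (Model n) x₀ x₀) * ξ k * η l = 0) → η = 0 := by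
    intro ξ hξ η h
    have hx : (chartAt (Model n) x₀).symm (chartAt (Model n) x₀ x₀) = x₀ :=
      (chartAt (Model n) x₀).left_inv (mem_chart_source _ x₀)
    have hmet : ∀ w w' : F, localMetric E x₀ (chartAt (Model n) x₀ x₀) w w' =
        inner ℝ ((trivializationAt F E x₀).symmL ℝ x₀ w)
          ((trivializationAt F E x₀).symmL ℝ x₀ w') := by
      intro w w'
      unfold localMetric
      rw [hx]
    have hρ0 := hpos _ ((chartAt (Model n) x₀).map_source (mem_chart_source _ x₀))
    let θ : Model n →L[ℝ] ℝ := ∑ k, ξ k • dx k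
    have hθ : θ ≠ 0 := by
      intro h0
      refine hξ (funext fun k => ?_)
      have := congrArg (fun L : Model n →L[ℝ] ℝ => L (EuclideanSpace.single k 1)) h0
      simpa [θ, dx, Finset.sum_apply, sum_apply, Pi.single_apply] using this
    let w : F := ∑ l, η l • β l
    -- the vanishing of a row of the symbol matrix is orthogonality to a vector of the range
    have hrow : ∀ r, (inner ℝ ((trivializationAt F E x₀).symmL ℝ x₀ w)
        ((trivializationAt F E x₀).symmL ℝ x₀ (∑ k, ξ k • S k r (chartAt (Model n) x₀ x₀))) : ℝ)
          = 0 := by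
      intro r
      have h1 := h r
      have h2 : ∑ k, ∑ l, a k r l (chartAt (Model n) x₀ x₀) * ξ k * η l =
          ρ (chartAt (Model n) x₀ x₀) * inner ℝ ((trivializationAt F E x₀).symmL ℝ x₀ w)
            ((trivializationAt F E x₀).symmL ℝ x₀
              (∑ k, ξ k • S k r (chartAt (Model n) x₀ x₀))) := by
        simp only [a, w, hmet, map_sum, _root_.map_smul, sum_inner, inner_sum,
          inner_smul_left, inner_smul_right, Finset.mul_sum, conj_trivial]
        refine Finset.sum_congr rfl fun k _ => Finset.sum_congr rfl fun l _ => ?_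
        ring
      rw [h2] at h1
      exact (mul_eq_zero.1 h1).resolve_left hρ0.ne'
    have hlinP : ∀ f : F₁, (inner ℝ ((trivializationAt F E x₀).symmL ℝ x₀ w)
        ((trivializationAt F E x₀).symmL ℝ x₀
          (P.coeffA x₀ (chartAt (Model n) x₀ x₀) (θ.smulRight f))) : ℝ) = 0 := by
      intro f
      rw [smulRight_eq_sum β₁ ξ dx f]
      simp only [map_sum, _root_.map_smul, inner_sum, inner_smul_right]
      refine Finset.sum_eq_zero fun r _ => ?_
      have := hrow (Sum.inl r)
      simp only [map_sum, _root_.map_smul, inner_sum, inner_smul_right, S, Sum.elim_inl] at this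
      rw [this, mul_zero]
    have hlinQ : ∀ f : F₂, (inner ℝ ((trivializationAt F E x₀).symmL ℝ x₀ w)
        ((trivializationAt F E x₀).symmL ℝ x₀
          (Q.coeffA x₀ (chartAt (Model n) x₀ x₀) (θ.smulRight f))) : ℝ) = 0 := by
      intro f
      rw [smulRight_eq_sum β₂ ξ dx f]
      simp only [map_sum, _root_.map_smul, inner_sum, inner_smul_right]
      refine Finset.sum_eq_zero fun r _ => ?_
      have := hrow (Sum.inr r)
      simp only [map_sum, _root_.map_smul, inner_sum, inner_smul_right, S, Sum.elim_inr] at this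
      rw [this, mul_zero]
    have hw : w = 0 := hell.eq_zero_of_inner_symbol hθ hlinP hlinQ
    have hind := Fintype.linearIndependent_iff.1 β.linearIndependent η hw
    exact funext hind
  have hsm := fun l => IsWeakSol.contDiffAt hUo hy₀ ha hb hsym hv hsol l
  refine isCkAt_of_contDiffAt_localRep (k := ⊤) (mem_patch_self x₀) ?_
  have hrep : localRep n F x₀ p = fun y => ∑ l, v l y • β l :=
    funext fun y => (β.sum_repr (localRep n F x₀ p y)).symm
  rw [hrep]
  exact ContDiffAt.sum fun l _ => (hsm l).smul contDiffAt_const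

end Regularity

/-! ### Time dependent sections -/

section Cylinder

set_option linter.unusedSectionVars false

/-- Gronwall's lemma for a nonnegative function with zero initial value. -/
lemma eq_zero_of_deriv_le_mul {T c : ℝ} {h h' : ℝ → ℝ} (hT : 0 < T) (hc : ContinuousOn h (Icc 0 T))
    (hd : ∀ t ∈ Ioo 0 T, HasDerivAt h (h' t) t) (hle : ∀ t ∈ Ioo 0 T, h' t ≤ c * h t)
    (hnn : ∀ t ∈ Icc 0 T, 0 ≤ h t) (h0 : h 0 = 0) : ∀ t ∈ Icc 0 T, h t = 0 := by
  have hder : ∀ t ∈ Ioo 0 T, HasDerivAt (fun t => Real.exp (-c * t) * h t)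
      (Real.exp (-c * t) * (h' t - c * h t)) t := by
    intro t ht
    have h1 : HasDerivAt (fun t => Real.exp (-c * t)) (Real.exp (-c * t) * -c) t := by
      simpa using ((hasDerivAt_id t).const_mul (-c)).exp
    have h2 := h1.mul (hd t ht)
    have h3 : Real.exp (-c * t) * -c * h t + Real.exp (-c * t) * h' t =
        Real.exp (-c * t) * (h' t - c * h t) := by ring
    rw [← h3]
    exact h2
  have hanti : AntitoneOn (fun t => Real.exp (-c * t) * h t) (Icc 0 T) := by
    refine antitoneOn_of_deriv_nonpos (convex_Icc 0 T) (by fun_prop) ?_ ?_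
    · rw [interior_Icc]
      exact fun t ht => (hder t ht).differentiableAt.differentiableWithinAt
    · rw [interior_Icc]
      intro t ht
      rw [(hder t ht).deriv]
      exact mul_nonpos_of_nonneg_of_nonpos (Real.exp_pos _).le (by linarith [hle t ht])
  intro t ht
  have h1 := hanti (left_mem_Icc.2 hT.le) ht ht.1
  simp only [h0, mul_zero] at h1
  exact le_antisymm (nonpos_of_mul_nonpos_right h1 (Real.exp_pos _)) (hnn t ht)

variable {n : ℕ} {X : Type*} [TopologicalSpace X] [CompactSpace X] [ChartedSpace (Model n) X]

section OneBundle

variable {F : Type*} [NormedAddCommGroup F] [NormedSpace ℝ F]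
  {E : X → Type*} [TopologicalSpace (TotalSpace F E)]
  [∀ x, NormedAddCommGroup (E x)] [∀ x, InnerProductSpace ℝ (E x)] [FiberBundle F E]
  [VectorBundle ℝ F E]

/-- A time dependent section is continuous if its coordinate representations are. -/
lemma isC0_of_continuousOn_localRep {T : ℝ} {u : ℝ → ∀ x, E x} {D : X → Set (Model n)}
    (hD : ∀ x₀, D x₀ ∈ 𝓝 (chartAt (Model n) x₀ x₀))
    (hu : ∀ x₀, ContinuousOn (fun q : ℝ × Model n => localRep n F x₀ (u q.1) q.2)
      (Icc 0 T ×ˢ D x₀)) : IsC0 F T u := by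
  rintro ⟨t, x₀⟩ ⟨ht, -⟩
  have hx₀ := mem_chart_source (Model n) x₀
  rw [FiberBundle.continuousWithinAt_totalSpace]
  refine ⟨continuousWithinAt_snd, ?_⟩
  have hch := (chartAt (Model n) x₀).continuousAt hx₀
  have h1 : Filter.Tendsto (fun q : ℝ × X => (q.1, chartAt (Model n) x₀ q.2))
      (𝓝[Icc 0 T ×ˢ univ] (t, x₀)) (𝓝[Icc 0 T ×ˢ D x₀] (t, chartAt (Model n) x₀ x₀)) := by
    refine tendsto_nhdsWithin_iff.2 ⟨?_, ?_⟩
    · refine (ContinuousAt.prodMk continuousAt_fst ?_).tendsto.mono_left nhdsWithin_le_nhds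
      exact ContinuousAt.comp (g := chartAt (Model n) x₀) hch continuousAt_snd
    · have h2 : ∀ᶠ q : ℝ × X in 𝓝 (t, x₀), chartAt (Model n) x₀ q.2 ∈ D x₀ :=
        (ContinuousAt.comp (g := chartAt (Model n) x₀) (f := (Prod.snd : ℝ × X → X))
          (x := (t, x₀)) hch continuousAt_snd).eventually (hD x₀)
      filter_upwards [self_mem_nhdsWithin, nhdsWithin_le_nhds h2] with q hq hq2
      exact ⟨hq.1, hq2⟩
  have h3 := (hu x₀ (t, chartAt (Model n) x₀ x₀) ⟨ht, mem_of_mem_nhds (hD x₀)⟩).tendsto.comp h1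
  have h4 : ∀ x ∈ (chartAt (Model n) x₀).source, ∀ s, localRep n F x₀ (u s)
      (chartAt (Model n) x₀ x) = (trivializationAt F E x₀ (TotalSpace.mk' F x (u s x))).2 := by
    intro x hx s
    have : TotalSpace.mk' F ((chartAt (Model n) x₀).symm (chartAt (Model n) x₀ x))
        (u s ((chartAt (Model n) x₀).symm (chartAt (Model n) x₀ x))) =
          TotalSpace.mk' F x (u s x) := by rw [(chartAt (Model n) x₀).left_inv hx]
    exact congrArg (fun z => (trivializationAt F E x₀ z).2) this
  have h5 : ∀ᶠ q : ℝ × X in 𝓝 (t, x₀), q.2 ∈ (chartAt (Model n) x₀).source :=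
    continuousAt_snd.eventually ((chartAt (Model n) x₀).open_source.mem_nhds hx₀)
  rw [ContinuousWithinAt, ← h4 x₀ hx₀ t]
  refine h3.congr' ?_
  filter_upwards [nhdsWithin_le_nhds h5] with q hq using h4 q.2 hq q.1

lemma IsC0.continuous {T : ℝ} {u : ℝ → ∀ x, E x} (hu : IsC0 F T u) {t : ℝ} (ht : t ∈ Icc 0 T) :
    Continuous (fun x => TotalSpace.mk' F x (u t x)) := by
  have h := ContinuousOn.comp_continuous (f := fun x : X => (t, x)) hu (by fun_prop)
    fun x => ⟨ht, mem_univ x⟩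
  exact h

lemma IsC0.continuousOn_time {T : ℝ} {u : ℝ → ∀ x, E x} (hu : IsC0 F T u) (x : X) :
    ContinuousOn (fun t => u t x) (Icc 0 T) := by
  rw [(FiberBundle.totalSpaceMk_isInducing F E x).continuousOn_iff]
  exact ContinuousOn.comp (f := fun t : ℝ => (t, x)) hu (by fun_prop) fun t ht => ⟨ht, mem_univ x⟩

lemma IsC0.exists_bound [IsContinuousRiemannianBundle F E] {T : ℝ} {u : ℝ → ∀ x, E x}
    (hu : IsC0 F T u) : ∃ K, 0 ≤ K ∧ ∀ t ∈ Icc 0 T, ∀ x, ‖u t x‖ ≤ K := by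
  have hc : ContinuousOn (fun q : ℝ × X => (inner ℝ (u q.1 q.2) (u q.1 q.2) : ℝ))
      (Icc 0 T ×ˢ univ) := ContinuousOn.inner_bundle hu hu
  obtain ⟨K, hK⟩ := (isCompact_Icc.prod isCompact_univ).exists_bound_of_continuousOn hc
  refine ⟨√K, by positivity, fun t ht x => ?_⟩
  have h := hK (t, x) ⟨ht, mem_univ x⟩
  rw [real_inner_self_eq_norm_sq, Real.norm_of_nonneg (by positivity)] at h
  exact Real.le_sqrt_of_sq_le h

variable {T : ℝ} {u : ℝ → ∀ x, E x}

lemma IsC2010.continuousOn_localRep (hu : IsC2010 n F T u) (x₀ : X) :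
    ContinuousOn (fun q : ℝ × Model n => localRep n F x₀ (u q.1) q.2)
      (Icc 0 T ×ˢ coordDomain n F E x₀) := by
  have h := hu.continuous_space x₀ 0 (by norm_num)
  have h2 := (ContinuousMultilinearMap.apply ℝ (fun _ : Fin 0 => Model n) F 0).continuous.comp_continuousOn h
  exact h2.congr fun q _ => rfl

lemma IsC2010.continuousOn_fderiv_localRep (hu : IsC2010 n F T u) (x₀ : X) :
    ContinuousOn (fun q : ℝ × Model n => fderiv ℝ (localRep n F x₀ (u q.1)) q.2)
      (Icc 0 T ×ˢ coordDomain n F E x₀) := by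
  have h := hu.continuous_space x₀ 1 (by norm_num)
  rw [continuousOn_clm_apply]
  intro ξ
  have h2 := (ContinuousMultilinearMap.apply ℝ (fun _ : Fin 1 => Model n) F
    fun _ => ξ).continuous.comp_continuousOn h
  exact h2.congr fun q _ => by simp [iteratedFDeriv_one_apply]

lemma IsC2010.isC0 (hu : IsC2010 n F T u) : IsC0 F T u :=
  isC0_of_continuousOn_localRep
    (fun x₀ => (isOpen_coordDomain x₀).mem_nhds (chartAt_mem_coordDomain (mem_patch_self x₀)))
    hu.continuousOn_localRep

lemma IsC2010.hasDerivAt (hu : IsC2010 n F T u) {t : ℝ} (ht : t ∈ Ioo 0 T) (x : X) :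
    HasDerivAt (fun s => u s x) (timeDeriv T u t x) t :=
  ((hu.differentiable_time x t (Ioo_subset_Icc_self ht)).hasDerivWithinAt).hasDerivAt
    (Icc_mem_nhds ht.1 ht.2)

lemma IsC2010.isCk (hu : IsC2010 n F T u) {t : ℝ} (ht : t ∈ Icc 0 T) : IsCk n F 2 (u t) :=
  hu.contMDiff_space t ht

end OneBundle

variable {F₁ : Type*} [NormedAddCommGroup F₁] [NormedSpace ℝ F₁]
  {E₁ : X → Type*} [TopologicalSpace (TotalSpace F₁ E₁)]
  [∀ x, NormedAddCommGroup (E₁ x)] [∀ x, InnerProductSpace ℝ (E₁ x)] [FiberBundle F₁ E₁]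
  [VectorBundle ℝ F₁ E₁]
  {F₂ : Type*} [NormedAddCommGroup F₂] [NormedSpace ℝ F₂]
  {E₂ : X → Type*} [TopologicalSpace (TotalSpace F₂ E₂)]
  [∀ x, NormedAddCommGroup (E₂ x)] [∀ x, InnerProductSpace ℝ (E₂ x)] [FiberBundle F₂ E₂]
  [VectorBundle ℝ F₂ E₂] [IsManifold (𝓡 n) ∞ X] [ContMDiffVectorBundle ∞ F₁ E₁ (𝓡 n)]

/-- A first order operator maps the class `C^{2,0,1,0}` to continuous time dependent sections. -/
lemma IsC2010.isC0_apply {T : ℝ} {u : ℝ → ∀ x, E₁ x} (hu : IsC2010 n F₁ T u)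
    (A : FirstOrderOp n F₁ E₁ F₂ E₂) : IsC0 F₂ T (fun t => A (u t)) := by
  refine isC0_of_continuousOn_localRep (D := fun x₀ => coordDomain₂ n F₁ E₁ F₂ E₂ x₀)
    (fun x₀ => (isOpen_coordDomain₂ x₀).mem_nhds (chartAt_mem_coordDomain₂ (mem_patch₂_self x₀)))
    fun x₀ => ?_
  have hsub : Icc 0 T ×ˢ coordDomain₂ n F₁ E₁ F₂ E₂ x₀ ⊆ Icc 0 T ×ˢ coordDomain n F₁ E₁ x₀ :=
    prod_mono_right inter_subset_left
  have hsnd : MapsTo Prod.snd (Icc 0 T ×ˢ coordDomain₂ n F₁ E₁ F₂ E₂ x₀)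
      (coordDomain₂ n F₁ E₁ F₂ E₂ x₀) := fun q hq => hq.2
  have ha := (A.contDiffOn_coeffA x₀).continuousOn.comp continuousOn_snd hsnd
  have hb := (A.contDiffOn_coeffB x₀).continuousOn.comp continuousOn_snd hsnd
  refine ((ha.clm_apply ((hu.continuousOn_fderiv_localRep x₀).mono hsub)).add
    (hb.clm_apply ((hu.continuousOn_localRep x₀).mono hsub))).congr fun q hq => ?_
  exact A.localRep_apply x₀ hq.2
    ((IsCkAt.contDiffAt_localRep (k := 2) hq.2.1 (hu.isCk hq.1 _)).differentiableAt (by simp))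

end Cylinder

namespace EllipticComplex

set_option linter.unusedSectionVars false

variable {n : ℕ} {X : Type*} [TopologicalSpace X] [T2Space X] [CompactSpace X]
  [ChartedSpace (Model n) X] [IsManifold (𝓡 n) ∞ X] [MeasurableSpace X] [BorelSpace X]
  {vol : Measure X}
  {F : ℤ → Type*} [∀ j, NormedAddCommGroup (F j)] [∀ j, NormedSpace ℝ (F j)]
  [∀ j, FiniteDimensional ℝ (F j)]
  {E : ℤ → X → Type*} [∀ j, TopologicalSpace (TotalSpace (F j) (E j))]
  [∀ j x, NormedAddCommGroup (E j x)] [∀ j x, InnerProductSpace ℝ (E j x)]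
  [∀ j, FiberBundle (F j) (E j)] [∀ j, VectorBundle ℝ (F j) (E j)]
  [∀ j, ContMDiffVectorBundle ∞ (F j) (E j) (𝓡 n)]
  [∀ j, IsContinuousRiemannianBundle (F j) (E j)]
  {N : ℕ} (C : EllipticComplex n F E vol N)

/-! ### The pressure -/

lemma isStronglyElliptic_of_eq {j k : ℤ} (h : j + 1 = k) :
    IsStronglyElliptic n (F j) (E := E j)
      (fun u x => C.dstar j k h (C.d j k h u) x + C.Aprev j (C.AprevStar j u) x) := by
  subst h
  exact C.stronglyElliptic j

lemma A_eq_zero_of_eq {j k : ℤ} (h : j + 1 = k) {p : ∀ x, E j x}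
    (h0 : ∀ x, C.d j k h p x = 0) (x : X) : C.A j p x = 0 := by
  subst h
  exact h0 x

/-- A continuous section of `E^{i-1}` with `A^{i-1} p = 0` and `(A^{i-2})^* p = 0` in the sense of
distributions is smooth, hence harmonic; it vanishes if it is orthogonal to the harmonic sections. -/
theorem eq_zero_of_orthogonal_harmonic [∀ j, IsContMDiffRiemannianBundle (𝓡 n) ∞ (F j) (E j)]
    [IsFiniteMeasure vol] (hvol : IsSmoothDensity n vol) {i : ℤ}
    {p : ∀ x, E (i - 1) x} (hp : Continuous fun x => TotalSpace.mk' (F (i - 1)) x (p x))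
    (hA : DistribEq vol (C.AprevStar i) p (fun _ => 0)) (hdiv : C.InKerAprevStar (i - 1) p)
    (horth : ∀ h : ∀ x, E (i - 1) x, C.IsHarmonic (i - 1) h →
      ∫ x, inner ℝ (p x) (h x) ∂vol = 0) (x : X) : p x = 0 := by
  have hsm : IsSmoothSection n (F (i - 1)) p := by
    refine isSmoothSection_of_orthogonal hvol
      (C.isStronglyElliptic_of_eq (sub_add_cancel i 1)) hp (fun φ hφ => ?_) fun φ hφ => ?_
    · have h := (hA φ hφ).2.2
      simp only [inner_zero_left, integral_zero] at h
      exact h.symm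
    · have h := (hdiv φ hφ).2.2
      simp only [inner_zero_left, integral_zero] at h
      exact h.symm
  have hAp : ∀ x, C.Aprev i p x = 0 := by
    have hs := (C.Aprev i).isSmoothSection hsm
    refine eq_zero_of_integral_inner_self_eq_zero hvol (IsCk.continuous (n := n) hs) ?_
    have h1 := C.isFormalAdjoint (i - 1) i (sub_add_cancel i 1) p _ hsm hs
    have h2 := (hA _ hs).2.2
    simp only [inner_zero_left, integral_zero] at h2
    exact h1.trans h2.symm
  have hdp : ∀ x, C.AprevStar (i - 1) p x = 0 :=
    (C.isFormalAdjoint _ _ (sub_add_cancel (i - 1) 1)).apply_eq_zero hvol (hsm.isCk 2) hdiv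
  exact eq_zero_of_integral_inner_self_eq_zero hvol hp
    (horth p ⟨hsm, C.A_eq_zero_of_eq (sub_add_cancel i 1) hAp, hdp⟩) x

/-! ### The energy estimate -/

lemma laplacian_eq {i : ℤ} {u : ∀ x, E i x} (hdiv : ∀ x, C.AprevStar i u x = 0) (x : X) :
    C.laplacian i u x = C.Astar i (C.A i u) x := by
  have h : C.AprevStar i u = fun x => 0 := funext hdiv
  rw [laplacian, h, FirstOrderOp.map_zero, add_zero]

/-- A distributional gradient is orthogonal to solenoidal sections of class `C¹`. -/
lemma integral_inner_eq_zero [IsFiniteMeasure vol] {i : ℤ} {m : ∀ x, E (i - 1) x}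
    {w U : ∀ x, E i x} (h : DistribEq vol (C.AprevStar i) m w) (hm : ∃ c, ∀ x, ‖m x‖ ≤ c)
    (hw : ∃ c, ∀ x, ‖w x‖ ≤ c) (hU : IsCk n (F i) 1 U) (hdiv : ∀ x, C.AprevStar i U x = 0) :
    Integrable (fun x => (inner ℝ (w x) (U x) : ℝ)) vol ∧ ∫ x, inner ℝ (w x) (U x) ∂vol = 0 := by
  obtain ⟨c, hc⟩ := hm
  obtain ⟨c', hc'⟩ := hw
  have h1 := h.of_isCk_one (K := max 0 (max c c')) (le_max_left _ _)
    (fun x => (hc x).trans ((le_max_left _ _).trans (le_max_right _ _)))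
    (fun x => (hc' x).trans ((le_max_right _ _).trans (le_max_right _ _))) hU
  refine ⟨h1.1, ?_⟩
  rw [h1.2.2]
  simp [hdiv]

lemma exists_norm_le_of_equation {i : ℤ} {M₁ : ∀ x, E (i + 1) x →ₗ[ℝ] E i x →ₗ[ℝ] E i x}
    {c₁ μ : ℝ} (hM₁ : ∀ (x : X) (v : E (i + 1) x) (u : E i x), ‖M₁ x v u‖ ≤ c₁ * ‖u‖ * ‖v‖)
    {u D f w q : ∀ x, E i x} (hu : IsCk n (F i) 2 u) (hdiv : ∀ x, C.AprevStar i u x = 0)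
    (hD : Continuous fun x => TotalSpace.mk' (F i) x (D x))
    (hf : Continuous fun x => TotalSpace.mk' (F i) x (f x))
    (hq : Continuous fun x => TotalSpace.mk' (F i) x (q x))
    (heq : ∀ x, D x + μ • C.laplacian i u x + (M₁ x (C.A i u x) (u x) + w x) + q x = f x) :
    ∃ c, ∀ x, ‖w x‖ ≤ c := by
  have hAu : IsCk n (F (i + 1)) (1 : ℕ∞) (C.A i u) := (C.A i).isCk (l := 2) (by norm_num) hu
  have hAAu : IsCk n (F i) (0 : ℕ∞) (C.Astar i (C.A i u)) := (C.Astar i).isCk (l := 1) (by simp) hAu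
  obtain ⟨k₁, -, h₁⟩ := exists_norm_section_le hD
  obtain ⟨k₂, -, h₂⟩ := exists_norm_section_le hf
  obtain ⟨k₃, -, h₃⟩ := exists_norm_section_le hq
  obtain ⟨k₄, -, h₄⟩ := exists_norm_section_le hAAu.continuous
  obtain ⟨k₅, hk₅, h₅⟩ := exists_norm_section_le hAu.continuous
  obtain ⟨k₆, hk₆, h₆⟩ := exists_norm_section_le hu.continuous
  refine ⟨k₂ + k₁ + |μ| * k₄ + |c₁| * k₆ * k₅ + k₃, fun x => ?_⟩
  have h7 : w x = f x - D x - μ • C.Astar i (C.A i u) x - M₁ x (C.A i u x) (u x) - q x := by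
    rw [← heq x, C.laplacian_eq hdiv]
    abel
  have h8 : ‖M₁ x (C.A i u x) (u x)‖ ≤ |c₁| * k₆ * k₅ := by
    refine (hM₁ x _ _).trans ?_
    gcongr
    · exact le_abs_self c₁
    · exact h₆ x
    · exact h₅ x
  have h9 : ‖μ • C.Astar i (C.A i u) x‖ ≤ |μ| * k₄ := by
    rw [norm_smul, Real.norm_eq_abs]
    gcongr
    exact h₄ x
  rw [h7]
  refine (norm_sub_le _ _).trans (add_le_add ((norm_sub_le _ _).trans (add_le_add
    ((norm_sub_le _ _).trans (add_le_add ((norm_sub_le _ _).trans (add_le_add (h₂ x) (h₁ x))) h9))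
    h8)) (h₃ x))

/-- Two solutions of the equation at a fixed time, with time derivatives `D'`, `D''`, satisfy the
energy inequality `(D' - D'', u' - u'') ≤ c ‖u' - u''‖²`: the gradient terms are orthogonal to
the solenoidal section `u' - u''`, and the remaining nonlinear term is absorbed by the Laplacian. -/
theorem energy_inequality [IsFiniteMeasure vol] (hvol : IsSmoothDensity n vol) {i : ℤ}
    {M₁ : ∀ x, E (i + 1) x →ₗ[ℝ] E i x →ₗ[ℝ] E i x} {c₁ K μ : ℝ} (hμ : 0 < μ)
    (hM₁ : ∀ (x : X) (v : E (i + 1) x) (u : E i x), ‖M₁ x v u‖ ≤ c₁ * ‖u‖ * ‖v‖)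
    {u' u'' D' D'' f w' w'' q' q'' : ∀ x, E i x} {p' p'' m' m'' : ∀ x, E (i - 1) x}
    (hu' : IsCk n (F i) 2 u') (hu'' : IsCk n (F i) 2 u'')
    (hdiv' : C.InKerAprevStar i u') (hdiv'' : C.InKerAprevStar i u'')
    (hK' : ∀ x, ‖u' x‖ ≤ K) (hK'' : ∀ x, ‖C.A i u'' x‖ ≤ K)
    (hD' : Continuous fun x => TotalSpace.mk' (F i) x (D' x))
    (hD'' : Continuous fun x => TotalSpace.mk' (F i) x (D'' x))
    (hf : Continuous fun x => TotalSpace.mk' (F i) x (f x))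
    (hq' : Continuous fun x => TotalSpace.mk' (F i) x (q' x))
    (hq'' : Continuous fun x => TotalSpace.mk' (F i) x (q'' x))
    (hp' : Continuous fun x => TotalSpace.mk' (F (i - 1)) x (p' x))
    (hp'' : Continuous fun x => TotalSpace.mk' (F (i - 1)) x (p'' x))
    (hpq' : DistribEq vol (C.AprevStar i) p' q') (hpq'' : DistribEq vol (C.AprevStar i) p'' q'')
    (hw' : DistribEq vol (C.AprevStar i) m' w') (hw'' : DistribEq vol (C.AprevStar i) m'' w'')
    (hm' : ∃ c, ∀ x, ‖m' x‖ ≤ c) (hm'' : ∃ c, ∀ x, ‖m'' x‖ ≤ c)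
    (heq' : ∀ x, D' x + μ • C.laplacian i u' x + (M₁ x (C.A i u' x) (u' x) + w' x) + q' x = f x)
    (heq'' : ∀ x, D'' x + μ • C.laplacian i u'' x + (M₁ x (C.A i u'' x) (u'' x) + w'' x) + q'' x =
      f x) :
    ∫ x, inner ℝ (D' x - D'' x) (u' x - u'' x) ∂vol ≤
      (|c₁| * K + (|c₁| * K) ^ 2 / (4 * μ)) * ∫ x, inner ℝ (u' x - u'' x) (u' x - u'' x) ∂vol := by
  have hsub : ∀ {k : ℕ∞ω} {j : ℤ} {a b : ∀ x, E j x}, IsCk n (F j) k a → IsCk n (F j) k b →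
      IsCk n (F j) k (fun x => a x - b x) := fun ha hb x => (ha x).sub (hb x)
  have hadj := C.isFormalAdjoint (i - 1) i (sub_add_cancel i 1)
  have hz' : ∀ x, C.AprevStar i u' x = 0 := hadj.apply_eq_zero hvol hu' hdiv'
  have hz'' : ∀ x, C.AprevStar i u'' x = 0 := hadj.apply_eq_zero hvol hu'' hdiv''
  have hu1' : IsCk n (F i) 1 u' := fun x => (hu' x).of_le (by norm_num)
  have hu1'' : IsCk n (F i) 1 u'' := fun x => (hu'' x).of_le (by norm_num)
  set U : ∀ x, E i x := fun x => u' x - u'' x with hUdef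
  have hU : IsCk n (F i) 1 U := hsub hu1' hu1''
  have hzU : ∀ x, C.AprevStar i U x = 0 := fun x => by
    rw [(C.AprevStar i).map_sub (hu1' x) (hu1'' x), hz', hz'', sub_zero]
  have hAu' : IsCk n (F (i + 1)) (1 : ℕ∞) (C.A i u') := (C.A i).isCk (l := 2) (by norm_num) hu'
  have hAu'' : IsCk n (F (i + 1)) (1 : ℕ∞) (C.A i u'') := (C.A i).isCk (l := 2) (by norm_num) hu''
  set G : ∀ x, E (i + 1) x := fun x => C.A i u' x - C.A i u'' x with hGdef
  have hG : IsCk n (F (i + 1)) 1 G := hsub hAu' hAu''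
  have hAU : ∀ x, C.A i U x = G x := fun x => (C.A i).map_sub (hu1' x) (hu1'' x)
  have hAG : ∀ x, C.Astar i G x = C.Astar i (C.A i u') x - C.Astar i (C.A i u'') x :=
    fun x => (C.Astar i).map_sub (hAu' x) (hAu'' x)
  have hAGc : Continuous fun x => TotalSpace.mk' (F i) x (C.Astar i G x) :=
    IsCk.continuous (n := n) (k := (0 : ℕ∞)) ((C.Astar i).isCk (l := 1) (by simp) hG)
  have hUc := hU.continuous
  have hGc := hG.continuous
  have hGreen : ∫ x, inner ℝ (C.Astar i G x) (U x) ∂vol = ∫ x, inner ℝ (G x) (G x) ∂vol := by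
    have h := (C.isFormalAdjoint i (i + 1) rfl).of_isCk_one hU hG
    simp only [real_inner_comm (U _)]
    refine h.symm.trans (integral_congr_ae (Filter.Eventually.of_forall fun x => ?_))
    exact congrArg (fun v => inner ℝ v (G x)) (hAU x)
  have bd : ∀ {j : ℤ} {a : ∀ x, E j x}, (Continuous fun x => TotalSpace.mk' (F j) x (a x)) →
      ∃ c, ∀ x, ‖a x‖ ≤ c := fun ha => (exists_norm_section_le ha).imp fun _ h => h.2
  obtain ⟨iw', ew'⟩ := C.integral_inner_eq_zero hw' hm'
    (C.exists_norm_le_of_equation hM₁ hu' hz' hD' hf hq' heq') hU hzU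
  obtain ⟨iw'', ew''⟩ := C.integral_inner_eq_zero hw'' hm''
    (C.exists_norm_le_of_equation hM₁ hu'' hz'' hD'' hf hq'' heq'') hU hzU
  obtain ⟨iq', eq'⟩ := C.integral_inner_eq_zero hpq' (bd hp') (bd hq') hU hzU
  obtain ⟨iq'', eq''⟩ := C.integral_inner_eq_zero hpq'' (bd hp'') (bd hq'') hU hzU
  set κ := |c₁| * K with hκ
  have iA := (integrable_inner_section vol hAGc hUc).const_mul μ
  have iG := (integrable_inner_section vol hGc hGc).const_mul μ
  have iU := (integrable_inner_section vol hUc hUc).const_mul (κ + κ ^ 2 / (4 * μ))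
  have iD : Integrable (fun x => (inner ℝ (D' x - D'' x) (U x) : ℝ)) vol := by
    simp only [inner_sub_left]
    exact (integrable_inner_section vol hD' hUc).sub (integrable_inner_section vol hD'' hUc)
  have hpt : ∀ x, inner ℝ (D' x - D'' x) (U x) ≤
      (μ * inner ℝ (G x) (G x) - μ * inner ℝ (C.Astar i G x) (U x) +
        (κ + κ ^ 2 / (4 * μ)) * inner ℝ (U x) (U x)) -
      ((inner ℝ (w' x) (U x) - inner ℝ (w'' x) (U x)) +
        (inner ℝ (q' x) (U x) - inner ℝ (q'' x) (U x))) := by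
    intro x
    have hM : M₁ x (C.A i u' x) (u' x) - M₁ x (C.A i u'' x) (u'' x) =
        M₁ x (G x) (u' x) + M₁ x (C.A i u'' x) (U x) := by
      simp only [hGdef, hUdef, map_sub, LinearMap.sub_apply]
      abel
    have hDx : D' x - D'' x = -(μ • C.Astar i G x) -
        (M₁ x (G x) (u' x) + M₁ x (C.A i u'' x) (U x)) - (w' x - w'' x) - (q' x - q'' x) := by
      have h1 := (heq' x).trans (heq'' x).symm
      rw [C.laplacian_eq hz', C.laplacian_eq hz''] at h1
      rw [← hM, hAG, smul_sub, ← sub_eq_zero]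
      rw [← sub_eq_zero] at h1
      rw [← h1]
      abel
    have hK0 : 0 ≤ K := (norm_nonneg _).trans (hK' x)
    have hκ0 : 0 ≤ κ := by positivity
    have hn1 : ‖M₁ x (G x) (u' x)‖ ≤ κ * ‖G x‖ := by
      refine (hM₁ x _ _).trans ?_
      rw [hκ]
      gcongr
      · exact le_abs_self c₁
      · exact hK' x
    have hn2 : ‖M₁ x (C.A i u'' x) (U x)‖ ≤ κ * ‖U x‖ := by
      refine (hM₁ x _ _).trans ?_
      rw [hκ, mul_assoc, mul_assoc, mul_comm K]
      gcongr
      · exact le_abs_self c₁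
      · exact hK'' x
    have hin : -(inner ℝ (M₁ x (G x) (u' x) + M₁ x (C.A i u'' x) (U x)) (U x) : ℝ) ≤
        (κ * ‖G x‖ + κ * ‖U x‖) * ‖U x‖ :=
      (neg_le_abs _).trans ((abs_real_inner_le_norm _ _).trans
        (mul_le_mul_of_nonneg_right ((norm_add_le _ _).trans (add_le_add hn1 hn2)) (norm_nonneg _)))
    -- Young's inequality `κ a b ≤ μ a² + κ² b² / (4 μ)`
    have hyoung : κ * ‖G x‖ * ‖U x‖ ≤ μ * ‖G x‖ ^ 2 + κ ^ 2 / (4 * μ) * ‖U x‖ ^ 2 := by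
      have h2 : μ * ‖G x‖ ^ 2 + κ ^ 2 / (4 * μ) * ‖U x‖ ^ 2 - κ * ‖G x‖ * ‖U x‖ =
          μ * (‖G x‖ - κ / (2 * μ) * ‖U x‖) ^ 2 := by
        field_simp
        ring
      have h3 : 0 ≤ μ * (‖G x‖ - κ / (2 * μ) * ‖U x‖) ^ 2 := by positivity
      linarith
    rw [hDx, real_inner_self_eq_norm_sq, real_inner_self_eq_norm_sq]
    simp only [inner_sub_left, inner_neg_left, inner_smul_left, conj_trivial] at hin ⊢
    nlinarith
  refine (integral_mono iD (((iG.sub iA).add iU).sub ((iw'.sub iw'').add (iq'.sub iq'')))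
    hpt).trans (le_of_eq ?_)
  have e1 : ∫ x, (μ * inner ℝ (G x) (G x) - μ * inner ℝ (C.Astar i G x) (U x) +
        (κ + κ ^ 2 / (4 * μ)) * inner ℝ (U x) (U x)) -
      ((inner ℝ (w' x) (U x) - inner ℝ (w'' x) (U x)) +
        (inner ℝ (q' x) (U x) - inner ℝ (q'' x) (U x))) ∂vol =
      (κ + κ ^ 2 / (4 * μ)) * ∫ x, inner ℝ (U x) (U x) ∂vol := by
    rw [integral_sub (f := fun x => μ * inner ℝ (G x) (G x) - μ * inner ℝ (C.Astar i G x) (U x) +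
          (κ + κ ^ 2 / (4 * μ)) * inner ℝ (U x) (U x))
        (g := fun x => (inner ℝ (w' x) (U x) - inner ℝ (w'' x) (U x)) +
          (inner ℝ (q' x) (U x) - inner ℝ (q'' x) (U x))) ((iG.sub iA).add iU)
        ((iw'.sub iw'').add (iq'.sub iq'')),
      integral_add (f := fun x => μ * inner ℝ (G x) (G x) - μ * inner ℝ (C.Astar i G x) (U x))
        (iG.sub iA) iU,
      integral_sub iG iA,
      integral_add (f := fun x => (inner ℝ (w' x) (U x) - inner ℝ (w'' x) (U x) : ℝ))
        (g := fun x => (inner ℝ (q' x) (U x) - inner ℝ (q'' x) (U x) : ℝ))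
        (iw'.sub iw'') (iq'.sub iq''), integral_sub iw' iw'', integral_sub iq' iq'',
      ew', ew'', eq', eq'', integral_const_mul, integral_const_mul, integral_const_mul, hGreen]
    ring
  exact e1

end EllipticComplex

/-! ### Uniqueness -/

section EnergyDerivative

set_option linter.unusedSectionVars false

variable {n : ℕ} {X : Type*} [TopologicalSpace X] [CompactSpace X] [ChartedSpace (Model n) X]
  [MeasurableSpace X] [BorelSpace X] {vol : Measure X} [IsFiniteMeasure vol]
  {F : Type*} [NormedAddCommGroup F] [NormedSpace ℝ F]
  {E : X → Type*} [TopologicalSpace (TotalSpace F E)]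
  [∀ x, NormedAddCommGroup (E x)] [∀ x, InnerProductSpace ℝ (E x)] [FiberBundle F E]
  [VectorBundle ℝ F E] [IsContinuousRiemannianBundle F E] {T : ℝ}

/-- The derivative of the `L²` norm of a time dependent section. -/
lemma hasDerivAt_integral_inner_self {u D : ℝ → ∀ x, E x}
    (hu : ∀ t ∈ Icc 0 T, Continuous fun x => TotalSpace.mk' F x (u t x))
    (hD : ∀ t ∈ Icc 0 T, Continuous fun x => TotalSpace.mk' F x (D t x))
    (hder : ∀ t ∈ Ioo 0 T, ∀ x, HasDerivAt (fun s => u s x) (D t x) t) {K : ℝ} (hK : 0 ≤ K)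
    (hub : ∀ t ∈ Icc 0 T, ∀ x, ‖u t x‖ ≤ K) (hDb : ∀ t ∈ Icc 0 T, ∀ x, ‖D t x‖ ≤ K) {t : ℝ}
    (ht : t ∈ Ioo 0 T) :
    HasDerivAt (fun s => ∫ x, inner ℝ (u s x) (u s x) ∂vol)
      (2 * ∫ x, inner ℝ (D t x) (u t x) ∂vol) t := by
  have hIcc : ∀ {s}, s ∈ Ioo 0 T → s ∈ Icc 0 T := fun hs => Ioo_subset_Icc_self hs
  have h := hasDerivAt_integral_of_dominated_loc_of_deriv_le (μ := vol) (bound := fun _ => 2 * (K * K))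
    (F := fun s x => (inner ℝ (u s x) (u s x) : ℝ))
    (F' := fun s x => (2 * inner ℝ (D s x) (u s x) : ℝ)) (x₀ := t) (s := Ioo 0 T)
    (Ioo_mem_nhds ht.1 ht.2)
    (Filter.eventually_of_mem (Ioo_mem_nhds ht.1 ht.2) fun s hs =>
      (integrable_inner_section vol (hu s (hIcc hs)) (hu s (hIcc hs))).aestronglyMeasurable)
    (integrable_inner_section vol (hu t (hIcc ht)) (hu t (hIcc ht)))
    ((integrable_inner_section vol (hD t (hIcc ht)) (hu t (hIcc ht))).const_mul
      2).aestronglyMeasurable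
    (Filter.Eventually.of_forall fun x s hs => by
      rw [norm_mul, Real.norm_ofNat]
      have h1 := (norm_inner_le_norm (𝕜 := ℝ) (D s x) (u s x)).trans
        (mul_le_mul (hDb s (hIcc hs) x) (hub s (hIcc hs) x) (norm_nonneg _) hK)
      linarith)
    (integrable_const _)
    (Filter.Eventually.of_forall fun x s hs => by
      have h1 := (hder s hs x).inner ℝ (hder s hs x)
      rw [real_inner_comm (D s x), ← two_mul] at h1
      exact h1)
  rw [← integral_const_mul]
  exact h.2

lemma continuousOn_integral_inner_self {u : ℝ → ∀ x, E x}
    (hu : ∀ t ∈ Icc 0 T, Continuous fun x => TotalSpace.mk' F x (u t x))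
    (hc : ∀ x, ContinuousOn (fun t => u t x) (Icc 0 T)) {K : ℝ} (hK : 0 ≤ K)
    (hub : ∀ t ∈ Icc 0 T, ∀ x, ‖u t x‖ ≤ K) :
    ContinuousOn (fun s => ∫ x, inner ℝ (u s x) (u s x) ∂vol) (Icc 0 T) := by
  refine continuousOn_of_dominated (bound := fun _ => K * K)
    (fun s hs => (integrable_inner_section vol (hu s hs) (hu s hs)).aestronglyMeasurable)
    (fun s hs => Filter.Eventually.of_forall fun x => (norm_inner_le_norm _ _).trans
      (mul_le_mul (hub s hs x) (hub s hs x) (norm_nonneg _) hK)) (integrable_const _)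
    (Filter.Eventually.of_forall fun x => (hc x).inner (hc x))

end EnergyDerivative

namespace EllipticComplex

set_option linter.unusedSectionVars false

variable {n : ℕ} {X : Type*} [TopologicalSpace X] [T2Space X] [CompactSpace X]
  [ChartedSpace (Model n) X] [IsManifold (𝓡 n) ∞ X] [MeasurableSpace X] [BorelSpace X]
  {vol : Measure X}
  {F : ℤ → Type*} [∀ j, NormedAddCommGroup (F j)] [∀ j, NormedSpace ℝ (F j)]
  [∀ j, FiniteDimensional ℝ (F j)]
  {E : ℤ → X → Type*} [∀ j, TopologicalSpace (TotalSpace (F j) (E j))]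
  [∀ j x, NormedAddCommGroup (E j x)] [∀ j x, InnerProductSpace ℝ (E j x)]
  [∀ j, FiberBundle (F j) (E j)] [∀ j, VectorBundle ℝ (F j) (E j)]
  [∀ j, ContMDiffVectorBundle ∞ (F j) (E j) (𝓡 n)]
  [∀ j, IsContinuousRiemannianBundle (F j) (E j)]
  {N : ℕ} {C : EllipticComplex n F E vol N} {i : ℤ}
  {M₁ : ∀ x, E (i + 1) x →ₗ[ℝ] E i x →ₗ[ℝ] E i x} {M₂ : ∀ x, E i x →ₗ[ℝ] E i x →ₗ[ℝ] E (i - 1) x}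
  {μ T : ℝ} {f : ℝ → ∀ x, E i x} {u₀ : ∀ x, E i x} {u' u'' : ℝ → ∀ x, E i x}
  {p' p'' : ℝ → ∀ x, E (i - 1) x}

/-- The velocity is unique, by the energy inequality and Gronwall's lemma. -/
theorem IsSolution.velocity_unique [IsFiniteMeasure vol] (hvol : IsSmoothDensity n vol)
    (hM₁ : ∃ c : ℝ, ∀ (x : X) (v : E (i + 1) x) (u : E i x), ‖M₁ x v u‖ ≤ c * ‖u‖ * ‖v‖)
    (hM₂ : ∃ c : ℝ, ∀ (x : X) (w u : E i x), ‖M₂ x w u‖ ≤ c * ‖u‖ * ‖w‖)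
    (hμ : 0 < μ) (hT : 0 < T) (hf : IsC0 (F i) T f)
    (h' : C.IsSolution i M₁ M₂ μ T f u₀ u' p') (h'' : C.IsSolution i M₁ M₂ μ T f u₀ u'' p'') :
    ∀ t ∈ Icc 0 T, ∀ x, u' t x = u'' t x := by
  obtain ⟨c₁, hM₁⟩ := hM₁
  obtain ⟨c₂, hM₂⟩ := hM₂
  obtain ⟨q', hq', hpq', heq'⟩ := h'.equation
  obtain ⟨q'', hq'', hpq'', heq''⟩ := h''.equation
  have hu' := h'.regular_u
  have hu'' := h''.regular_u
  obtain ⟨k₁, hk₁, b₁⟩ := hu'.isC0.exists_bound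
  obtain ⟨k₂, hk₂, b₂⟩ := hu''.isC0.exists_bound
  obtain ⟨k₃, hk₃, b₃⟩ := (hu''.isC0_apply (C.A i)).exists_bound
  obtain ⟨k₄, hk₄, b₄⟩ := hu'.continuous_timeDeriv.exists_bound
  obtain ⟨k₅, hk₅, b₅⟩ := hu''.continuous_timeDeriv.exists_bound
  have hM₂b : ∀ {u : ∀ x, E i x} {k : ℝ}, 0 ≤ k → (∀ x, ‖u x‖ ≤ k) →
      ∃ c, ∀ x, ‖M₂ x (u x) (u x)‖ ≤ c := by
    intro u k hk hu
    refine ⟨|c₂| * k * k, fun x => (hM₂ x _ _).trans ?_⟩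
    gcongr
    · exact le_abs_self c₂
    · exact hu x
    · exact hu x
  have hcs : ∀ {a b : ∀ x, E i x}, (Continuous fun x => TotalSpace.mk' (F i) x (a x)) →
      (Continuous fun x => TotalSpace.mk' (F i) x (b x)) →
      Continuous fun x => TotalSpace.mk' (F i) x (a x - b x) := by
    intro a b ha hb
    have ha' : IsCk n (F i) 0 a := contMDiff_zero_iff.2 ha
    have hb' : IsCk n (F i) 0 b := contMDiff_zero_iff.2 hb
    exact IsCk.continuous (n := n) (k := 0) fun x => (ha' x).sub (hb' x)
  have hUc : ∀ t ∈ Icc 0 T, Continuous fun x => TotalSpace.mk' (F i) x (u' t x - u'' t x) :=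
    fun t ht => hcs (hu'.isC0.continuous ht) (hu''.isC0.continuous ht)
  have hDc : ∀ t ∈ Icc 0 T, Continuous fun x =>
      TotalSpace.mk' (F i) x (timeDeriv T u' t x - timeDeriv T u'' t x) :=
    fun t ht => hcs (hu'.continuous_timeDeriv.continuous ht) (hu''.continuous_timeDeriv.continuous ht)
  set k := k₁ + k₂ + k₄ + k₅ with hkdef
  have hk : 0 ≤ k := by positivity
  have hUb : ∀ t ∈ Icc 0 T, ∀ x, ‖u' t x - u'' t x‖ ≤ k := fun t ht x =>
    (norm_sub_le _ _).trans ((add_le_add (b₁ t ht x) (b₂ t ht x)).trans (by linarith))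
  have hDb : ∀ t ∈ Icc 0 T, ∀ x, ‖timeDeriv T u' t x - timeDeriv T u'' t x‖ ≤ k := fun t ht x =>
    (norm_sub_le _ _).trans ((add_le_add (b₄ t ht x) (b₅ t ht x)).trans (by linarith))
  have hzero := eq_zero_of_deriv_le_mul
    (h := fun t => ∫ x, inner ℝ (u' t x - u'' t x) (u' t x - u'' t x) ∂vol)
    (c := 2 * (|c₁| * (k₁ + k₃) + (|c₁| * (k₁ + k₃)) ^ 2 / (4 * μ))) hT
    (continuousOn_integral_inner_self hUc (fun x => (hu'.isC0.continuousOn_time x).sub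
      (hu''.isC0.continuousOn_time x)) hk hUb)
    (fun t ht => hasDerivAt_integral_inner_self hUc hDc
      (fun s hs x => (hu'.hasDerivAt hs x).sub (hu''.hasDerivAt hs x)) hk hUb hDb ht)
    (fun t ht => ?_) (fun t _ => integral_nonneg fun x => real_inner_self_nonneg)
    (by simp [h'.initial, h''.initial])
  · intro t ht x
    exact sub_eq_zero.1 (eq_zero_of_integral_inner_self_eq_zero hvol (hUc t ht) (hzero t ht) x)
  · have htI := Ioo_subset_Icc_self ht
    obtain ⟨z', ⟨w', hw', hz'⟩, hE'⟩ := heq' t ht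
    obtain ⟨z'', ⟨w'', hw'', hz''⟩, hE''⟩ := heq'' t ht
    rw [mul_assoc]
    refine mul_le_mul_of_nonneg_left ?_ zero_le_two
    exact C.energy_inequality hvol hμ hM₁ (hu'.isCk htI) (hu''.isCk htI) (h'.div_u t htI)
      (h''.div_u t htI) (fun x => (b₁ t htI x).trans (by linarith))
      (fun x => (b₃ t htI x).trans (by linarith)) (hu'.continuous_timeDeriv.continuous htI)
      (hu''.continuous_timeDeriv.continuous htI) (hf.continuous htI) (hq'.continuous htI)
      (hq''.continuous htI) (h'.continuous_p.continuous htI) (h''.continuous_p.continuous htI)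
      (hpq' t htI) (hpq'' t htI) hw' hw'' (hM₂b hk₁ (b₁ t htI)) (hM₂b hk₂ (b₂ t htI))
      (fun x => by rw [← hz']; exact hE' x) (fun x => by rw [← hz'']; exact hE'' x)

/-- The pressure is unique: the difference of two pressures with the same velocity has vanishing
distributional gradient. -/
theorem IsSolution.pressure_unique [∀ j, IsContMDiffRiemannianBundle (𝓡 n) ∞ (F j) (E j)]
    [IsFiniteMeasure vol] (hvol : IsSmoothDensity n vol) (hT : 0 < T)
    (h' : C.IsSolution i M₁ M₂ μ T f u₀ u' p') (h'' : C.IsSolution i M₁ M₂ μ T f u₀ u'' p'')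
    (hu : ∀ t ∈ Icc 0 T, ∀ x, u' t x = u'' t x) :
    ∀ t ∈ Icc 0 T, ∀ x, p' t x = p'' t x := by
  obtain ⟨q', hq', hpq', heq'⟩ := h'.equation
  obtain ⟨q'', hq'', hpq'', heq''⟩ := h''.equation
  have hopen : ∀ x, ∀ t ∈ Ioo 0 T, p' t x = p'' t x := by
    intro x t ht
    have htI := Ioo_subset_Icc_self ht
    obtain ⟨z', ⟨w', hw', hz'⟩, hE'⟩ := heq' t ht
    obtain ⟨z'', ⟨w'', hw'', hz''⟩, hE''⟩ := heq'' t ht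
    have hut : u' t = u'' t := funext (hu t htI)
    have hDt : ∀ x, timeDeriv T u' t x = timeDeriv T u'' t x := fun x =>
      derivWithin_congr (fun s hs => hu s hs x) (hu t htI x)
    have hwq : ∀ x, q' t x - q'' t x = w'' x - w' x := by
      intro x
      have h := (hE' x).trans (hE'' x).symm
      rw [hz', hz'', hDt, hut, ← sub_eq_zero] at h
      rw [← sub_eq_zero, ← h]
      abel
    rw [hut] at hw'
    have hp' := h'.continuous_p.continuous htI
    have hp'' := h''.continuous_p.continuous htI
    have hp0' : IsCk n (F (i - 1)) 0 (p' t) := contMDiff_zero_iff.2 hp'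
    have hp0'' : IsCk n (F (i - 1)) 0 (p'' t) := contMDiff_zero_iff.2 hp''
    have hpc : Continuous fun x => TotalSpace.mk' (F (i - 1)) x (p' t x - p'' t x) :=
      IsCk.continuous (n := n) (k := 0) fun x => (hp0' x).sub (hp0'' x)
    refine sub_eq_zero.1 (C.eq_zero_of_orthogonal_harmonic hvol hpc ?_ ?_ ?_ x)
    · intro φ hφ
      obtain ⟨-, j1, k1⟩ := hpq' t htI φ hφ
      obtain ⟨-, j2, k2⟩ := hpq'' t htI φ hφ
      obtain ⟨i3, -, k3⟩ := hw' φ hφ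
      obtain ⟨i4, -, k4⟩ := hw'' φ hφ
      obtain ⟨i1, -, -⟩ := hpq' t htI φ hφ
      obtain ⟨i2, -, -⟩ := hpq'' t htI φ hφ
      refine ⟨by simp, by simp only [inner_sub_left]; exact j1.sub j2, ?_⟩
      have e1 : ∫ x, inner ℝ (q' t x - q'' t x) (φ x) ∂vol = 0 := by
        simp only [hwq, inner_sub_left]
        rw [integral_sub i4 i3, k3, k4, sub_self]
      simp only [inner_zero_left, integral_zero, inner_sub_left] at e1 ⊢
      rw [integral_sub i1 i2] at e1
      rw [integral_sub j1 j2, ← k1, ← k2, e1]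
    · intro φ hφ
      obtain ⟨-, j1, k1⟩ := h'.div_p t htI φ hφ
      obtain ⟨-, j2, k2⟩ := h''.div_p t htI φ hφ
      refine ⟨by simp, by simp only [inner_sub_left]; exact j1.sub j2, ?_⟩
      simp only [inner_zero_left, integral_zero, inner_sub_left] at k1 k2 ⊢
      rw [integral_sub j1 j2, ← k1, ← k2, sub_zero]
    · intro h hh
      have hhc := IsCk.continuous (n := n) hh.1
      simp only [inner_sub_left]
      rw [integral_sub (integrable_inner_section vol hp' hhc)
        (integrable_inner_section vol hp'' hhc), h'.orthogonal_p t htI h hh,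
        h''.orthogonal_p t htI h hh, sub_zero]
  intro t ht x
  exact Set.EqOn.of_subset_closure (hopen x) (h'.continuous_p.continuousOn_time x)
    (h''.continuous_p.continuousOn_time x) Ioo_subset_Icc_self
    (closure_Ioo hT.ne).symm.subset ht

end EllipticComplex

end NavierStokesComplex

end

open NavierStokesComplex in
theorem theoremt {n : ℕ} {X : Type*} [TopologicalSpace X] [T2Space X] [CompactSpace X]
    [ChartedSpace (EuclideanSpace ℝ (Fin n)) X] [IsManifold (𝓡 n) ∞ X]
    [MeasurableSpace X] [BorelSpace X] (vol : Measure X) (hvol : IsSmoothDensity n vol)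
    {F : ℤ → Type*} [∀ j, NormedAddCommGroup (F j)] [∀ j, NormedSpace ℝ (F j)]
    [∀ j, FiniteDimensional ℝ (F j)]
    {E : ℤ → X → Type*} [∀ j, TopologicalSpace (TotalSpace (F j) (E j))]
    [∀ j x, NormedAddCommGroup (E j x)] [∀ j x, InnerProductSpace ℝ (E j x)]
    [∀ j, FiberBundle (F j) (E j)] [∀ j, VectorBundle ℝ (F j) (E j)]
    [∀ j, ContMDiffVectorBundle ∞ (F j) (E j) (𝓡 n)]
    [∀ j, IsContMDiffRiemannianBundle (𝓡 n) ∞ (F j) (E j)]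
    {N : ℕ} (C : EllipticComplex n F E vol N)
    (i : ℤ) (hi₀ : 0 ≤ i) (hiN : i ≤ N)
    (M₁ : ∀ x, E (i + 1) x →ₗ[ℝ] E i x →ₗ[ℝ] E i x)
    (M₂ : ∀ x, E i x →ₗ[ℝ] E i x →ₗ[ℝ] E (i - 1) x)
    (hM₁ : ∃ c : ℝ, ∀ (x : X) (v : E (i + 1) x) (u : E i x), ‖M₁ x v u‖ ≤ c * ‖u‖ * ‖v‖)
    (hM₂ : ∃ c : ℝ, ∀ (x : X) (w u : E i x), ‖M₂ x w u‖ ≤ c * ‖u‖ * ‖w‖)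
    (μ T : ℝ) (hμ : 0 < μ) (hT : 0 < T)
    (f : ℝ → ∀ x, E i x) (hf : IsC0 (F i) T f)
    (u₀ : ∀ x, E i x) (hu₀ : Continuous (fun x => TotalSpace.mk' (F i) x (u₀ x)))
    (hu₀' : C.InKerAprevStar i u₀)
    (u' u'' : ℝ → ∀ x, E i x) (p' p'' : ℝ → ∀ x, E (i - 1) x)
    (h' : C.IsSolution i M₁ M₂ μ T f u₀ u' p')
    (h'' : C.IsSolution i M₁ M₂ μ T f u₀ u'' p'') :
    ∀ t ∈ Icc 0 T, ∀ x, u' t x = u'' t x ∧ p' t x = p'' t x := by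
  have : IsFiniteMeasure vol := hvol.isFiniteMeasure
  have : ∀ j, IsContinuousRiemannianBundle (F j) (E j) := fun j =>
    isContinuousRiemannianBundle n (F j) (E j)
  have hu := EllipticComplex.IsSolution.velocity_unique hvol hM₁ hM₂ hμ hT hf h' h''
  have hp := EllipticComplex.IsSolution.pressure_unique hvol hT h' h'' hu
  exact fun t ht x => ⟨hu t ht x, hp t ht x⟩
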